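/- **Setting.** Fix $P\in\mathbb N$ and a finite-dimensional internal space $\mathbb C^{\iota}$, described below for each class. Let $\sigma_x,\sigma_y,\sigma_z$ be the Pauli matrices; write $\nu_\alpha,\sigma_\alpha,\tau_\alpha$ for the Pauli matrix $\sigma_\alpha$ acting on the sublattice index $\nu$, the spin index $\sigma$, the Nambu index $\tau$ respectively (and as the identity on the other internal indices), each of these indices taking two values, and let $p\in\{1,\dots,P\}$. Let $M^*$ be the entrywise complex conjugate of $M$. An internal matrix $M$ satisfies the constraints of * **AIII** (indices $(\nu,p)$) if $\nu_zM\nu_z=-M$; * **BDI** (indices $(\sigma,\nu,p)$) if $M$ commutes with $\sigma_x,\sigma_y,\sigma_z$, $\sigma_yM^*\sigma_y=M$ and $\nu_zM\nu_z=-M$; * **CII** (indices $(\nu,\sigma,p)$) if $\sigma_yM^*\sigma_y=M$ and $\nu_zM\nu_z=-M$; * **D** (indices $(\tau,p)$) if $\tau_xM^*\tau_x=-M$; * **DIII** (indices $(\tau,\sigma,p)$) if $\tau_xM^*\tau_x=-M$ and $\sigma_yM^*\sigma_y=M$. Let $X$ be one of these classes. Let $h_r$ ($r\in\mathbb Z$)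 be internal matrices, only finitely many nonzero, each satisfying the constraints of $X$, with $h_{-r}=h_r^\dagger$. The Bloch Hamiltonian is $H_k=\sum_r e^{ikr}h_r$, and it is assumed to be gapped: $\det H_k\neq0$ for all $k\in\mathbb R$. On $\ell^2(\mathbb N)\otimes\mathbb C^\iota$ let $T=\sum_{j\ge0}|j\rangle\langle j+1|$, $T^{-s}:=(T^\dagger)^{s}$ for $s>0$, and $$\widetilde H=\sum_r T^r\otimes h_r .$$ Let $W$ be a finite-rank Hermitian (bounded) operator on $\ell^2(\mathbb N)\otimes\mathbb C^\iota$ in class $X$, i.e. all its internal blocks $\langle j|W|j'\rangle$ satisfy the constraints of $X$. **The block $A_k$ of $H_k$.** In AIII and CII, $A_k$ is the lower left block of $H_k=\begin{bmatrix}0&A_k^\dagger\\A_k&0\end{bmatrix}$ in $\nu$-space; in BDI it is the same block of the spin-up block of $H_k$. In D, $U_{\rm D}H_kU_{\rm D}^\dagger=iA_k$ with $U_{\rm D}^\dagger=\frac1{\sqrt2}\begin{bmatrix}1&i\\1&-i\end{bmatrix}$ acting on $\tau$. In DIII, $A_k$ is the lower left block of $U_{\rm DIII}H_kU_{\rm DIII}^\dagger=\begin{bmatrix}0&A_k^\dagger\\A_k&0\end{bmatrix}$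 with $$U_{\rm DIII}^\dagger=\frac1{\sqrt2}\begin{bmatrix}0&-i&-i&0\\1&0&0&-1\\i&0&0&i\\0&-1&1&0\end{bmatrix}$$ acting on $(\tau,\sigma)$ in the order $(0,\uparrow),(0,\downarrow),(1,\uparrow),(1,\downarrow)$. **Bulk invariant $Q^B(H)$.** * AIII, CII: $\displaystyle\frac1{2\pi i}\int_{-\pi}^{\pi}dk\,\frac{d}{dk}\log\det A_k$; BDI: $\displaystyle\frac1{\pi i}\int_{-\pi}^{\pi}dk\,\frac{d}{dk}\log\det A_k$; * D: $\displaystyle\operatorname{sgn}\left[\frac{\operatorname{Pf}A_{k=0}}{\operatorname{Pf}A_{k=\pi}}\right]$; * DIII: $\displaystyle\frac{\operatorname{Pf}A_{k=0}}{\operatorname{Pf}A_{k=\pi}}\exp\left(\frac12\int_0^\pi dk\,\frac{d}{dk}\log\det A_k\right)$. Here $\frac{d}{dk}\log f=f'/f$, and $\operatorname{Pf}$ is the Pfaffian. **Boundary invariant $Q^\partial(\widetilde H+W)$.** Let $\mathcal N=\dim\operatorname{Ker}(\widetilde H+W)$ and, in the classes AIII, BDI and CII, let $\mathcal N_{\nu=0}$,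 $\mathcal N_{\nu=1}$ be the dimensions of the subspaces of $\operatorname{Ker}(\widetilde H+W)$ on which $1\otimes\nu_z$ equals $+1$, $-1$ respectively. Then $Q^\partial=\mathcal N_{\nu=0}-\mathcal N_{\nu=1}$ in AIII, BDI, CII, $Q^\partial=(-1)^{\mathcal N}$ in D, and $Q^\partial=(-1)^{\mathcal N/2}$ in DIII. **Theorem (bulk-boundary correspondence).** For each of the five classes, the kernel of $\widetilde H+W$ is finite-dimensional (and of even dimension in class DIII), and $$Q^\partial(\widetilde H+W)=Q^B(H).$$ -/

import Mathlib

open scoped Matrix Kronecker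

noncomputable section

namespace BBC

/-! ## The half-line Hilbert space and banded block-Toeplitz operators -/

/-- The Hilbert space `ℓ²(ℕ) ⊗ ℂ^ι` of a half-infinite strip whose sites `j = 0, 1, 2, …` carry
internal states labelled by `ι`. -/
abbrev HalfLine (ι : Type*) [Fintype ι] : Type _ :=
  lp (fun _ : ℕ => EuclideanSpace ℂ ι) 2

section Operators

variable {ι : Type*} [Fintype ι]

theorem summable_sq (ψ : HalfLine ι) : Summable fun j => ‖ψ j‖ ^ 2 := by
  simpa using (lp.memℓp ψ).summable (by norm_num)

theorem norm_sq_eq (ψ : HalfLine ι) : ‖ψ‖ ^ 2 = ∑' j, ‖ψ j‖ ^ 2 := by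
  simpa using lp.norm_rpow_eq_tsum (p := 2) (by norm_num) ψ

theorem memℓp_two {f : ℕ → EuclideanSpace ℂ ι} (hf : Summable fun j => ‖f j‖ ^ 2) :
    Memℓp f 2 :=
  memℓp_gen (by simpa using hf)

theorem norm_le_of_sq {ψ : HalfLine ι} {C : ℝ} (hC : 0 ≤ C) (h : ∑' j, ‖ψ j‖ ^ 2 ≤ C ^ 2) :
    ‖ψ‖ ≤ C := by
  rw [← norm_sq_eq] at h
  exact (sq_le_sq₀ (norm_nonneg _) hC).1 h

/-- The left shift `T ⊗ 1`, `T = ∑_j |j⟩⟨j+1|`. -/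
def shift : HalfLine ι →L[ℂ] HalfLine ι :=
  LinearMap.mkContinuous
    { toFun := fun ψ => ⟨fun j => ψ (j + 1),
        memℓp_two ((summable_nat_add_iff 1).2 (summable_sq ψ))⟩
      map_add' := fun _ _ => rfl
      map_smul' := fun _ _ => rfl } 1 <| by
    intro ψ
    rw [one_mul]
    refine norm_le_of_sq (norm_nonneg _) ?_
    rw [norm_sq_eq]
    have h := (summable_sq ψ).tsum_eq_zero_add
    have h0 : 0 ≤ ‖ψ 0‖ ^ 2 := by positivity
    change ∑' j, ‖ψ (j + 1)‖ ^ 2 ≤ _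
    linarith

variable [DecidableEq ι]

/-- The on-site operator `1 ⊗ a`. -/
def onSite (a : Matrix ι ι ℂ) : HalfLine ι →L[ℂ] HalfLine ι :=
  have key : ∀ (ψ : HalfLine ι) (j : ℕ), ‖Matrix.toEuclideanCLM (𝕜 := ℂ) a (ψ j)‖ ^ 2 ≤
      ‖Matrix.toEuclideanCLM (𝕜 := ℂ) a‖ ^ 2 * ‖ψ j‖ ^ 2 := fun ψ j => by
    rw [← mul_pow]
    gcongr
    exact ContinuousLinearMap.le_opNorm _ _
  have summ : ∀ ψ : HalfLine ι,
      Summable fun j => ‖Matrix.toEuclideanCLM (𝕜 := ℂ) a (ψ j)‖ ^ 2 := fun ψ =>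
    Summable.of_nonneg_of_le (fun _ => by positivity) (key ψ) ((summable_sq ψ).mul_left _)
  LinearMap.mkContinuous
    { toFun := fun ψ => ⟨fun j => Matrix.toEuclideanCLM (𝕜 := ℂ) a (ψ j), memℓp_two (summ ψ)⟩
      map_add' := fun ψ φ => by
        ext1; funext j
        exact map_add (Matrix.toEuclideanCLM (𝕜 := ℂ) a) (ψ j) (φ j)
      map_smul' := fun c ψ => by
        ext1; funext j
        exact map_smul (Matrix.toEuclideanCLM (𝕜 := ℂ) a) c (ψ j) }
    ‖Matrix.toEuclideanCLM (𝕜 := ℂ) a‖ <| by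
    intro ψ
    refine norm_le_of_sq (by positivity) ?_
    rw [mul_pow, norm_sq_eq, ← tsum_mul_left]
    exact (summ ψ).tsum_le_tsum (key ψ) ((summable_sq ψ).mul_left _)

/-- `T^r ⊗ 1` for `r ≥ 0` and `(T†)^|r| ⊗ 1` for `r < 0`. -/
def shiftPow (r : ℤ) : HalfLine ι →L[ℂ] HalfLine ι :=
  if 0 ≤ r then shift ^ r.natAbs else (ContinuousLinearMap.adjoint shift) ^ r.natAbs

/-- The banded block-Toeplitz operator `∑_r T^r ⊗ h_r` with finitely many nonzero coefficients
`h_r`. -/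
def toeplitz (h : ℤ →₀ Matrix ι ι ℂ) : HalfLine ι →L[ℂ] HalfLine ι :=
  h.sum fun r a => shiftPow r ∘L onSite a

/-- The internal block `⟨j| W |j'⟩` of an operator on the half-line. -/
def block (W : HalfLine ι →L[ℂ] HalfLine ι) (j j' : ℕ) : Matrix ι ι ℂ :=
  Matrix.of fun a b => W (lp.single 2 j' (EuclideanSpace.single b 1)) j a

end Operators

/-! ## Bloch Hamiltonians and boundary terms in a symmetry class

A symmetry class is specified by the set `S` of internal matrices that satisfy its on-site
constraints. All classifying symmetries act on the internal space only, so that an operator on the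
lattice has them if and only if all its internal blocks have them. -/

section Classes

variable {ι : Type*} [Fintype ι] [DecidableEq ι]

/-- The Bloch Hamiltonian `H_k = ∑_r e^{ikr} h_r`. -/
def bloch (h : ℤ →₀ Matrix ι ι ℂ) (k : ℝ) : Matrix ι ι ℂ :=
  h.sum fun r a => Complex.exp (Complex.I * k * r) • a

/-- `h` is the family of hopping matrices of a gapped (at zero energy) Hermitian Bloch Hamiltonian
with the on-site symmetries `S`. -/
structure IsGappedBloch (S : Set (Matrix ι ι ℂ)) (h : ℤ →₀ Matrix ι ι ℂ) : Prop where
  hermitian : ∀ r, h (-r) = (h r)ᴴ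
  symmetric : ∀ r, h r ∈ S
  gapped : ∀ k : ℝ, (bloch h k).det ≠ 0

/-- `W` is a finite-rank Hermitian operator with the on-site symmetries `S`. -/
structure IsBoundaryTerm (S : Set (Matrix ι ι ℂ)) (W : HalfLine ι →L[ℂ] HalfLine ι) : Prop where
  hermitian : IsSelfAdjoint W
  symmetric : ∀ j j', block W j j' ∈ S
  finiteRank : FiniteDimensional ℂ W.range

end Classes

/-- Entrywise complex conjugate of a matrix. -/
def conj {m n : Type*} (M : Matrix m n ℂ) : Matrix m n ℂ := M.map (starRingEnd ℂ)

def pauliX : Matrix (Fin 2) (Fin 2) ℂ := !![0, 1; 1, 0]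

def pauliY : Matrix (Fin 2) (Fin 2) ℂ := !![0, -Complex.I; Complex.I, 0]

def pauliZ : Matrix (Fin 2) (Fin 2) ℂ := !![1, 0; 0, -1]

/-! Internal labels: `ν` (sublattice), `σ` (spin) and `τ` (Nambu) range over `Fin 2`; the remaining
internal label ranges over `Fin P`. In classes AIII, BDI, CII the matrices are those of the
single-particle Hamiltonian, in classes D, DIII those of the Bogoliubov-de Gennes Hamiltonian. -/

/-- Class AIII, internal labels `(ν, p)`: sublattice symmetry `ν_z M ν_z = -M`. -/
def classAIII (P : ℕ) : Set (Matrix (Fin 2 × Fin P) (Fin 2 × Fin P) ℂ) :=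
  {M | (pauliZ ⊗ₖ 1) * M * (pauliZ ⊗ₖ 1) = -M}

/-- Class BDI, internal labels `(σ, ν, p)`: invariance under spin rotations, time reversal
`σ_y M^* σ_y = M` and sublattice symmetry `ν_z M ν_z = -M`. -/
def classBDI (P : ℕ) : Set (Matrix (Fin 2 × Fin 2 × Fin P) (Fin 2 × Fin 2 × Fin P) ℂ) :=
  {M | Commute (pauliX ⊗ₖ 1) M ∧ Commute (pauliY ⊗ₖ 1) M ∧ Commute (pauliZ ⊗ₖ 1) M ∧
    (pauliY ⊗ₖ 1) * conj M * (pauliY ⊗ₖ 1) = M ∧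
    (1 ⊗ₖ (pauliZ ⊗ₖ 1)) * M * (1 ⊗ₖ (pauliZ ⊗ₖ 1)) = -M}

/-- Class CII, internal labels `(ν, σ, p)`: time reversal `σ_y M^* σ_y = M` and sublattice symmetry
`ν_z M ν_z = -M`. -/
def classCII (P : ℕ) : Set (Matrix (Fin 2 × Fin 2 × Fin P) (Fin 2 × Fin 2 × Fin P) ℂ) :=
  {M | (1 ⊗ₖ (pauliY ⊗ₖ 1)) * conj M * (1 ⊗ₖ (pauliY ⊗ₖ 1)) = M ∧
    (pauliZ ⊗ₖ 1) * M * (pauliZ ⊗ₖ 1) = -M}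

/-- Class D, internal labels `(τ, p)`: the Fermi constraint `τ_x M^* τ_x = -M`. -/
def classD (P : ℕ) : Set (Matrix (Fin 2 × Fin P) (Fin 2 × Fin P) ℂ) :=
  {M | (pauliX ⊗ₖ 1) * conj M * (pauliX ⊗ₖ 1) = -M}

/-- Class DIII, internal labels `((τ, σ), p)`: the Fermi constraint `τ_x M^* τ_x = -M` and time
reversal `σ_y M^* σ_y = M`. -/
def classDIII (P : ℕ) : Set (Matrix ((Fin 2 × Fin 2) × Fin P) ((Fin 2 × Fin 2) × Fin P) ℂ) :=
  {M | ((pauliX ⊗ₖ 1) ⊗ₖ 1) * conj M * ((pauliX ⊗ₖ 1) ⊗ₖ 1) = -M ∧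
    ((1 ⊗ₖ pauliY) ⊗ₖ 1) * conj M * ((1 ⊗ₖ pauliY) ⊗ₖ 1) = M}

/-! ## The block `A` of a Hamiltonian -/

/-- The lower left block of a matrix: in classes AIII and CII, `H = [[0, A†], [A, 0]]`. -/
def lowerLeft {κ : Type*} (M : Matrix (Fin 2 × κ) (Fin 2 × κ) ℂ) : Matrix κ κ ℂ :=
  Matrix.of fun a b => M (1, a) (0, b)

/-- In class BDI, `A` is the lower left block in the sublattice space of the spin-up block of `H`. -/
def blockBDI {κ : Type*} (M : Matrix (Fin 2 × Fin 2 × κ) (Fin 2 × Fin 2 × κ) ℂ) : Matrix κ κ ℂ :=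
  Matrix.of fun a b => M (0, 1, a) (0, 0, b)

/-- The adjoint of the unitary matrix that takes a class D Hamiltonian to its Majorana form. -/
def UDadj : Matrix (Fin 2) (Fin 2) ℂ :=
  ((1 / Real.sqrt 2 : ℝ) : ℂ) • !![1, Complex.I; 1, -Complex.I]

/-- In class D, `U_D H U_D† = iA`. -/
def blockD {P : ℕ} (M : Matrix (Fin 2 × Fin P) (Fin 2 × Fin P) ℂ) :
    Matrix (Fin 2 × Fin P) (Fin 2 × Fin P) ℂ :=
  (-Complex.I) • ((UDadjᴴ ⊗ₖ 1) * M * (UDadj ⊗ₖ 1))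

/-- The adjoint of the unitary matrix that takes a class DIII Hamiltonian to block off-diagonal
form; rows are ordered as `(τ, σ) = (0, ↑), (0, ↓), (1, ↑), (1, ↓)`. -/
def UDIIIadj : Matrix (Fin 2 × Fin 2) (Fin 2 × Fin 2) ℂ :=
  ((1 / Real.sqrt 2 : ℝ) : ℂ) • Matrix.submatrix
    (!![0, -Complex.I, -Complex.I, 0;
        1, 0, 0, -1;
        Complex.I, 0, 0, Complex.I;
        0, -1, 1, 0] : Matrix (Fin (2 * 2)) (Fin (2 * 2)) ℂ)
    finProdFinEquiv finProdFinEquiv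

/-- In class DIII, `U_DIII H U_DIII† = [[0, A†], [A, 0]]`. -/
def blockDIII {P : ℕ} (M : Matrix ((Fin 2 × Fin 2) × Fin P) ((Fin 2 × Fin 2) × Fin P) ℂ) :
    Matrix (Fin 2 × Fin P) (Fin 2 × Fin P) ℂ :=
  let N : Matrix ((Fin 2 × Fin 2) × Fin P) ((Fin 2 × Fin 2) × Fin P) ℂ :=
    (UDIIIadjᴴ ⊗ₖ 1) * M * (UDIIIadj ⊗ₖ 1)
  Matrix.of fun a b => N ((1, a.1), a.2) ((0, b.1), b.2)

/-! ## Bulk invariants, as functions of the block `A_k` of the Bloch Hamiltonian -/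

/-- The Pfaffian of an antisymmetric matrix of order `2n`:
`(2^n n!)⁻¹ ∑_s sgn(s) ∏_{i < n} M_{s(2i), s(2i+1)}`. -/
def pfaffian {n : ℕ} (M : Matrix (Fin (2 * n)) (Fin (2 * n)) ℂ) : ℂ :=
  ((2 : ℂ) ^ n * (n.factorial : ℂ))⁻¹ *
    ∑ s : Equiv.Perm (Fin (2 * n)), ((Equiv.Perm.sign s : ℤ) : ℂ) *
      ∏ i : Fin n, M (s ⟨2 * i, by omega⟩) (s ⟨2 * i + 1, by omega⟩)

/-- The Pfaffian of a matrix with rows and columns labelled by pairs, in dictionary order. -/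
def pf {P : ℕ} (M : Matrix (Fin 2 × Fin P) (Fin 2 × Fin P) ℂ) : ℂ :=
  pfaffian (M.submatrix finProdFinEquiv.symm finProdFinEquiv.symm)

/-- The winding number `(2πi)⁻¹ ∫_{-π}^{π} dk (d/dk) log det A_k`. -/
def winding {κ : Type*} [Fintype κ] [DecidableEq κ] (A : ℝ → Matrix κ κ ℂ) : ℂ :=
  (2 * Real.pi * Complex.I)⁻¹ *
    ∫ k in (-Real.pi)..Real.pi, logDeriv (fun k' : ℝ => (A k').det) k

/-- The sign of a nonzero real number, extended to complex numbers as `z / |z|`. -/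
def sgn (z : ℂ) : ℂ := z / ‖z‖

/-- The bulk invariant of class AIII. -/
def bulkAIII {P : ℕ} (h : ℤ →₀ Matrix (Fin 2 × Fin P) (Fin 2 × Fin P) ℂ) : ℂ :=
  winding fun k => lowerLeft (bloch h k)

/-- The bulk invariant of class BDI; the factor `2` accounts for the two identical spin blocks. -/
def bulkBDI {P : ℕ} (h : ℤ →₀ Matrix (Fin 2 × Fin 2 × Fin P) (Fin 2 × Fin 2 × Fin P) ℂ) : ℂ :=
  2 * winding fun k => blockBDI (bloch h k)

/-- The bulk invariant of class CII. -/
def bulkCII {P : ℕ} (h : ℤ →₀ Matrix (Fin 2 × Fin 2 × Fin P) (Fin 2 × Fin 2 × Fin P) ℂ) : ℂ :=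
  winding fun k => lowerLeft (bloch h k)

/-- The bulk invariant of class D, `sgn (Pf A_{k=0} / Pf A_{k=π})`. -/
def bulkD {P : ℕ} (h : ℤ →₀ Matrix (Fin 2 × Fin P) (Fin 2 × Fin P) ℂ) : ℂ :=
  sgn (pf (blockD (bloch h 0)) / pf (blockD (bloch h Real.pi)))

/-- The bulk invariant of class DIII,
`(Pf A_{k=0} / Pf A_{k=π}) exp (1/2 ∫_0^π dk (d/dk) log det A_k)`. -/
def bulkDIII {P : ℕ}
    (h : ℤ →₀ Matrix ((Fin 2 × Fin 2) × Fin P) ((Fin 2 × Fin 2) × Fin P) ℂ) : ℂ :=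
  pf (blockDIII (bloch h 0)) / pf (blockDIII (bloch h Real.pi)) *
    Complex.exp (1 / 2 *
      ∫ k in (0 : ℝ)..Real.pi, logDeriv (fun k' : ℝ => (blockDIII (bloch h k')).det) k)

/-! ## Boundary invariants -/

section Boundary

variable {ι : Type*} [Fintype ι] [DecidableEq ι]

/-- The space of zero modes, that is, of square-summable vectors of zero energy. -/
def zeroModes (H : HalfLine ι →L[ℂ] HalfLine ι) : Submodule ℂ (HalfLine ι) :=
  LinearMap.ker H.toLinearMap

/-- `N_{ν=0} - N_{ν=1}`: the number of zero modes of chirality `+1` minus the number of zero modes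
of chirality `-1`, with respect to the chiral operator `1 ⊗ Γ`. -/
def chiralBoundary (Γ : Matrix ι ι ℂ) (H : HalfLine ι →L[ℂ] HalfLine ι) : ℤ :=
  (Module.finrank ℂ
      ↥(zeroModes H ⊓ Module.End.eigenspace (onSite Γ).toLinearMap 1) : ℤ) -
    (Module.finrank ℂ
      ↥(zeroModes H ⊓ Module.End.eigenspace (onSite Γ).toLinearMap (-1)) : ℤ)

/-- The number `N` of zero modes. -/
def numZeroModes (H : HalfLine ι →L[ℂ] HalfLine ι) : ℕ :=
  Module.finrank ℂ (zeroModes H)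

end Boundary

end BBC

end

/-! Two facts about half-line operators carry the theorem: an index formula for the chiral classes
and a mod 2 formula for the superconducting ones.

Index. A banded block Toeplitz operator is a polynomial in the left shift times a power of the right
shift. Zeros of the determinant of the symbol are split off one at a time, each as a factor `X - C
ζ` in a single internal state; such a factor contributes to the Fredholm index exactly when `ζ` lies
in the open unit disc (`isFredholm_polyOp`). The argument principle counts the same zeros, so the
index is the winding number (`index_toeplitz`), and finite-rank terms do not change it. In AIII, BDI
and CII the sublattice symmetry makes the Hamiltonian off-diagonal. Zero modes of the two
chiralities are the kernels of its block and of the adjoint block, and the difference of their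
dimensions is the index of the block (`IsSplitting.chiralBoundary_eq`).

Parity. In D and DIII the block is a complex skew-symmetric operator. For an alternating form
satisfying a Fredholm alternative, each further independent linear condition changes the dimension
of the radical by exactly one (`Solvable.inf_ker`). Hence the parity of the kernel of a
skew-symmetric Fredholm operator is stable under skew-symmetric finite-rank perturbations, and
passing from `F` to `Kᵀ F K` shifts it by the index of `K`.

To compute this parity, regard the symbol `A` as a skew-hermitian matrix over the Laurent
polynomials with involution `z ↦ z⁻¹`. Every invariant Laurent polynomial is a norm, so isotropic
vectors exist, and induction on the size yields `g A g† = d J d†` with `J` the constant standard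
skew matrix and `det g`, `det d` without zeros on the circle (`isHyperbolic`). Toeplitz operators
respect this identity (`toeplitz_congruence`) and `J` is invertible, so the parity is that of the
number of zeros of `det g` and `det d` in the disc. At `z = ±1` the involution is invisible and
Pfaffians change by `det g` and `det d`; the exponential of half the integral along the upper half
circle supplies the signs of the zeros (`exp_half_integral_onCircle`). This is the DIII formula.
There the kernel of the Hamiltonian is the sum of the kernels of the block and its adjoint, which
have equal dimension, whence the exponent `N / 2`. In class D the determinant is real, the
exponential is positive, and only the sign of the Pfaffian quotient remains. -/

set_option linter.unusedSectionVars false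

noncomputable section

namespace BBC

/-! ## The index of a linear map -/

section Index

variable {K U V W : Type*} [Field K] [AddCommGroup U] [Module K U] [AddCommGroup V] [Module K V]
  [AddCommGroup W] [Module K W]

/-- The index `dim ker f - dim coker f`. -/
def index (f : V →ₗ[K] W) : ℤ :=
  (Module.finrank K (LinearMap.ker f) : ℤ) - Module.finrank K (W ⧸ LinearMap.range f)

/-- `f` has finite-dimensional kernel and cokernel. -/
structure FiniteDefect (f : V →ₗ[K] W) : Prop where
  ker : FiniteDimensional K (LinearMap.ker f)
  coker : FiniteDimensional K (W ⧸ LinearMap.range f)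

theorem finiteDimensional_of_ker_range {f : V →ₗ[K] W} (h₁ : FiniteDimensional K (LinearMap.ker f))
    (h₂ : FiniteDimensional K (LinearMap.range f)) : FiniteDimensional K V := by
  have : FiniteDimensional K (V ⧸ LinearMap.ker f) :=
    Module.Finite.equiv f.quotKerEquivRange.symm
  exact Module.Finite.of_submodule_quotient (LinearMap.ker f)

/-- The maps `ψ`, `φ`, `γ`, `π` form the exact sequence `0 → ker f → ker gf → ker g → coker f →
coker gf → coker g → 0`. Exactness gives finiteness of the two terms for `gf`, and the alternating
sum of dimensions gives additivity. -/
theorem FiniteDefect.comp_and_index_comp {g : V →ₗ[K] W} {f : U →ₗ[K] V} (hg : FiniteDefect g)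
    (hf : FiniteDefect f) : FiniteDefect (g ∘ₗ f) ∧ index (g ∘ₗ f) = index g + index f := by
  have := hg.ker
  have := hg.coker
  have := hf.ker
  have := hf.coker
  let ψ : LinearMap.ker (g ∘ₗ f) →ₗ[K] LinearMap.ker g :=
    f.restrict (fun x hx => by simpa using hx)
  let φ : LinearMap.ker g →ₗ[K] V ⧸ LinearMap.range f :=
    (LinearMap.range f).mkQ ∘ₗ (LinearMap.ker g).subtype
  let γ : (V ⧸ LinearMap.range f) →ₗ[K] W ⧸ LinearMap.range (g ∘ₗ f) :=
    (LinearMap.range f).mapQ _ g (by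
      rintro _ ⟨x, rfl⟩
      exact ⟨x, rfl⟩)
  let π : (W ⧸ LinearMap.range (g ∘ₗ f)) →ₗ[K] W ⧸ LinearMap.range g :=
    Submodule.factor (LinearMap.range_comp_le_range f g)
  have hψ : LinearMap.range ψ = LinearMap.ker φ := by
    ext ⟨y, hy⟩
    simp only [LinearMap.mem_range, LinearMap.mem_ker, φ, LinearMap.comp_apply,
      Submodule.subtype_apply, Submodule.mkQ_apply, Submodule.Quotient.mk_eq_zero]
    constructor
    · rintro ⟨⟨x, hx⟩, h⟩
      exact ⟨x, congrArg Subtype.val h⟩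
    · rintro ⟨x, rfl⟩
      exact ⟨⟨x, by simpa using hy⟩, rfl⟩
  have hφ : LinearMap.range φ = LinearMap.ker γ := by
    ext y
    obtain ⟨y, rfl⟩ := Submodule.Quotient.mk_surjective _ y
    simp only [LinearMap.mem_range, LinearMap.mem_ker, γ, Submodule.mapQ_apply,
      Submodule.Quotient.mk_eq_zero, φ, LinearMap.comp_apply, Submodule.subtype_apply,
      Submodule.mkQ_apply]
    constructor
    · rintro ⟨⟨x, hx⟩, h⟩
      obtain ⟨u, hu⟩ := (Submodule.Quotient.eq _).1 h
      refine ⟨-u, ?_⟩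
      rw [LinearMap.mem_ker] at hx
      rw [map_neg, hu, map_neg, map_sub]
      simp [hx]
    · rintro ⟨u, hu⟩
      refine ⟨⟨y - f u, by simpa [sub_eq_zero] using hu.symm⟩, ?_⟩
      rw [Submodule.Quotient.eq]
      exact ⟨-u, by simp⟩
  have hγ : LinearMap.range γ = LinearMap.ker π := by
    ext y
    obtain ⟨y, rfl⟩ := Submodule.Quotient.mk_surjective _ y
    have hy : y ∈ LinearMap.range g ↔ Submodule.Quotient.mk y ∈ LinearMap.ker π :=
      (Submodule.Quotient.mk_eq_zero _).symm
    rw [← hy]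
    constructor
    · rintro ⟨x, hx⟩
      obtain ⟨x, rfl⟩ := Submodule.Quotient.mk_surjective _ x
      obtain ⟨u, hu⟩ := (Submodule.Quotient.eq _).1 hx
      exact ⟨x - f u, by rw [map_sub, ← LinearMap.comp_apply, hu]; simp⟩
    · rintro ⟨x, rfl⟩
      exact ⟨Submodule.Quotient.mk x, rfl⟩
  have hπ : LinearMap.range π = ⊤ :=
    LinearMap.range_eq_top.2 (Submodule.factor_surjective _)
  let e : LinearMap.ker ψ ≃ₗ[K] LinearMap.ker f :=
    LinearEquiv.ofBijective
      ((((LinearMap.ker (g ∘ₗ f)).subtype).comp (LinearMap.ker ψ).subtype).codRestrict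
        (LinearMap.ker f) fun x => congrArg Subtype.val x.2) <| by
      constructor
      · intro x y h
        exact Subtype.ext (Subtype.ext (Subtype.mk.inj h))
      · rintro ⟨x, hx⟩
        rw [LinearMap.mem_ker] at hx
        exact ⟨⟨⟨x, by simp [hx]⟩, Subtype.ext hx⟩, rfl⟩
  have : FiniteDimensional K (LinearMap.ker ψ) := Module.Finite.equiv e.symm
  have hk : FiniteDimensional K (LinearMap.ker (g ∘ₗ f)) :=
    finiteDimensional_of_ker_range (f := ψ) inferInstance inferInstance
  have hc : FiniteDimensional K (W ⧸ LinearMap.range (g ∘ₗ f)) :=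
    finiteDimensional_of_ker_range (f := π) (hγ ▸ inferInstance) inferInstance
  refine ⟨⟨hk, hc⟩, ?_⟩
  have e₁ := ψ.finrank_range_add_finrank_ker
  have e₂ := φ.finrank_range_add_finrank_ker
  have e₃ := γ.finrank_range_add_finrank_ker
  have e₄ := π.finrank_range_add_finrank_ker
  rw [hψ, e.finrank_eq] at e₁
  rw [hφ] at e₂
  rw [hγ] at e₃
  rw [hπ, finrank_top] at e₄
  simp only [index]
  lia

theorem index_comp {g : V →ₗ[K] W} {f : U →ₗ[K] V} (hg : FiniteDefect g)
    (hf : FiniteDefect f) : index (g ∘ₗ f) = index g + index f :=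
  (hg.comp_and_index_comp hf).2

theorem FiniteDefect.subtype {S : Submodule K V} (hS : FiniteDimensional K (V ⧸ S)) :
    FiniteDefect S.subtype :=
  ⟨by rw [Submodule.ker_subtype]; infer_instance, by rwa [Submodule.range_subtype]⟩

/-- Maps that agree on a subspace of finite codimension have the same index. -/
theorem index_eq_of_eqOn {f g : V →ₗ[K] W} (hf : FiniteDefect f) (hg : FiniteDefect g)
    {S : Submodule K V} (hS : FiniteDimensional K (V ⧸ S)) (h : ∀ x ∈ S, f x = g x) :
    index f = index g := by
  have h' : f ∘ₗ S.subtype = g ∘ₗ S.subtype := by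
    ext x
    exact h x x.2
  -- Restricting to `S` is composing with the inclusion of `S`; its index enters both sides and
  -- cancels.
  have h₁ := index_comp hf (.subtype hS)
  rw [h', index_comp hg (.subtype hS)] at h₁
  linarith

theorem FiniteDefect.of_bijective {f : V →ₗ[K] W} (hf : Function.Bijective f) :
    FiniteDefect f ∧ index f = 0 := by
  have h₁ := LinearMap.ker_eq_bot.2 hf.1
  have h₂ := LinearMap.range_eq_top.2 hf.2
  refine ⟨⟨by rw [h₁]; infer_instance, by rw [h₂]; infer_instance⟩, ?_⟩
  rw [index, h₁, h₂, finrank_bot, Module.finrank_zero_of_subsingleton]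
  simp

theorem finrank_quotient_inf_ker {S : Submodule K V} [FiniteDimensional K (V ⧸ S)]
    {ψ : V →ₗ[K] K} {v : V} (hv : v ∈ S) (hψ : ψ v ≠ 0) :
    FiniteDimensional K (V ⧸ (S ⊓ LinearMap.ker ψ)) ∧
      Module.finrank K (V ⧸ (S ⊓ LinearMap.ker ψ)) = Module.finrank K (V ⧸ S) + 1 := by
  let L : V →ₗ[K] (V ⧸ S) × K := S.mkQ.prod ψ
  have hL : LinearMap.ker L = S ⊓ LinearMap.ker ψ := by
    rw [LinearMap.ker_prod, Submodule.ker_mkQ]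
  have hs : Function.Surjective L := by
    rintro ⟨q, c⟩
    obtain ⟨x, rfl⟩ := Submodule.Quotient.mk_surjective _ q
    refine ⟨x + ((c - ψ x) / ψ v) • v, Prod.ext ?_ ?_⟩
    · change Submodule.Quotient.mk _ = _
      rw [Submodule.Quotient.eq]
      simpa using S.smul_mem _ hv
    · simp [L, hψ]
  have e := L.quotKerEquivOfSurjective hs
  rw [hL] at e
  exact ⟨Module.Finite.equiv e.symm, by simp [e.finrank_eq]⟩

theorem finrank_inf_ker {S : Submodule K V} [FiniteDimensional K S] {ψ : V →ₗ[K] K} {v : V}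
    (hv : v ∈ S) (hψ : ψ v ≠ 0) :
    Module.finrank K ↥(S ⊓ LinearMap.ker ψ) + 1 = Module.finrank K S := by
  have h := (ψ.domRestrict S).finrank_range_add_finrank_ker
  have hr : LinearMap.range (ψ.domRestrict S) = ⊤ := by
    rw [LinearMap.range_eq_top]
    intro c
    exact ⟨(c / ψ v) • ⟨v, hv⟩, by simp [hψ]⟩
  rw [hr, finrank_top, Module.finrank_self, LinearMap.ker_domRestrict] at h
  have hc : Submodule.comap S.subtype (LinearMap.ker ψ) =
      Submodule.comap S.subtype (S ⊓ LinearMap.ker ψ) := by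
    rw [Submodule.comap_inf, Submodule.comap_subtype_self, top_inf_eq]
  rw [hc, (Submodule.comapSubtypeEquivOfLe inf_le_left).finrank_eq] at h
  lia

theorem finrank_sup_span_of_notMem {S : Submodule K V} [FiniteDimensional K S] {v : V}
    (hv : v ∉ S) : Module.finrank K ↥(S ⊔ Submodule.span K {v}) = Module.finrank K S + 1 := by
  have h := Submodule.finrank_sup_add_finrank_inf_eq S (Submodule.span K {v})
  have hv0 : v ≠ 0 := fun h => hv (h ▸ S.zero_mem)
  rw [(Submodule.disjoint_span_singleton' hv0).2 hv |>.eq_bot, finrank_bot,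
    finrank_span_singleton hv0] at h
  exact h

end Index

/-! ## The radical of an alternating form on subspaces of finite codimension -/

section Alternating

variable {K V : Type*} [Field K] [AddCommGroup V] [Module K V]

/-- The radical of the restriction of `B` to `S`. -/
def radical (B : V →ₗ[K] V →ₗ[K] K) (S : Submodule K V) : Submodule K V where
  carrier := {v | v ∈ S ∧ ∀ y ∈ S, B v y = 0}
  add_mem' := fun ⟨h₁, h₂⟩ ⟨h₃, h₄⟩ =>
    ⟨S.add_mem h₁ h₃, fun y hy => by simp [h₂ y hy, h₄ y hy]⟩
  zero_mem' := ⟨S.zero_mem, fun y _ => by simp⟩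
  smul_mem' := fun c _ ⟨h₁, h₂⟩ => ⟨S.smul_mem c h₁, fun y hy => by simp [h₂ y hy]⟩

/-- The radical of `B` on `S` is finite-dimensional, and a functional in `E` that vanishes on it is
represented on `S` by an element of `S`. -/
structure Solvable (B : V →ₗ[K] V →ₗ[K] K) (E : Submodule K (Module.Dual K V))
    (S : Submodule K V) : Prop where
  finite : FiniteDimensional K (radical B S)
  solve : ∀ φ ∈ E, (∀ r ∈ radical B S, φ r = 0) → ∃ v ∈ S, ∀ y ∈ S, B v y = φ y

/-- Dichotomy for the new condition `ψ`. If `ψ` is nonzero on the radical, the radical loses one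
dimension. If `ψ` vanishes there, it is represented as `B u` on `S`, and `u` is a new element of the
radical of the hyperplane. Either way the parity flips, and solvability is inherited so that the
step can be iterated. -/
theorem Solvable.inf_ker {B : V →ₗ[K] V →ₗ[K] K} (hB : B.IsAlt)
    {E : Submodule K (Module.Dual K V)} {S : Submodule K V} (hS : Solvable B E S)
    {ψ : Module.Dual K V} (hψ : ψ ∈ E) {x : V} (hx : x ∈ S) (hxψ : ψ x ≠ 0) :
    Solvable B E (S ⊓ LinearMap.ker ψ) ∧
      Odd (Module.finrank K (radical B S) +
        Module.finrank K (radical B (S ⊓ LinearMap.ker ψ))) := by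
  have := hS.finite
  have skew : ∀ a b, B a b = - B b a := fun a b => (hB.neg b a).symm
  by_cases h : ∃ r ∈ radical B S, ψ r ≠ 0
  · obtain ⟨r, hr, hrψ⟩ := h
    have key : ∀ v ∈ S, (∀ y ∈ S ⊓ LinearMap.ker ψ, B v y = 0) → ∀ y ∈ S, B v y = 0 := by
      intro v hv h0 y hy
      have := h0 (y - (ψ y / ψ r) • r) ⟨S.sub_mem hy (S.smul_mem _ hr.1), by simp [hrψ]⟩
      simpa [skew v r, hr.2 v hv] using this
    have hrad : radical B (S ⊓ LinearMap.ker ψ) = radical B S ⊓ LinearMap.ker ψ := by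
      ext v
      constructor
      · rintro ⟨⟨h₁, h₂⟩, h₃⟩
        exact ⟨⟨h₁, key v h₁ h₃⟩, h₂⟩
      · rintro ⟨⟨h₁, h₃⟩, h₂⟩
        exact ⟨⟨h₁, h₂⟩, fun y hy => h₃ y hy.1⟩
    refine ⟨⟨by rw [hrad]; infer_instance, fun φ hφ h0 => ?_⟩, ?_⟩
    -- Subtracting a multiple of `ψ`, invisible on `S ⊓ ker ψ`, makes the functional vanish at `r`
    -- too, hence on the whole radical of `S`.
    · obtain ⟨v, hv, hvy⟩ := hS.solve (φ - (φ r / ψ r) • ψ) (E.sub_mem hφ (E.smul_mem _ hψ)) (by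
        intro s hs
        have := h0 (s - (ψ s / ψ r) • r) (by
          rw [hrad]
          exact ⟨Submodule.sub_mem _ hs (Submodule.smul_mem _ _ hr), by simp [hrψ]⟩)
        simp only [map_sub, map_smul, smul_eq_mul] at this
        simp only [LinearMap.sub_apply, LinearMap.smul_apply, smul_eq_mul]
        rw [← this]
        ring)
      refine ⟨v - (ψ v / ψ r) • r, ⟨S.sub_mem hv (S.smul_mem _ hr.1), by simp [hrψ]⟩, ?_⟩
      rintro y ⟨hy, hy'⟩
      have hy' : ψ y = 0 := hy'
      simp [hvy y hy, hy', hr.2 y hy]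
    · rw [hrad, ← finrank_inf_ker hr hrψ]
      exact ⟨_, by ring⟩
  · push Not at h
    obtain ⟨u, hu, huy⟩ := hS.solve ψ hψ h
    have huψ : ψ u = 0 := by rw [← huy u hu]; exact hB u
    have hrad : radical B (S ⊓ LinearMap.ker ψ) = radical B S ⊔ Submodule.span K {u} := by
      apply le_antisymm
      · rintro v ⟨⟨h₁, h₂⟩, h₃⟩
        rw [Submodule.mem_sup]
        refine ⟨v - (B v x / ψ x) • u, ⟨S.sub_mem h₁ (S.smul_mem _ hu), fun y hy => ?_⟩,
          (B v x / ψ x) • u, Submodule.smul_mem _ _ (Submodule.mem_span_singleton_self u),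
          by simp⟩
        have := h₃ (y - (ψ y / ψ x) • x) ⟨S.sub_mem hy (S.smul_mem _ hx), by simp [hxψ]⟩
        simp only [map_sub, map_smul, smul_eq_mul] at this
        simp only [map_sub, map_smul, smul_eq_mul, LinearMap.sub_apply, LinearMap.smul_apply,
          huy y hy]
        rw [← this]
        ring
      · refine sup_le ?_ ?_
        · intro v hv
          exact ⟨⟨hv.1, h v hv⟩, fun y hy => hv.2 y hy.1⟩
        · rw [Submodule.span_singleton_le_iff_mem]
          exact ⟨⟨hu, huψ⟩, fun y hy => by rw [huy y hy.1]; exact hy.2⟩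
    have hu' : u ∉ radical B S := fun hu' => hxψ (by rw [← huy x hx, hu'.2 x hx])
    refine ⟨⟨by rw [hrad]; infer_instance, fun φ hφ h0 => ?_⟩, ?_⟩
    · rw [hrad] at h0
      obtain ⟨v, hv, hvy⟩ := hS.solve φ hφ fun r hr => h0 r (Submodule.mem_sup_left hr)
      -- The solution on `S` already lies in `ker ψ`: `ψ v = B u v = -φ u`, and `φ u = 0` because
      -- `u` belongs to the new radical.
      refine ⟨v, ⟨hv, ?_⟩, fun y hy => hvy y hy.1⟩
      change ψ v = 0
      rw [← huy v hv, skew, hvy u hu, h0 u (Submodule.mem_sup_right (Submodule.mem_span_singleton_self u)), neg_zero]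
    · rw [hrad, finrank_sup_span_of_notMem hu']
      exact ⟨Module.finrank K (radical B S), by ring⟩

/-- Conditions are imposed one at a time. A condition already implied by the earlier ones changes
nothing; any other raises the codimension by one and flips the parity of the radical. -/
theorem Solvable.exists_of_list {B : V →ₗ[K] V →ₗ[K] K} (hB : B.IsAlt)
    {E : Submodule K (Module.Dual K V)} (h : Solvable B E ⊤) (l : List (Module.Dual K V))
    (hl : ∀ ψ ∈ l, ψ ∈ E) :
    ∃ S : Submodule K V, (∀ x, x ∈ S ↔ ∀ ψ ∈ l, ψ x = 0) ∧ Solvable B E S ∧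
      FiniteDimensional K (V ⧸ S) ∧
      Even (Module.finrank K (radical B ⊤) + Module.finrank K (radical B S) +
        Module.finrank K (V ⧸ S)) := by
  induction l with
  | nil =>
    have : Subsingleton (V ⧸ (⊤ : Submodule K V)) := 
      Submodule.Quotient.subsingleton_iff.2 rfl
    refine ⟨⊤, by simp, h, inferInstance, ?_⟩
    rw [Module.finrank_zero_of_subsingleton (M := V ⧸ (⊤ : Submodule K V))]
    exact ⟨_, rfl⟩
  | cons ψ l ih =>
    obtain ⟨S, h₀, h₁, h₂, h₃⟩ := ih fun φ hφ => hl φ (List.mem_cons_of_mem _ hφ)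
    by_cases hx : ∃ x ∈ S, ψ x ≠ 0
    · obtain ⟨x, hx, hxψ⟩ := hx
      obtain ⟨h₄, h₅⟩ := h₁.inf_ker hB (hl ψ List.mem_cons_self) hx hxψ
      obtain ⟨h₆, h₇⟩ := finrank_quotient_inf_ker hx hxψ
      refine ⟨S ⊓ LinearMap.ker ψ, fun x => ?_, h₄, h₆, ?_⟩
      · rw [Submodule.mem_inf, h₀, LinearMap.mem_ker, List.forall_mem_cons, and_comm]
      · rw [h₇]
        rw [Nat.even_iff] at h₃ ⊢
        rw [Nat.odd_iff] at h₅
        lia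
    · push Not at hx
      refine ⟨S, fun x => ?_, h₁, h₂, h₃⟩
      rw [List.forall_mem_cons, ← h₀]
      exact ⟨fun h => ⟨hx x h, h⟩, fun h => h.2⟩

end Alternating

/-! ## Fredholm operators on a Hilbert space -/

section Fredholm

open scoped LinearMap.FiniteRangeSetoid InnerProductSpace

variable {X : Type*} [NormedAddCommGroup X] [InnerProductSpace ℂ X]

theorem isFredholm_comp {F G : X →L[ℂ] X} (hF : F.IsFredholm) (hG : G.IsFredholm) :
    (F ∘L G).IsFredholm := by
  obtain ⟨F', hF'⟩ := hF.exists_isQuasiInverse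
  obtain ⟨G', hG'⟩ := hG.exists_isQuasiInverse
  exact .of_isQuasiInverse (v := G' ∘L F') (hG'.comp hF')

theorem isFredholm_add {F W : X →L[ℂ] X} (hF : F.IsFredholm)
    (hW : FiniteDimensional ℂ W.range) : (F + W).IsFredholm := by
  obtain ⟨F', h₁, h₂⟩ := hF.exists_isQuasiInverse
  have hW' : W.toLinearMap ≈ 0 := LinearMap.FiniteRangeSetoid.equiv_zero_iff_hasFiniteRange.2
    (Submodule.fg_iff_finiteDimensional _ |>.2 hW)
  have hFW : (F + W).toLinearMap ≈ F.toLinearMap := by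
    rw [LinearMap.FiniteRangeSetoid.equiv_iff_hasFiniteRange]
    have : (F + W).toLinearMap - F.toLinearMap = W.toLinearMap := by
      ext x
      simp
    rw [this]
    exact Submodule.fg_iff_finiteDimensional _ |>.2 hW
  refine .of_isQuasiInverse (v := F') ⟨?_, ?_⟩
  · exact Setoid.trans (LinearMap.FiniteRangeSetoid.equiv_comp_left hFW) h₁
  · exact Setoid.trans (LinearMap.FiniteRangeSetoid.equiv_comp_right hFW) h₂

theorem finiteDefect_of_isFredholm {F : X →L[ℂ] X} (hF : F.IsFredholm) :
    FiniteDefect F.toLinearMap :=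
  ⟨hF.finite_ker, hF.finite_coker⟩

theorem isFredholm_of_comp_eq_one {F G : X →L[ℂ] X} (h₁ : F ∘L G = 1)
    (h₂ : FiniteDimensional ℂ (G ∘L F - 1).range) : F.IsFredholm ∧ G.IsFredholm := by
  have e₁ : (F ∘L G).toLinearMap ≈ LinearMap.id := by
    rw [h₁]
    exact Setoid.refl _
  have e₂ : (G ∘L F).toLinearMap ≈ LinearMap.id := by
    rw [LinearMap.FiniteRangeSetoid.equiv_iff_hasFiniteRange]
    exact Submodule.fg_iff_finiteDimensional _ |>.2 h₂
  exact ⟨.of_isQuasiInverse (v := G) ⟨e₂, e₁⟩, .of_isQuasiInverse (v := F) ⟨e₁, e₂⟩⟩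

theorem isFredholm_of_isUnit {F : X →L[ℂ] X} (hF : IsUnit F) :
    F.IsFredholm ∧ index F.toLinearMap = 0 := by
  obtain ⟨u, rfl⟩ := hF
  refine ⟨(isFredholm_of_comp_eq_one (G := u⁻¹.val) u.mul_inv ?_).1, ?_⟩
  · have : u⁻¹.val ∘L u.val - 1 = 0 := sub_eq_zero.2 u.inv_mul
    rw [this]
    have h0 : (0 : X →L[ℂ] X).range = ⊥ := LinearMap.range_zero
    rw [h0]
    infer_instance
  · refine (FiniteDefect.of_bijective ⟨fun x y h => ?_, fun y => ⟨u⁻¹.val y, ?_⟩⟩).2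
    · have := congrArg u⁻¹.val h
      change (u⁻¹.val * u.val) x = (u⁻¹.val * u.val) y at this
      simpa using this
    · change (u.val * u⁻¹.val) y = y
      simp

theorem index_mul {F G : X →L[ℂ] X} (hF : F.IsFredholm) (hG : G.IsFredholm) :
    index (F * G).toLinearMap = index F.toLinearMap + index G.toLinearMap :=
  index_comp (finiteDefect_of_isFredholm hF) (finiteDefect_of_isFredholm hG)

theorem finiteDimensional_quotient_ker {W : X →L[ℂ] X} (hW : FiniteDimensional ℂ W.range) :
    FiniteDimensional ℂ (X ⧸ W.ker) :=
  Module.Finite.equiv W.toLinearMap.quotKerEquivRange.symm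

theorem index_add {F W : X →L[ℂ] X} (hF : F.IsFredholm) (hW : FiniteDimensional ℂ W.range) :
    index (F + W).toLinearMap = index F.toLinearMap := by
  refine index_eq_of_eqOn (finiteDefect_of_isFredholm (isFredholm_add hF hW))
    (finiteDefect_of_isFredholm hF) (finiteDimensional_quotient_ker hW) fun x hx => ?_
  have hx : W x = 0 := hx
  simp [hx]

/-! ## Complex skew-symmetric operators

The transpose is taken with respect to a complex conjugation `C` of the Hilbert space. -/

/-- `C` is an antiunitary involution. -/
structure IsConjugation (C : X →ₛₗ[starRingEnd ℂ] X) : Prop where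
  inner_conj : ∀ x y, ⟪C x, C y⟫_ℂ = ⟪y, x⟫_ℂ
  conj_conj : ∀ x, C (C x) = x

/-- The bilinear form `x, y ↦ ⟪C x, F y⟫`. -/
def pairing (C : X →ₛₗ[starRingEnd ℂ] X) (F : X →L[ℂ] X) : X →ₗ[ℂ] X →ₗ[ℂ] ℂ :=
  LinearMap.mk₂ ℂ (fun x y => ⟪C x, F y⟫_ℂ)
    (fun x y z => by simp)
    (fun c x y => by simp [mul_comm])
    (fun x y z => by simp)
    (fun c x y => by simp)

@[simp]
theorem pairing_apply (C : X →ₛₗ[starRingEnd ℂ] X) (F : X →L[ℂ] X) (x y : X) :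
    pairing C F x y = ⟪C x, F y⟫_ℂ := rfl

/-- The functionals represented by the inner product. -/
def innerFunctionals (X : Type*) [NormedAddCommGroup X] [InnerProductSpace ℂ X] :
    Submodule ℂ (Module.Dual ℂ X) where
  carrier := {φ | ∃ c, ∀ x, φ x = ⟪c, x⟫_ℂ}
  add_mem' := fun ⟨c, hc⟩ ⟨d, hd⟩ => ⟨c + d, fun x => by simp [hc, hd]⟩
  zero_mem' := ⟨0, by simp⟩
  smul_mem' := fun a φ ⟨c, hc⟩ => ⟨starRingEnd ℂ a • c, fun x => by simp [hc, mul_comm]⟩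

/-- `F` is skew-symmetric with respect to the transposition defined by `C`. -/
def IsSkewOperator (C : X →ₛₗ[starRingEnd ℂ] X) (F : X →L[ℂ] X) : Prop :=
  ∀ x y, ⟪C x, F y⟫_ℂ = -⟪C y, F x⟫_ℂ

variable {C : X →ₛₗ[starRingEnd ℂ] X}

theorem IsConjugation.inner_comm (hC : IsConjugation C) (x y : X) : ⟪C x, y⟫_ℂ = ⟪C y, x⟫_ℂ := by
  rw [← hC.inner_conj, hC.conj_conj]

theorem IsSkewOperator.isAlt {F : X →L[ℂ] X} (hF : IsSkewOperator C F) :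
    (pairing C F).IsAlt := fun x => by
  have := hF x x
  rw [pairing_apply]
  linear_combination this / 2

theorem IsSkewOperator.inner_eq (hC : IsConjugation C) {F : X →L[ℂ] X} (hF : IsSkewOperator C F)
    (x y : X) : ⟪C x, F y⟫_ℂ = -⟪C (F x), y⟫_ℂ := by
  rw [hF, hC.inner_comm]

theorem IsSkewOperator.radical_top (hC : IsConjugation C) {F : X →L[ℂ] X}
    (hF : IsSkewOperator C F) : radical (pairing C F) ⊤ = F.ker := by
  ext v
  constructor
  · rintro ⟨-, h⟩
    have h' : ⟪C (F v), C (F v)⟫_ℂ = 0 := by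
      have := h (C (F v)) trivial
      rw [pairing_apply, hF.inner_eq hC, neg_eq_zero] at this
      exact this
    rw [hC.inner_conj, inner_self_eq_zero] at h'
    exact h'
  · intro hv
    have hv : F v = 0 := hv
    exact ⟨trivial, fun y _ => by simp [hF.inner_eq hC, hv]⟩

variable [CompleteSpace X]

theorem index_eq_ker_adjoint {F : X →L[ℂ] X} (hF : F.IsFredholm) :
    index F.toLinearMap = (Module.finrank ℂ F.ker : ℤ) -
      Module.finrank ℂ (ContinuousLinearMap.adjoint F).ker := by
  have := hF.isClosed_range.completeSpace_coe
  rw [← F.orthogonal_range, index,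
    (Submodule.quotientEquivOfIsCompl _ _ F.range.isCompl_orthogonal).finrank_eq]

/-- This is the Fredholm alternative. The range is closed, hence the double orthogonal complement of
itself, and skew symmetry shows that `C` maps the orthogonal complement of the range into the
kernel. A functional that vanishes on the kernel is therefore represented by a vector whose
conjugate lies in the range. -/
theorem IsSkewOperator.solvable (hC : IsConjugation C) {F : X →L[ℂ] X}
    (hF : IsSkewOperator C F) (hF' : F.IsFredholm) :
    Solvable (pairing C F) (innerFunctionals X) ⊤ := by
  refine ⟨by rw [hF.radical_top hC]; exact hF'.finite_ker, ?_⟩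
  rintro φ ⟨c, hc⟩ h0
  have hmem : C c ∈ F.range := by
    have hcl := hF'.isClosed_range.submodule_topologicalClosure_eq
    rw [← hcl, ← Submodule.orthogonal_orthogonal_eq_closure, Submodule.mem_orthogonal]
    intro z hz
    have hz' : F (C z) = 0 := by
      have h1 : ⟪C (F (C z)), C (F (C z))⟫_ℂ = 0 := by
        have := (Submodule.mem_orthogonal' _ _).1 hz (F (C (F (C z)))) ⟨_, rfl⟩
        rw [← hC.conj_conj z, hF.inner_eq hC, neg_eq_zero] at this
        simpa [hC.conj_conj] using this
      rw [hC.inner_conj, inner_self_eq_zero] at h1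
      exact h1
    have := h0 (C z) (by rw [hF.radical_top hC]; exact hz')
    rw [hc] at this
    rw [← hC.inner_conj, hC.conj_conj]
    exact this
  obtain ⟨v, hv⟩ := hmem
  refine ⟨-v, trivial, fun y _ => ?_⟩
  have hv : F v = C c := hv
  rw [pairing_apply, hF.inner_eq hC, map_neg, map_neg, hv, hC.conj_conj, hc, inner_neg_left, neg_neg]

theorem exists_list_of_isClosed {S : Submodule ℂ X} (hS : IsClosed (S : Set X))
    (hS' : FiniteDimensional ℂ (X ⧸ S)) :
    ∃ l : List (Module.Dual ℂ X), (∀ ψ ∈ l, ψ ∈ innerFunctionals X) ∧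
      ∀ x, x ∈ S ↔ ∀ ψ ∈ l, ψ x = 0 := by
  have := hS.completeSpace_coe
  have : FiniteDimensional ℂ Sᗮ := Module.Finite.equiv
    (Submodule.quotientEquivOfIsCompl _ _ S.isCompl_orthogonal)
  let b := Module.finBasis ℂ Sᗮ
  refine ⟨(List.finRange _).map fun i => innerₛₗ ℂ (b i : X), ?_, fun x => ?_⟩
  · intro ψ hψ
    obtain ⟨i, -, rfl⟩ := List.mem_map.1 hψ
    exact ⟨b i, fun x => rfl⟩
  · simp only [List.mem_map, List.mem_finRange, true_and, forall_exists_index,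
      forall_apply_eq_imp_iff, innerₛₗ_apply_apply]
    constructor
    · intro hx i
      exact (Submodule.mem_orthogonal' _ _).1 (b i).2 x hx
    · intro h
      rw [← S.orthogonal_orthogonal, Submodule.mem_orthogonal]
      intro u hu
      have hu' : u = ∑ i, b.repr ⟨u, hu⟩ i • (b i : X) := by
        have := congrArg Sᗮ.subtype (b.sum_repr ⟨u, hu⟩)
        rw [map_sum] at this
        simp only [map_smul, Submodule.subtype_apply] at this
        exact this.symm
      rw [hu', sum_inner]
      exact Finset.sum_eq_zero fun i _ => by rw [inner_smul_left, h, mul_zero]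

theorem IsSkewOperator.even_radical (hC : IsConjugation C) {F : X →L[ℂ] X}
    (hF : IsSkewOperator C F) (hF' : F.IsFredholm) {S : Submodule ℂ X}
    (hS : IsClosed (S : Set X)) (hS' : FiniteDimensional ℂ (X ⧸ S)) :
    FiniteDimensional ℂ (radical (pairing C F) S) ∧
    Even (Module.finrank ℂ F.ker + Module.finrank ℂ (radical (pairing C F) S) +
      Module.finrank ℂ (X ⧸ S)) := by
  obtain ⟨l, h₁, h₂⟩ := exists_list_of_isClosed hS hS'
  obtain ⟨S', h₃, h₄, h₅, h₆⟩ := (hF.solvable hC hF').exists_of_list hF.isAlt l h₁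
  obtain rfl : S = S' := by
    ext x
    rw [h₂, h₃]
  rw [hF.radical_top hC] at h₆
  exact ⟨h₄.finite, h₆⟩

/-- The parity of the dimension of the kernel of a skew-symmetric Fredholm operator is unchanged
under skew-symmetric perturbations of finite rank. -/
theorem IsSkewOperator.even_ker_add (hC : IsConjugation C) {F W : X →L[ℂ] X}
    (hF : IsSkewOperator C F) (hFW : IsSkewOperator C (F + W)) (hF' : F.IsFredholm)
    (hW : FiniteDimensional ℂ W.range) :
    Even (Module.finrank ℂ (F + W).ker + Module.finrank ℂ F.ker) := by
  have hc := W.isClosed_ker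
  have hS := finiteDimensional_quotient_ker hW
  have h₁ := (hF.even_radical hC hF' hc hS).2
  have h₂ := (hFW.even_radical hC (isFredholm_add hF' hW) hc hS).2
  -- On `ker W` the forms of `F` and `F + W` coincide. Both kernel dimensions are thus compared with
  -- the same radical and the same codimension.
  have h₃ : radical (pairing C (F + W)) W.ker = radical (pairing C F) W.ker := by
    ext v
    refine and_congr Iff.rfl (forall₂_congr fun y hy => ?_)
    have hy : W y = 0 := hy
    simp [hy]
  rw [h₃] at h₂
  obtain ⟨a, ha⟩ := h₁
  obtain ⟨b, hb⟩ := h₂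
  rw [Nat.even_iff]
  omega

/-- The parity of the dimension of the kernel of `Kᵀ F K`, for a skew-symmetric `F`. -/
theorem IsSkewOperator.even_ker_congruence (hC : IsConjugation C) {F G K : X →L[ℂ] X}
    (hF : IsSkewOperator C F) (hF' : F.IsFredholm) (hK : K.IsFredholm)
    (h : ∀ x y, ⟪C x, G y⟫_ℂ = ⟪C (K x), F (K y)⟫_ℂ) :
    Even ((Module.finrank ℂ G.ker : ℤ) + Module.finrank ℂ F.ker + index K.toLinearMap) := by
  obtain ⟨hfin, he⟩ := hF.even_radical hC hF' hK.isClosed_range hK.finite_coker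
  have := hK.finite_ker
  have hG : G.ker = Submodule.comap K.toLinearMap (radical (pairing C F) K.range) := by
    ext x
    rw [Submodule.mem_comap]
    change G x = 0 ↔ (_ ∧ _)
    constructor
    · intro hx
      refine ⟨⟨x, rfl⟩, ?_⟩
      rintro _ ⟨y, rfl⟩
      change ⟪C (K x), F (K y)⟫_ℂ = 0
      rw [hF, ← h, hx, inner_zero_right, neg_zero]
    · rintro ⟨-, h0⟩
      rw [← inner_self_eq_zero (𝕜 := ℂ), ← hC.conj_conj (G x)]
      have := h0 (K (C (G x))) ⟨_, rfl⟩
      rw [pairing_apply] at this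
      change ⟪C (K x), F (K (C (G x)))⟫_ℂ = 0 at this
      rw [hF, ← h, neg_eq_zero] at this
      simpa [hC.conj_conj] using this
  let f : G.ker →ₗ[ℂ] radical (pairing C F) K.range :=
    K.toLinearMap.restrict fun x hx => by rwa [hG] at hx
  have hf : Function.Surjective f := by
    rintro ⟨y, hy⟩
    obtain ⟨x, rfl⟩ := hy.1
    exact ⟨⟨x, by rw [hG]; exact hy⟩, rfl⟩
  have hle : K.ker ≤ G.ker := by
    intro x hx
    have hx : K x = 0 := hx
    rw [hG, Submodule.mem_comap]
    change K x ∈ _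
    rw [hx]
    exact Submodule.zero_mem _
  have hk : LinearMap.ker f = Submodule.comap G.ker.subtype K.ker := by
    ext ⟨x, hx⟩
    exact Subtype.ext_iff
  have hkf : FiniteDimensional ℂ (LinearMap.ker f) := by
    rw [hk]
    exact Module.Finite.equiv (Submodule.comapSubtypeEquivOfLe hle).symm
  have : FiniteDimensional ℂ G.ker := finiteDimensional_of_ker_range hkf inferInstance
  -- Rank-nullity for `K : ker G → radical` gives `dim ker G = dim radical + dim ker K`. The radical
  -- is congruent mod 2 to `dim ker F` plus the codimension of the range of `K`, so the index of `K`
  -- appears.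
  have hr := f.finrank_range_add_finrank_ker
  rw [LinearMap.range_eq_top.2 hf, finrank_top, hk,
    (Submodule.comapSubtypeEquivOfLe hle).finrank_eq] at hr
  rw [index]
  obtain ⟨m, hm⟩ := he
  exact ⟨m + Module.finrank ℂ K.ker - Module.finrank ℂ (X ⧸ K.range), by
    push_cast [← hr]
    omega⟩

end Fredholm

/-! ## Operators on the half-line -/

section HalfLineOperators

open scoped InnerProductSpace

variable {ι κ μ : Type*} [Fintype ι] [Fintype κ] [Fintype μ]

theorem halfLine_ext {ψ φ : HalfLine ι} (h : ∀ j a, ψ j a = φ j a) : ψ = φ := by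
  ext j a
  exact h j a

/-- The operator `1 ⊗ V` for a rectangular matrix `V`. -/
def site [DecidableEq κ] (V : Matrix ι κ ℂ) : HalfLine κ →L[ℂ] HalfLine ι :=
  let L : EuclideanSpace ℂ κ →L[ℂ] EuclideanSpace ℂ ι :=
    LinearMap.toContinuousLinearMap (Matrix.toEuclideanLin V)
  have key : ∀ (ψ : HalfLine κ) (j : ℕ), ‖L (ψ j)‖ ^ 2 ≤ ‖L‖ ^ 2 * ‖ψ j‖ ^ 2 := fun ψ j => by
    rw [← mul_pow]
    gcongr
    exact ContinuousLinearMap.le_opNorm _ _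
  have summ : ∀ ψ : HalfLine κ, Summable fun j => ‖L (ψ j)‖ ^ 2 := fun ψ =>
    Summable.of_nonneg_of_le (fun _ => by positivity) (key ψ) ((summable_sq ψ).mul_left _)
  LinearMap.mkContinuous
    { toFun := fun ψ => ⟨fun j => L (ψ j), memℓp_two (summ ψ)⟩
      map_add' := fun ψ φ => by
        ext1; funext j
        exact map_add L (ψ j) (φ j)
      map_smul' := fun c ψ => by
        ext1; funext j
        exact map_smul L c (ψ j) }
    ‖L‖ <| by
    intro ψ
    refine norm_le_of_sq (by positivity) ?_
    rw [mul_pow, norm_sq_eq, ← tsum_mul_left]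
    exact (summ ψ).tsum_le_tsum (key ψ) ((summable_sq ψ).mul_left _)

/-- Entrywise complex conjugation of vectors. -/
def conjVec : HalfLine ι →ₛₗ[starRingEnd ℂ] HalfLine ι where
  toFun ψ := ⟨fun j => WithLp.toLp 2 fun a => starRingEnd ℂ (ψ j a), memℓp_two <| by
    have : ∀ j, ‖(WithLp.toLp 2 fun a => starRingEnd ℂ (ψ j a) : EuclideanSpace ℂ ι)‖ = ‖ψ j‖ := by
      intro j
      simp [EuclideanSpace.norm_eq]
    simpa only [this] using summable_sq ψ⟩
  map_add' ψ φ := halfLine_ext fun j a => map_add (starRingEnd ℂ) (ψ j a) (φ j a)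
  map_smul' c ψ := halfLine_ext fun j a => by simp

@[simp]
theorem conjVec_apply (ψ : HalfLine ι) (j : ℕ) (a : ι) :
    conjVec ψ j a = starRingEnd ℂ (ψ j a) := rfl

theorem inner_eq_tsum (ψ φ : HalfLine ι) :
    ⟪ψ, φ⟫_ℂ = ∑' j, ∑ a, starRingEnd ℂ (ψ j a) * φ j a := by
  rw [lp.inner_eq_tsum]
  refine tsum_congr fun j => ?_
  rw [PiLp.inner_apply]
  exact Finset.sum_congr rfl fun a _ => by rw [RCLike.inner_apply, mul_comm]

theorem isConjugation_conjVec : IsConjugation (conjVec (ι := ι)) where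
  inner_conj ψ φ := by
    simp only [inner_eq_tsum, conjVec_apply, Complex.conj_conj]
    exact tsum_congr fun j => Finset.sum_congr rfl fun a _ => mul_comm _ _
  conj_conj ψ := halfLine_ext fun j a => by simp

variable [DecidableEq ι] [DecidableEq κ] [DecidableEq μ]

theorem site_apply (V : Matrix ι κ ℂ) (ψ : HalfLine κ) (j : ℕ) (a : ι) :
    site V ψ j a = ∑ b, V a b * ψ j b := rfl

theorem onSite_eq_site (V : Matrix ι ι ℂ) : onSite V = site V := rfl

theorem site_mul (V : Matrix ι κ ℂ) (U : Matrix κ μ ℂ) : site (V * U) = site V ∘L site U := by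
  ext1 ψ
  refine halfLine_ext fun j a => ?_
  simp only [site_apply, ContinuousLinearMap.comp_apply, Matrix.mul_apply, Finset.mul_sum,
    Finset.sum_mul]
  rw [Finset.sum_comm]
  simp only [mul_assoc]

theorem site_one : site (1 : Matrix ι ι ℂ) = 1 := by
  ext1 ψ
  refine halfLine_ext fun j a => ?_
  simp [site_apply, Matrix.one_apply]

theorem site_add (V U : Matrix ι κ ℂ) : site (V + U) = site V + site U := by
  ext1 ψ
  refine halfLine_ext fun j a => ?_
  simp [site_apply, add_mul, Finset.sum_add_distrib]

theorem site_smul (c : ℂ) (V : Matrix ι κ ℂ) : site (c • V) = c • site V := by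
  ext1 ψ
  refine halfLine_ext fun j a => ?_
  simp [site_apply, Finset.mul_sum, mul_assoc]

theorem site_zero : site (0 : Matrix ι κ ℂ) = 0 := by
  simpa using site_smul 0 (0 : Matrix ι κ ℂ)

theorem adjoint_site (V : Matrix ι κ ℂ) : ContinuousLinearMap.adjoint (site V) = site Vᴴ := by
  symm
  rw [ContinuousLinearMap.eq_adjoint_iff]
  intro ψ φ
  simp only [inner_eq_tsum, site_apply, map_sum, map_mul, Matrix.conjTranspose_apply,
    Finset.sum_mul, Finset.mul_sum, RCLike.star_def, Complex.conj_conj]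
  refine tsum_congr fun j => ?_
  rw [Finset.sum_comm]
  exact Finset.sum_congr rfl fun a _ => Finset.sum_congr rfl fun b _ => by ring

theorem shift_apply (ψ : HalfLine ι) (j : ℕ) : shift ψ j = ψ (j + 1) := rfl

theorem norm_shift_le : ‖(shift : HalfLine ι →L[ℂ] HalfLine ι)‖ ≤ 1 :=
  LinearMap.mkContinuous_norm_le _ zero_le_one _

/-- The state `|j⟩ ⊗ |a⟩`. -/
def ket (j : ℕ) (a : ι) : HalfLine ι := lp.single 2 j (EuclideanSpace.single a 1)

theorem ket_apply (j : ℕ) (a : ι) (j' : ℕ) (b : ι) :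
    ket j a j' b = if j' = j ∧ b = a then 1 else 0 := by
  rw [ket, lp.single_apply]
  by_cases h : j' = j
  · subst h
    simp
  · simp [h]

theorem inner_ket (j : ℕ) (a : ι) (ψ : HalfLine ι) : ⟪ket j a, ψ⟫_ℂ = ψ j a := by
  rw [ket, lp.inner_single_left, EuclideanSpace.inner_single_left]
  simp

theorem shift_ket_zero (a : ι) : shift (ket 0 a) = 0 :=
  halfLine_ext fun j b => by simp [shift_apply, ket_apply]

theorem shift_ket_succ (j : ℕ) (a : ι) : shift (ket (j + 1) a) = ket j a :=
  halfLine_ext fun j' b => by simp [shift_apply, ket_apply]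

/-- The right shift. -/
abbrev shiftAdj : HalfLine ι →L[ℂ] HalfLine ι := ContinuousLinearMap.adjoint shift

theorem shiftAdj_apply_zero (ψ : HalfLine ι) (a : ι) : shiftAdj ψ 0 a = 0 := by
  rw [← inner_ket, ContinuousLinearMap.adjoint_inner_right, shift_ket_zero, inner_zero_left]

theorem shiftAdj_apply_succ (ψ : HalfLine ι) (j : ℕ) (a : ι) : shiftAdj ψ (j + 1) a = ψ j a := by
  rw [← inner_ket, ContinuousLinearMap.adjoint_inner_right, shift_ket_succ, inner_ket]

theorem shift_mul_shiftAdj : (shift * shiftAdj : HalfLine ι →L[ℂ] HalfLine ι) = 1 := by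
  ext1 ψ
  exact halfLine_ext fun j a => shiftAdj_apply_succ ψ j a

theorem shift_comp_site (V : Matrix ι κ ℂ) : shift ∘L site V = site V ∘L shift := rfl

theorem shiftAdj_comp_site (V : Matrix ι κ ℂ) : shiftAdj ∘L site V = site V ∘L shiftAdj := by
  have h := congrArg ContinuousLinearMap.adjoint (shift_comp_site Vᴴ)
  rw [ContinuousLinearMap.adjoint_comp, ContinuousLinearMap.adjoint_comp, adjoint_site,
    Matrix.conjTranspose_conjTranspose] at h
  exact h.symm

/-- `onSite` as a ring homomorphism. -/
def onSiteHom : Matrix ι ι ℂ →+* (HalfLine ι →L[ℂ] HalfLine ι) where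
  toFun := onSite
  map_one' := site_one
  map_mul' := site_mul
  map_zero' := site_zero
  map_add' := site_add

@[simp]
theorem onSiteHom_apply (V : Matrix ι ι ℂ) : onSiteHom V = site V := rfl

/-- `S` commutes with all on-site operators. -/
def IsTranslation (S : HalfLine ι →L[ℂ] HalfLine ι) : Prop := ∀ a, Commute (onSiteHom a) S

theorem isTranslation_shift : IsTranslation (shift (ι := ι)) := fun a =>
  (shift_comp_site a).symm

theorem isTranslation_shiftAdj : IsTranslation (shiftAdj (ι := ι)) := fun a =>
  (shiftAdj_comp_site a).symm

/-- The value of a polynomial matrix at a translation operator. -/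
def polyOp {S : HalfLine ι →L[ℂ] HalfLine ι} (hS : IsTranslation S) :
    Matrix ι ι (Polynomial ℂ) →+* (HalfLine ι →L[ℂ] HalfLine ι) :=
  (Polynomial.eval₂RingHom' onSiteHom S fun a => hS a).comp (matPolyEquiv (R := ℂ) (n := ι)).toRingEquiv.toRingHom

variable {S : HalfLine ι →L[ℂ] HalfLine ι} (hS : IsTranslation S)

theorem polyOp_map_C (a : Matrix ι ι ℂ) : polyOp hS (a.map Polynomial.C) = site a := by
  have : matPolyEquiv (a.map Polynomial.C) = Polynomial.C a := matPolyEquiv_map_C a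
  simp [polyOp, this]

theorem polyOp_X : polyOp hS (Matrix.diagonal fun _ => Polynomial.X) = S := by
  have : matPolyEquiv (Matrix.diagonal fun _ : ι => (Polynomial.X : Polynomial ℂ)) =
    Polynomial.X := matPolyEquiv_diagonal_X
  simp [polyOp, this]

end HalfLineOperators

/-! ## Acting on a single internal state -/

section Peel

/-- For an idempotent `p` commuting with `a`, the element `p * a + (1 - p)` acts as `a` on the range
of `p` and trivially on the complement, so such elements multiply like their first entries. No
commutation of `b` with `p` is needed. -/
theorem peel_mul {A : Type*} [Ring A] {p a b : A} (hp : p * p = p) (ha : Commute p a) :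
    (p * a + (1 - p)) * (p * b + (1 - p)) = p * (a * b) + (1 - p) := by
  have h1 : p * a * p = p * a := by rw [mul_assoc, ← ha.eq, ← mul_assoc, hp]
  calc _ = (p * a * p) * b + p * a - p * a * p + (p * b - p * p * b) + (1 - p - p + p * p) := by
        noncomm_ring
    _ = _ := by rw [h1, hp]; noncomm_ring

theorem isUnit_peel {A : Type*} [Ring A] {p a : A} (hp : p * p = p) (ha : Commute p a)
    (hu : IsUnit a) : IsUnit (p * a + (1 - p)) := by
  obtain ⟨u, rfl⟩ := hu
  refine ⟨⟨p * u + (1 - p), p * u⁻¹.val + (1 - p), ?_, ?_⟩, rfl⟩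
  · rw [peel_mul hp ha]
    simp
  · rw [peel_mul hp ha.units_inv_right]
    simp

end Peel

/-! ### Fredholm index of matrix polynomials in the shifts -/

section IndexOfPolynomials

open Polynomial

variable {ι : Type*} [Fintype ι] [DecidableEq ι]

theorem site_single_mul_self (i : ι) :
    (site (Matrix.single i i 1) * site (Matrix.single i i 1) : HalfLine ι →L[ℂ] HalfLine ι) =
      site (Matrix.single i i 1) := by
  rw [← onSiteHom_apply, ← map_mul]
  simp

theorem polyOp_diagonal {S : HalfLine ι →L[ℂ] HalfLine ι} (hS : IsTranslation S) (i : ι) (ζ : ℂ) :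
    polyOp hS (Matrix.diagonal (Function.update 1 i (X - C ζ))) =
      site (Matrix.single i i 1) * (S - ζ • 1) + (1 - site (Matrix.single i i 1)) := by
  have h : Matrix.diagonal (Function.update (1 : ι → ℂ[X]) i (X - C ζ)) =
      (Matrix.single i i (1 : ℂ)).map C * (Matrix.diagonal (fun _ => X) -
        ((ζ • (1 : Matrix ι ι ℂ)).map C)) + (1 - (Matrix.single i i (1 : ℂ)).map C) := by
    ext a b : 2
    have e : ((ζ • (1 : Matrix ι ι ℂ)).map (C : ℂ →+* ℂ[X])) = Matrix.diagonal fun _ => C ζ := by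
      rw [Matrix.smul_one_eq_diagonal, Matrix.diagonal_map (map_zero C)]
    have e' : (Matrix.single i i (1 : ℂ)).map (C : ℂ →+* ℂ[X]) =
        Matrix.diagonal (Pi.single i 1) := by
      rw [← Matrix.diagonal_single, Matrix.diagonal_map (map_zero C)]
      congr 1
      ext k : 1
      by_cases hk : k = i <;> simp [hk]
    rw [e, e', Matrix.diagonal_sub, Matrix.diagonal_mul_diagonal]
    by_cases hab : a = b
    · subst hab
      by_cases hai : a = i
      · subst hai
        simp
      · simp [hai]
    · simp [hab]
  rw [h, map_add, map_mul, map_sub, map_sub, map_one, polyOp_X, polyOp_map_C, polyOp_map_C,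
    site_smul, site_one]

theorem isUnit_one_sub_smul {S : HalfLine ι →L[ℂ] HalfLine ι} (hS : ‖S‖ ≤ 1) {ζ : ℂ}
    (hζ : ‖ζ‖ < 1) : IsUnit (1 - ζ • S) := by
  apply isUnit_one_sub_of_norm_lt_one
  rw [norm_smul]
  nlinarith [norm_nonneg ζ, norm_nonneg S]

theorem isUnit_sub_smul_one {S : HalfLine ι →L[ℂ] HalfLine ι} (hS : ‖S‖ ≤ 1) {ζ : ℂ}
    (hζ : 1 < ‖ζ‖) : IsUnit (S - ζ • 1) := by
  have h0 : ζ ≠ 0 := fun h => by simp [h] at hζ; linarith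
  have h := isUnit_one_sub_smul hS (ζ := ζ⁻¹) (by rw [norm_inv]; exact inv_lt_one_of_one_lt₀ hζ)
  have e : S - ζ • 1 = (-ζ) • (1 - ζ⁻¹ • S) := by
    rw [smul_sub, smul_smul, neg_mul, mul_inv_cancel₀ h0]
    simp only [neg_smul, one_smul]
    abel
  rw [e]
  exact h.smul (Units.mk0 (-ζ) (neg_ne_zero.2 h0))

theorem commute_site {S : HalfLine ι →L[ℂ] HalfLine ι} (hS : IsTranslation S) (a : Matrix ι ι ℂ) :
    Commute (site a) S := hS a

/-- The left shift acting on the internal state `i` only. -/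
abbrev peelShift (i : ι) : HalfLine ι →L[ℂ] HalfLine ι :=
  site (Matrix.single i i 1) * shift + (1 - site (Matrix.single i i 1))

/-- The right shift acting on the internal state `i` only. -/
abbrev peelShiftAdj (i : ι) : HalfLine ι →L[ℂ] HalfLine ι :=
  site (Matrix.single i i 1) * shiftAdj + (1 - site (Matrix.single i i 1))

theorem site_single_apply (i : ι) (ψ : HalfLine ι) (j : ℕ) (a : ι) :
    site (Matrix.single i i 1) ψ j a = if a = i then ψ j a else 0 := by
  rw [site_apply]
  by_cases h : a = i
  · subst h
    simp [Matrix.single_apply]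
  · simp [h, Ne.symm h]

theorem peelShift_apply (i : ι) (ψ : HalfLine ι) (j : ℕ) (a : ι) :
    peelShift i ψ j a = if a = i then ψ (j + 1) a else ψ j a := by
  change site (Matrix.single i i 1) (shift ψ) j a +
    (ψ j a - site (Matrix.single i i 1) ψ j a) = _
  rw [site_single_apply, site_single_apply, shift_apply]
  split_ifs <;> simp

theorem peelShift_mul_peelShiftAdj (i : ι) : peelShift i * peelShiftAdj i = 1 := by
  rw [peel_mul (site_single_mul_self i) (commute_site isTranslation_shift _),
    shift_mul_shiftAdj]
  simp

theorem ker_peelShift (i : ι) : (peelShift i).ker = Submodule.span ℂ {ket 0 i} := by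
  apply le_antisymm
  · intro ψ hψ
    have hψ : peelShift i ψ = 0 := hψ
    rw [Submodule.mem_span_singleton]
    refine ⟨ψ 0 i, halfLine_ext fun j a => ?_⟩
    have h := fun j => congrArg (fun φ : HalfLine ι => φ j a) hψ
    simp only [peelShift_apply] at h
    change ψ 0 i * ket 0 i j a = ψ j a
    rw [ket_apply]
    by_cases ha : a = i
    · subst ha
      cases j with
      | zero => simp
      | succ j => simpa using (h j).symm
    · simpa [ha] using (h j).symm
  · rw [Submodule.span_singleton_le_iff_mem]
    change peelShift i (ket 0 i) = 0
    refine halfLine_ext fun j a => ?_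
    rw [peelShift_apply, ket_apply, ket_apply]
    by_cases ha : a = i <;> simp [ha]

/-- The left shift on one internal state is surjective and kills only the state at site `0`, so its
index is `1`. The right shift is a right inverse of it, which forces the index `-1`. -/
theorem isFredholm_peelShift (i : ι) :
    ((peelShift i).IsFredholm ∧ (peelShiftAdj i).IsFredholm) ∧
      index (peelShift i).toLinearMap = 1 ∧ index (peelShiftAdj i).toLinearMap = -1 := by
  have h1 : peelShift i ∘L peelShiftAdj i = 1 := peelShift_mul_peelShiftAdj i
  have hF := isFredholm_of_comp_eq_one h1 (by
    have hle : (peelShiftAdj i ∘L peelShift i - 1).range ≤ (peelShift i).ker := by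
      rintro _ ⟨ψ, rfl⟩
      have h0 : peelShift i * (peelShiftAdj i * peelShift i - 1) = 0 := by
        rw [mul_sub, ← mul_assoc, peelShift_mul_peelShiftAdj, one_mul, mul_one, sub_self]
      exact congrArg (fun F => F ψ) h0
    have : FiniteDimensional ℂ (peelShift i).ker := by
      rw [ker_peelShift]
      infer_instance
    exact Submodule.finiteDimensional_of_le hle)
  have hi : index (peelShift i).toLinearMap = 1 := by
    have hr : LinearMap.range (peelShift i).toLinearMap = ⊤ :=
      LinearMap.range_eq_top.2 fun ψ => ⟨peelShiftAdj i ψ, congrArg (fun F => F ψ) h1⟩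
    have hk : (peelShift i).ker = Submodule.span ℂ {ket 0 i} := ker_peelShift i
    have h0 : (ket 0 i : HalfLine ι) ≠ 0 := fun h => by
      have := congrArg (fun φ : HalfLine ι => φ 0 i) h
      simp [ket_apply] at this
    rw [index, hk, finrank_span_singleton h0, hr]
    have : Subsingleton (HalfLine ι ⧸ (⊤ : Submodule ℂ (HalfLine ι))) :=
      Submodule.Quotient.subsingleton_iff.2 rfl
    rw [Module.finrank_zero_of_subsingleton]
    simp
  refine ⟨hF, hi, ?_⟩
  have h2 := index_mul hF.1 hF.2
  rw [peelShift_mul_peelShiftAdj, (isFredholm_of_isUnit isUnit_one).2, hi] at h2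
  linarith

/-- The number of zeros in the open unit disc. -/
def discRoots (q : ℂ[X]) : ℕ := (q.roots.filter fun z => ‖z‖ < 1).card

theorem discRoots_mul {q r : ℂ[X]} (h : q * r ≠ 0) :
    discRoots (q * r) = discRoots q + discRoots r := by
  rw [discRoots, roots_mul h, Multiset.filter_add, Multiset.card_add, discRoots, discRoots]

theorem discRoots_C (c : ℂ) : discRoots (C c) = 0 := by simp [discRoots]

theorem discRoots_X_sub_C (ζ : ℂ) : discRoots (X - C ζ) = if ‖ζ‖ < 1 then 1 else 0 := by
  rw [discRoots, roots_X_sub_C, Multiset.filter_singleton]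
  split_ifs <;> simp

/-- The Fredholm property and the index of a single-zero factor at a translation operator. -/
def HasIndexStep {S : HalfLine ι →L[ℂ] HalfLine ι} (hS : IsTranslation S) (ε : ℤ) : Prop :=
  ∀ i ζ, ‖ζ‖ ≠ 1 →
    (polyOp hS (Matrix.diagonal (Function.update 1 i (X - C ζ)))).IsFredholm ∧
    index (polyOp hS (Matrix.diagonal (Function.update 1 i (X - C ζ)))).toLinearMap =
      ε * discRoots (X - C ζ)

/-- For `‖ζ‖ < 1` one has `S - ζ = S (1 - ζ S†)` with an invertible second factor by the Neumann
series, leaving the index of the peeled shift. For `‖ζ‖ > 1` the operator `S - ζ` is itself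
invertible. -/
theorem hasIndexStep_shift : HasIndexStep (isTranslation_shift (ι := ι)) 1 := by
  intro i ζ hζ
  rw [polyOp_diagonal, discRoots_X_sub_C]
  obtain ⟨⟨h₁, -⟩, h₂, -⟩ := isFredholm_peelShift i
  have hp := site_single_mul_self i
  rcases lt_or_gt_of_ne hζ with hζ | hζ
  · have e : (shift - ζ • 1 : HalfLine ι →L[ℂ] HalfLine ι) = shift * (1 - ζ • shiftAdj) := by
      rw [mul_sub, mul_one, mul_smul_comm, shift_mul_shiftAdj]
    rw [e, ← peel_mul hp (commute_site isTranslation_shift _)]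
    have hu := isFredholm_of_isUnit (isUnit_peel hp
      ((Commute.one_right _).sub_right
        ((commute_site isTranslation_shiftAdj (Matrix.single i i 1)).smul_right ζ))
      (isUnit_one_sub_smul (S := shiftAdj (ι := ι)) (by
        rw [LinearIsometryEquiv.norm_map]
        exact norm_shift_le) hζ))
    refine ⟨isFredholm_comp h₁ hu.1, ?_⟩
    rw [index_mul h₁ hu.1, h₂, hu.2]
    simp [hζ]
  · have hu := isFredholm_of_isUnit (isUnit_peel hp
      ((commute_site isTranslation_shift (Matrix.single i i 1)).sub_right
        ((Commute.one_right _).smul_right ζ))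
      (isUnit_sub_smul_one (S := shift (ι := ι)) norm_shift_le hζ))
    refine ⟨hu.1, ?_⟩
    rw [hu.2]
    simp [hζ.le]

theorem hasIndexStep_shiftAdj : HasIndexStep (isTranslation_shiftAdj (ι := ι)) (-1) := by
  intro i ζ hζ
  rw [polyOp_diagonal, discRoots_X_sub_C]
  obtain ⟨⟨-, h₁⟩, -, h₂⟩ := isFredholm_peelShift i
  have hp := site_single_mul_self i
  rcases lt_or_gt_of_ne hζ with hζ | hζ
  -- The right shift has to be split off on the right, since only `shift * shiftAdj` equals `1`.
  · have e : (shiftAdj - ζ • 1 : HalfLine ι →L[ℂ] HalfLine ι) = (1 - ζ • shift) * shiftAdj := by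
      rw [sub_mul, one_mul, smul_mul_assoc, shift_mul_shiftAdj]
    have hc := (Commute.one_right _).sub_right
        ((commute_site isTranslation_shift (Matrix.single i i 1)).smul_right ζ)
    rw [e, ← peel_mul hp hc]
    have hu := isFredholm_of_isUnit (isUnit_peel hp hc
      (isUnit_one_sub_smul (S := shift (ι := ι)) norm_shift_le hζ))
    refine ⟨isFredholm_comp hu.1 h₁, ?_⟩
    rw [index_mul hu.1 h₁, h₂, hu.2]
    simp [hζ]
  · have hu := isFredholm_of_isUnit (isUnit_peel hp
      ((commute_site isTranslation_shiftAdj (Matrix.single i i 1)).sub_right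
        ((Commute.one_right _).smul_right ζ))
      (isUnit_sub_smul_one (S := shiftAdj (ι := ι)) (by
        rw [LinearIsometryEquiv.norm_map]
        exact norm_shift_le) hζ))
    refine ⟨hu.1, ?_⟩
    rw [hu.2]
    simp [hζ.le]

/-- A zero of the determinant of a polynomial matrix can be split off. -/
theorem exists_mul_eq_mul_diagonal {p : Matrix ι ι ℂ[X]} {ζ : ℂ} (h : p.det.IsRoot ζ) :
    ∃ (Q : Matrix ι ι ℂ) (p' : Matrix ι ι ℂ[X]) (i : ι), Q.det ≠ 0 ∧
      p * Q.map C = p' * Matrix.diagonal (Function.update 1 i (X - C ζ)) := by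
  have h' : (p.map (eval ζ)).det = 0 := by
    have := RingHom.map_det (evalRingHom ζ) p
    rw [coe_evalRingHom, h] at this
    exact this.symm
  obtain ⟨v, hv, hpv⟩ := Matrix.exists_mulVec_eq_zero_iff.2 h'
  obtain ⟨i, hi⟩ := Function.ne_iff.1 hv
  -- Replacing column `i` of the identity by a null vector `v` of `p(ζ)` turns column `i` of `p * Q`
  -- into `p v`, which vanishes at `ζ` and is divisible by `X - C ζ`. The determinant of `Q` is `v
  -- i`, nonzero by the choice of `i`.
  let Q : Matrix ι ι ℂ := (1 : Matrix ι ι ℂ).updateCol i v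
  have hQ : Q.det = v i := by
    rw [← Matrix.cramer_apply, Matrix.cramer_one]
    rfl
  have hd : ∀ a, ∃ r, (p * Q.map C) a i = r * (X - C ζ) := by
    intro a
    have : (X - C ζ) ∣ (p * Q.map C) a i := by
      rw [dvd_iff_isRoot, IsRoot.def, Matrix.mul_apply, eval_finsetSum]
      have := congrFun hpv a
      simpa [Matrix.mulVec, dotProduct, Q] using this
    obtain ⟨r, hr⟩ := this
    exact ⟨r, by rw [hr, mul_comm]⟩
  choose r hr using hd
  refine ⟨Q, (p * Q.map C).updateCol i r, i, by rw [hQ]; exact hi, ?_⟩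
  ext a b : 2
  rw [Matrix.mul_diagonal]
  by_cases hb : b = i
  · subst hb
    rw [hr, Matrix.updateCol_self, Function.update_self]
  · rw [Matrix.updateCol_ne hb, Function.update_of_ne hb, Pi.one_apply, mul_one]

/-- Induction on the degree of the determinant. Each zero is split off as a diagonal factor of known
index, up to an invertible constant matrix. When the determinant is a nonzero constant, the matrix
is invertible over the polynomials and so is the operator. -/
theorem isFredholm_polyOp {S : HalfLine ι →L[ℂ] HalfLine ι} (hS : IsTranslation S) {ε : ℤ}
    (hε : HasIndexStep hS ε) {p : Matrix ι ι ℂ[X]} (hp : ∀ z : ℂ, ‖z‖ = 1 → p.det.eval z ≠ 0) :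
    (polyOp hS p).IsFredholm ∧ index (polyOp hS p).toLinearMap = ε * discRoots p.det := by
  induction hn : p.det.natDegree generalizing p with
  | zero =>
    obtain ⟨c, hc⟩ := natDegree_eq_zero.1 hn
    have hc0 : c ≠ 0 := by
      have := hp 1 (by simp)
      rw [← hc, eval_C] at this
      exact this
    have hu : IsUnit p := by
      rw [Matrix.isUnit_iff_isUnit_det, ← hc]
      exact isUnit_C.2 hc0.isUnit
    have := isFredholm_of_isUnit (hu.map (polyOp hS))
    refine ⟨this.1, ?_⟩
    rw [this.2, ← hc, discRoots_C]
    simp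
  | succ n ih =>
    have hdeg : p.det.degree ≠ 0 := by
      intro h
      rw [natDegree_eq_of_degree_eq_some h] at hn
      simp at hn
    obtain ⟨ζ, hζ⟩ := IsAlgClosed.exists_root p.det hdeg
    have hζ1 : ‖ζ‖ ≠ 1 := fun h => hp ζ h hζ
    obtain ⟨Q, p', i, hQ, h⟩ := exists_mul_eq_mul_diagonal hζ
    have hdet : p.det * C Q.det = p'.det * (X - C ζ) := by
      have := congrArg Matrix.det h
      rw [Matrix.det_mul, Matrix.det_mul, Matrix.det_diagonal, Finset.prod_update_of_mem
        (Finset.mem_univ _)] at this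
      have e := RingHom.map_det (C : ℂ →+* ℂ[X]) Q
      rw [e]
      simpa using this
    have hp0 : p.det ≠ 0 := fun h => by simp [h] at hn
    have hne : p.det * C Q.det ≠ 0 := mul_ne_zero hp0 (C_ne_zero.2 hQ)
    have hp'0 : p'.det ≠ 0 := left_ne_zero_of_mul (hdet ▸ hne)
    have hn' : p'.det.natDegree = n := by
      have := congrArg natDegree hdet
      rw [natDegree_mul_C hQ, natDegree_mul hp'0 (X_sub_C_ne_zero ζ), natDegree_X_sub_C] at this
      omega
    obtain ⟨h₁, h₂⟩ := ih (p := p') (fun z hz h0 => by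
      have := congrArg (eval z) hdet
      rw [eval_mul, eval_mul, h0, zero_mul, eval_C] at this
      exact mul_ne_zero (hp z hz) hQ this) hn'
    obtain ⟨h₃, h₄⟩ := hε i ζ hζ1
    have hQu : IsUnit (Q.map C : Matrix ι ι ℂ[X]) := by
      have : IsUnit Q := (Matrix.isUnit_iff_isUnit_det _).2 hQ.isUnit
      exact this.map (C : ℂ →+* ℂ[X]).mapMatrix
    obtain ⟨u, hu⟩ := hQu.map (polyOp hS)
    have hop : polyOp hS p = polyOp hS p' *
        polyOp hS (Matrix.diagonal (Function.update 1 i (X - C ζ))) * u⁻¹.val := by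
      rw [← map_mul, ← h, map_mul, ← hu, mul_assoc, u.mul_inv, mul_one]
    obtain ⟨h₅, h₆⟩ := isFredholm_of_isUnit (u⁻¹).isUnit
    have h₇ : (polyOp hS p' *
        polyOp hS (Matrix.diagonal (Function.update 1 i (X - C ζ)))).IsFredholm :=
      isFredholm_comp h₁ h₃
    refine ⟨hop ▸ isFredholm_comp h₇ h₅, ?_⟩
    have hr : discRoots p.det = discRoots p'.det + discRoots (X - C ζ) := by
      rw [← discRoots_mul (hdet ▸ hne), ← hdet, discRoots_mul hne, discRoots_C, add_zero]
    rw [hop, index_mul h₇ h₅, index_mul h₁ h₃, h₂, h₄, h₆, hr]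
    push_cast
    ring

end IndexOfPolynomials

/-! ## Logarithmic derivatives along the unit circle -/

section Winding

open Polynomial Real
open scoped Interval

/-- A continuously differentiable function without zeros. -/
structure IsNonvanishing (f : ℝ → ℂ) : Prop where
  contDiff : ContDiff ℝ 1 f
  ne_zero : ∀ k, f k ≠ 0

variable {f g : ℝ → ℂ}

theorem IsNonvanishing.differentiable (hf : IsNonvanishing f) : Differentiable ℝ f :=
  hf.contDiff.differentiable one_ne_zero

theorem IsNonvanishing.continuous_logDeriv (hf : IsNonvanishing f) : Continuous (logDeriv f) :=
  (hf.contDiff.continuous_deriv le_rfl).div hf.contDiff.continuous hf.ne_zero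

theorem IsNonvanishing.intervalIntegrable (hf : IsNonvanishing f) (a b : ℝ) :
    IntervalIntegrable (logDeriv f) MeasureTheory.volume a b :=
  hf.continuous_logDeriv.intervalIntegrable a b

theorem IsNonvanishing.mul (hf : IsNonvanishing f) (hg : IsNonvanishing g) :
    IsNonvanishing fun k => f k * g k :=
  ⟨hf.contDiff.mul hg.contDiff, fun k => mul_ne_zero (hf.ne_zero k) (hg.ne_zero k)⟩

theorem isNonvanishing_const {c : ℂ} (hc : c ≠ 0) : IsNonvanishing fun _ => c :=
  ⟨contDiff_const, fun _ => hc⟩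

theorem IsNonvanishing.comp_neg (hf : IsNonvanishing f) : IsNonvanishing fun k => f (-k) :=
  ⟨hf.contDiff.comp contDiff_neg, fun k => hf.ne_zero (-k)⟩

theorem IsNonvanishing.logDeriv_mul (hf : IsNonvanishing f) (hg : IsNonvanishing g) (k : ℝ) :
    logDeriv (fun k => f k * g k) k = logDeriv f k + logDeriv g k :=
  _root_.logDeriv_mul k (hf.ne_zero k) (hg.ne_zero k) (hf.differentiable k) (hg.differentiable k)

theorem logDeriv_comp_neg (k : ℝ) : logDeriv (fun k => f (-k)) k = -logDeriv f (-k) := by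
  simp only [logDeriv_apply, deriv_comp_neg]
  ring

theorem IsNonvanishing.integral_logDeriv_mul (hf : IsNonvanishing f) (hg : IsNonvanishing g)
    (a b : ℝ) : ∫ k in a..b, logDeriv (fun k => f k * g k) k =
      (∫ k in a..b, logDeriv f k) + ∫ k in a..b, logDeriv g k := by
  rw [← intervalIntegral.integral_add (hf.intervalIntegrable a b) (hg.intervalIntegrable a b)]
  simp only [hf.logDeriv_mul hg]

theorem integral_logDeriv_const (c : ℂ) (a b : ℝ) :
    ∫ k in a..b, logDeriv (fun _ : ℝ => c) k = 0 := by
  simp [logDeriv_apply]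

/-- The product of `f` with the exponential of minus the integral of `f'/f` has zero derivative,
hence is constant. No branch of the logarithm has to be chosen. -/
theorem IsNonvanishing.exp_integral_logDeriv (hf : IsNonvanishing f) (a b : ℝ) :
    Complex.exp (∫ k in a..b, logDeriv f k) = f b / f a := by
  let F : ℝ → ℂ := fun x => f x * Complex.exp (-∫ k in a..x, logDeriv f k)
  have hF : ∀ x, HasDerivAt F 0 x := by
    intro x
    have h1 := intervalIntegral.integral_hasDerivAt_right (hf.intervalIntegrable a x)
      hf.continuous_logDeriv.aestronglyMeasurable.stronglyMeasurableAtFilter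
      hf.continuous_logDeriv.continuousAt
    have h2 := (hf.differentiable x).hasDerivAt.mul h1.neg.cexp
    refine h2.congr_deriv ?_
    have := hf.ne_zero x
    rw [logDeriv_apply]
    field_simp
    ring
  have hc := is_const_of_deriv_eq_zero (fun x => (hF x).differentiableAt) (fun x => (hF x).deriv) b a
  simp only [F, intervalIntegral.integral_same, Complex.exp_neg, Complex.exp_zero, inv_one,
    mul_one] at hc
  rw [← hc]
  have := hf.ne_zero b
  field_simp

/-- The restriction of a polynomial to the unit circle. -/
def onCircle (q : ℂ[X]) (k : ℝ) : ℂ := q.eval (Complex.exp (k * Complex.I))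

theorem hasDerivAt_circle (k : ℝ) :
    HasDerivAt (fun k : ℝ => Complex.exp (k * Complex.I))
      (Complex.exp (k * Complex.I) * Complex.I) k := by
  have h : HasDerivAt (fun k : ℝ => (k : ℂ) * Complex.I) (1 * Complex.I) k :=
    (Complex.ofRealCLM.hasDerivAt (x := k)).mul_const Complex.I
  simpa using h.cexp

theorem contDiff_onCircle (q : ℂ[X]) : ContDiff ℝ 1 (onCircle q) := by
  have h1 : ContDiff ℝ 1 fun k : ℝ => Complex.exp (k * Complex.I) :=
    ((Complex.ofRealCLM.contDiff).mul contDiff_const).cexp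
  have h2 : ContDiff ℝ 1 fun z : ℂ => q.eval z := by
    simpa using (Polynomial.contDiff_aeval (𝕜 := ℂ) (R := ℂ) q 1).restrict_scalars ℝ
  exact h2.comp h1

theorem norm_exp_mul_I (k : ℝ) : ‖Complex.exp (k * Complex.I)‖ = 1 :=
  Complex.norm_exp_ofReal_mul_I k

theorem isNonvanishing_onCircle {q : ℂ[X]} (hq : ∀ z : ℂ, ‖z‖ = 1 → q.eval z ≠ 0) :
    IsNonvanishing (onCircle q) :=
  ⟨contDiff_onCircle q, fun k => hq _ (norm_exp_mul_I k)⟩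

theorem onCircle_mul (q r : ℂ[X]) : onCircle (q * r) = fun k => onCircle q k * onCircle r k := by
  ext k
  simp [onCircle]

/-- By periodicity the integral may be taken over `[0, 2π]`, where it is the contour integral of `(z
- ζ)⁻¹` over the unit circle: `2πi` for `ζ` inside, zero by Cauchy's theorem for `ζ` outside. -/
theorem integral_logDeriv_X_sub_C {ζ : ℂ} (hζ : ‖ζ‖ ≠ 1) :
    ∫ k in (-π)..π, logDeriv (onCircle (X - C ζ)) k =
      2 * π * Complex.I * discRoots (X - C ζ) := by
  have hper : Function.Periodic (logDeriv (onCircle (X - C ζ))) (2 * π) := by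
    have h : Function.Periodic (onCircle (X - C ζ)) (2 * π) := by
      intro k
      simp only [onCircle]
      congr 1
      push_cast
      rw [add_mul, Complex.exp_add, Complex.exp_two_pi_mul_I, mul_one]
    intro k
    rw [logDeriv_apply, logDeriv_apply, h k, ← deriv_comp_add_const]
    congr 2
    exact funext h
  have h1 : ∫ k in (-π)..π, logDeriv (onCircle (X - C ζ)) k =
      ∫ k in (0 : ℝ)..(2 * π), logDeriv (onCircle (X - C ζ)) k := by
    have := hper.intervalIntegral_add_eq (-π) 0
    rw [zero_add] at this
    rw [← this]
    congr 1
    ring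
  have h2 : ∫ k in (0 : ℝ)..(2 * π), logDeriv (onCircle (X - C ζ)) k =
      ∮ z in C(0, 1), (z - ζ)⁻¹ := by
    rw [circleIntegral]
    refine intervalIntegral.integral_congr fun k _ => ?_
    have hd : deriv (onCircle (X - C ζ)) k = Complex.exp (k * Complex.I) * Complex.I := by
      have : onCircle (X - C ζ) = fun k : ℝ => Complex.exp (k * Complex.I) - ζ := by
        ext k
        simp [onCircle]
      rw [this]
      exact ((hasDerivAt_circle k).sub_const ζ).deriv
    simp only [logDeriv_apply, hd, deriv_circleMap, circleMap, onCircle]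
    simp [div_eq_mul_inv]
  rw [h1, h2, discRoots_X_sub_C]
  rcases lt_or_gt_of_ne hζ with hζ | hζ
  · rw [circleIntegral.integral_sub_inv_of_mem_ball (by simpa using hζ)]
    simp [hζ]
  · rw [Complex.circleIntegral_eq_zero_of_differentiable_on_off_countable zero_le_one
      Set.countable_empty]
    · simp [hζ.le]
    · refine ContinuousOn.inv₀ (by fun_prop) fun z hz h0 => ?_
      rw [sub_eq_zero] at h0
      subst h0
      simp at hz
      linarith
    · intro z hz
      refine DifferentiableAt.inv (by fun_prop) fun h0 => ?_
      rw [sub_eq_zero] at h0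
      subst h0
      simp at hz
      linarith

/-- The argument principle for a polynomial on the unit circle. -/
theorem integral_logDeriv_onCircle {q : ℂ[X]} (hq : ∀ z : ℂ, ‖z‖ = 1 → q.eval z ≠ 0) :
    ∫ k in (-π)..π, logDeriv (onCircle q) k = 2 * π * Complex.I * discRoots q := by
  induction hn : q.natDegree generalizing q with
  | zero =>
    obtain ⟨c, rfl⟩ := natDegree_eq_zero.1 hn
    have : onCircle (C c) = fun _ => c := by
      ext k
      simp [onCircle]
    rw [this, integral_logDeriv_const, discRoots_C]
    simp
  | succ n ih =>
    have hdeg : q.degree ≠ 0 := by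
      intro h
      rw [natDegree_eq_of_degree_eq_some h] at hn
      simp at hn
    obtain ⟨ζ, hζ⟩ := IsAlgClosed.exists_root q hdeg
    have hζ1 : ‖ζ‖ ≠ 1 := fun h => hq ζ h hζ
    obtain ⟨r, rfl⟩ := dvd_iff_isRoot.2 hζ
    have hne : (X - C ζ) * r ≠ 0 := fun h => by simp [h] at hn
    have h1 : ∀ z : ℂ, ‖z‖ = 1 → (X - C ζ).eval z ≠ 0 := fun z hz h0 =>
      hq z hz (by rw [eval_mul, h0, zero_mul])
    have h2 : ∀ z : ℂ, ‖z‖ = 1 → r.eval z ≠ 0 := fun z hz h0 =>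
      hq z hz (by rw [eval_mul, h0, mul_zero])
    have hn' : r.natDegree = n := by
      rw [natDegree_mul (X_sub_C_ne_zero ζ) (right_ne_zero_of_mul hne), natDegree_X_sub_C] at hn
      omega
    rw [onCircle_mul, (isNonvanishing_onCircle h1).integral_logDeriv_mul
      (isNonvanishing_onCircle h2), integral_logDeriv_X_sub_C hζ1, ih h2 hn', discRoots_mul hne]
    push_cast
    ring

theorem integral_logDeriv_comp_neg (f : ℝ → ℂ) :
    ∫ k in (0 : ℝ)..π, logDeriv (fun k => f (-k)) k = -∫ k in (-π)..0, logDeriv f k := by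
  simp only [logDeriv_comp_neg]
  rw [intervalIntegral.integral_neg, intervalIntegral.integral_comp_neg (fun k => logDeriv f k)]
  simp

/-- The exponent is half the difference of the integrals over the upper and lower half circles. It
equals the upper integral minus half the full one; the former exponentiates to the quotient of
values at `-1` and `1`, and the latter is `πi` times the number of zeros in the disc. -/
theorem exp_half_integral_onCircle {q : ℂ[X]} (hq : ∀ z : ℂ, ‖z‖ = 1 → q.eval z ≠ 0) :
    Complex.exp (1 / 2 * ∫ k in (0 : ℝ)..π,
      logDeriv (fun k => onCircle q k * onCircle q (-k)) k) =
    q.eval (-1) / q.eval 1 * (-1) ^ discRoots q := by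
  have h := isNonvanishing_onCircle hq
  rw [h.integral_logDeriv_mul h.comp_neg, integral_logDeriv_comp_neg]
  have h1 := intervalIntegral.integral_add_adjacent_intervals (h.intervalIntegrable (-π) 0)
    (h.intervalIntegrable 0 π)
  rw [integral_logDeriv_onCircle hq] at h1
  have h2 : 1 / 2 * ((∫ k in (0 : ℝ)..π, logDeriv (onCircle q) k) +
      -∫ k in (-π)..0, logDeriv (onCircle q) k) =
      (∫ k in (0 : ℝ)..π, logDeriv (onCircle q) k) + (discRoots q : ℂ) * (-(π * Complex.I)) := by
    linear_combination (-1 / 2 : ℂ) * h1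
  rw [h2, Complex.exp_add, h.exp_integral_logDeriv, Complex.exp_nat_mul, Complex.exp_neg,
    Complex.exp_pi_mul_I]
  simp [onCircle]

end Winding

/-! ## Skew-hermitian matrices of Laurent polynomials

The involution of the ring of Laurent polynomials is `z ↦ z⁻¹`. -/

section Laurent

open LaurentPolynomial

/-- Evaluation of a Laurent polynomial. -/
def evalUnit (z : ℂˣ) : ℂ[T;T⁻¹] →+* ℂ := LaurentPolynomial.eval₂ (RingHom.id ℂ) z

theorem evalUnit_T (z : ℂˣ) (n : ℤ) : evalUnit z (T n) = (z : ℂ) ^ n := by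
  simp [evalUnit]

theorem evalUnit_C (z : ℂˣ) (c : ℂ) : evalUnit z (C c) = c := by
  simp [evalUnit]

theorem evalUnit_toLaurent (z : ℂˣ) (p : Polynomial ℂ) :
    evalUnit z (Polynomial.toLaurent p) = p.eval (z : ℂ) := by
  simp [evalUnit, Polynomial.eval₂_id]

theorem evalUnit_invert (z : ℂˣ) (f : ℂ[T;T⁻¹]) : evalUnit z (invert f) = evalUnit z⁻¹ f := by
  induction f using LaurentPolynomial.induction_on' with
  | add p q hp hq => rw [map_add, map_add, map_add, hp, hq]
  | C_mul_T n a => simp [evalUnit_T, evalUnit_C]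

/-- `f` has no zeros on the unit circle. -/
def CircleUnit (f : ℂ[T;T⁻¹]) : Prop := ∀ z : ℂˣ, ‖(z : ℂ)‖ = 1 → evalUnit z f ≠ 0

theorem circleUnit_mul {f g : ℂ[T;T⁻¹]} : CircleUnit (f * g) ↔ CircleUnit f ∧ CircleUnit g := by
  simp only [CircleUnit, map_mul, mul_ne_zero_iff]
  exact ⟨fun h => ⟨fun z hz => (h z hz).1, fun z hz => (h z hz).2⟩,
    fun h z hz => ⟨h.1 z hz, h.2 z hz⟩⟩

theorem CircleUnit.invert {f : ℂ[T;T⁻¹]} (hf : CircleUnit f) :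
    CircleUnit (LaurentPolynomial.invert f) := fun z hz => by
  rw [evalUnit_invert]
  exact hf _ (by simp [hz])

theorem CircleUnit.of_isUnit {f : ℂ[T;T⁻¹]} (hf : IsUnit f) : CircleUnit f := fun z _ =>
  (hf.map (evalUnit z)).ne_zero

theorem CircleUnit.one : CircleUnit 1 := .of_isUnit isUnit_one

theorem CircleUnit.pow {f : ℂ[T;T⁻¹]} (hf : CircleUnit f) (n : ℕ) : CircleUnit (f ^ n) :=
  fun z hz => by
    rw [map_pow]
    exact pow_ne_zero _ (hf z hz)

/-- With `t = z + z⁻¹`, the recurrence `z^(n+2) + z^(-n-2) = t (z^(n+1) + z^(-n-1)) - (z^n +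
z^(-n))` expresses every symmetrized monomial as a polynomial in `t`. -/
theorem add_invert_mem_range (f : ℂ[T;T⁻¹]) :
    f + invert f ∈ (Polynomial.aeval (T 1 + T (-1) : ℂ[T;T⁻¹]) : Polynomial ℂ →ₐ[ℂ] _).range := by
  set t : ℂ[T;T⁻¹] := T 1 + T (-1)
  set A := (Polynomial.aeval t : Polynomial ℂ →ₐ[ℂ] ℂ[T;T⁻¹]).range
  have ht : t ∈ A := ⟨Polynomial.X, by simp⟩
  have key : ∀ n : ℕ, (T n + T (-n) : ℂ[T;T⁻¹]) ∈ A := by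
    intro n
    induction n using Nat.strong_induction_on with
    | _ n ih =>
      match n with
      | 0 => simpa using A.add_mem A.one_mem A.one_mem
      | 1 => simpa using ht
      | n + 2 =>
        have e : (T ((n + 2 : ℕ) : ℤ) + T (-((n + 2 : ℕ) : ℤ)) : ℂ[T;T⁻¹]) =
            t * (T ((n + 1 : ℕ) : ℤ) + T (-((n + 1 : ℕ) : ℤ))) - (T (n : ℤ) + T (-(n : ℤ))) := by
          simp only [t, add_mul, mul_add, ← T_add]
          push_cast
          ring_nf
        rw [e]
        exact A.sub_mem (A.mul_mem ht (ih (n + 1) (by omega))) (ih n (by omega))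
  induction f using LaurentPolynomial.induction_on' with
  | add p q hp hq =>
    rw [map_add, add_add_add_comm]
    exact A.add_mem hp hq
  | C_mul_T n a =>
    rw [map_mul, invert_C, invert_T, ← mul_add, ← smul_eq_C_mul]
    refine A.smul_mem ?_ a
    obtain ⟨m, rfl | rfl⟩ := n.eq_nat_or_neg
    · exact key m
    · rw [neg_neg, add_comm]
      exact key m

/-- Norms are multiplicative, so linear factors suffice. If `ζ` and `ζ'` are the roots of `x² - r x
+ 1`, then `z + z⁻¹ - r = -ζ' (z - ζ) (z⁻¹ - ζ)`, and the constant `-ζ'` is absorbed by its square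
root `c`. -/
theorem exists_mul_invert_eq_aeval (p : Polynomial ℂ) :
    ∃ g : ℂ[T;T⁻¹], g * invert g = Polynomial.aeval (T 1 + T (-1) : ℂ[T;T⁻¹]) p := by
  induction hn : p.natDegree generalizing p with
  | zero =>
    obtain ⟨c, rfl⟩ := Polynomial.natDegree_eq_zero.1 hn
    obtain ⟨r, hr⟩ := IsAlgClosed.exists_pow_nat_eq c zero_lt_two
    exact ⟨C r, by rw [invert_C, ← map_mul, ← sq, hr, Polynomial.aeval_C, LaurentPolynomial.algebraMap_apply]; rfl⟩
  | succ n ih =>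
    have hdeg : p.degree ≠ 0 := by
      intro h
      rw [Polynomial.natDegree_eq_of_degree_eq_some h] at hn
      simp at hn
    obtain ⟨r, hr⟩ := IsAlgClosed.exists_root p hdeg
    obtain ⟨q, rfl⟩ := Polynomial.dvd_iff_isRoot.2 hr
    have hne : (Polynomial.X - Polynomial.C r) * q ≠ 0 := fun h => by simp [h] at hn
    have hn' : q.natDegree = n := by
      rw [Polynomial.natDegree_mul (Polynomial.X_sub_C_ne_zero r) (right_ne_zero_of_mul hne),
        Polynomial.natDegree_X_sub_C] at hn
      omega
    obtain ⟨g, hg⟩ := ih q hn'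
    obtain ⟨w, hw⟩ := IsAlgClosed.exists_pow_nat_eq (r ^ 2 - 4) zero_lt_two
    have hζ : ((r + w) / 2) * ((r - w) / 2) = 1 := by linear_combination (-1 / 4 : ℂ) * hw
    set ζ := (r + w) / 2
    set ζ' := (r - w) / 2
    have hr' : r = ζ + ζ' := by simp only [ζ, ζ']; ring
    obtain ⟨c, hc⟩ := IsAlgClosed.exists_pow_nat_eq (-ζ') zero_lt_two
    refine ⟨C c * (T 1 - C ζ) * g, ?_⟩
    have hT : (T 1 * T (-1) : ℂ[T;T⁻¹]) = 1 := by rw [← T_add]; simp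
    have h1 : (C c * C c : ℂ[T;T⁻¹]) = -C ζ' := by rw [← map_mul, ← sq, hc, map_neg]
    have h2 : (C ζ * C ζ' : ℂ[T;T⁻¹]) = 1 := by rw [← map_mul, hζ, map_one]
    rw [map_mul, map_mul, map_mul, map_sub, invert_C, invert_C, invert_T, ← hg, map_sub,
      Polynomial.aeval_X, Polynomial.aeval_C, LaurentPolynomial.algebraMap_apply]
    have h3 : (C (algebraMap ℂ ℂ r) : ℂ[T;T⁻¹]) = C ζ + C ζ' := by rw [← map_add, ← hr']; rfl
    rw [h3]
    linear_combination (g * invert g) * ((T 1 - C ζ) * (T (-1) - C ζ) * h1 - C ζ' * hT +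
      (T 1 + T (-1) - C ζ) * h2)

/-- Every invariant Laurent polynomial is a norm. -/
theorem exists_mul_invert_eq {f : ℂ[T;T⁻¹]} (hf : invert f = f) :
    ∃ g, g * invert g = f := by
  -- An invariant `f` is the symmetrization of `f / 2`, hence a polynomial in `z + z⁻¹`.
  obtain ⟨p, hp⟩ := add_invert_mem_range (C (1 / 2) * f)
  obtain ⟨g, hg⟩ := exists_mul_invert_eq_aeval p
  refine ⟨g, ?_⟩
  rw [hg]
  refine hp.trans ?_
  rw [map_mul, invert_C, hf, ← add_mul, ← map_add]
  norm_num

/-- A vector over a principal ideal domain is a multiple of a column of an invertible matrix. -/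
theorem exists_isUnit_det_eq_mul {R ι : Type*} [CommRing R] [IsDomain R] [IsPrincipalIdealRing R]
    [Fintype ι] [DecidableEq ι] [Nonempty ι] (v : ι → R) :
    ∃ (B : Matrix ι ι R) (j : ι) (c : R), IsUnit B.det ∧ ∀ a, v a = c * B a j := by
  -- The Smith normal form adapts a basis of the whole module to the submodule spanned by `v`, which
  -- has rank at most one; rank zero means `v = 0`.
  obtain ⟨n, snf⟩ := Submodule.smithNormalForm (Pi.basisFun R ι) (Submodule.span R {v})
  have hn : n ≤ 1 := by
    have h1 := Module.finrank_eq_card_basis snf.bN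
    have h2 := finrank_span_le_card (R := R) ({v} : Set (ι → R))
    rw [Fintype.card_fin] at h1
    rw [h1] at h2
    simpa using h2
  have hv := snf.bN.sum_repr ⟨v, Submodule.mem_span_singleton_self v⟩
  have hv' : v = ∑ i, snf.bN.repr ⟨v, Submodule.mem_span_singleton_self v⟩ i •
      (snf.bN i : ι → R) := by
    have := congrArg (Submodule.span R {v}).subtype hv
    rw [map_sum] at this
    simp only [map_smul, Submodule.subtype_apply] at this
    exact this.symm
  generalize snf.bN.repr ⟨v, Submodule.mem_span_singleton_self v⟩ = x at hv'
  interval_cases n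
  · refine ⟨1, Classical.arbitrary ι, 0, by simp, fun a => ?_⟩
    rw [hv']
    simp
  · refine ⟨(Pi.basisFun R ι).toMatrix snf.bM, snf.f 0, x 0 * snf.a 0, ?_, fun a => ?_⟩
    · rw [← Module.Basis.det_apply]
      exact (Pi.basisFun R ι).isUnit_det snf.bM
    · have ha := congrFun hv' a
      rw [Fin.sum_univ_one, snf.snf] at ha
      rw [ha]
      simp [Module.Basis.toMatrix_apply, mul_assoc]

theorem exists_isUnit_det_eq_mul_laurent {ι : Type*} [Fintype ι] [DecidableEq ι] [Nonempty ι]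
    (v : ι → ℂ[T;T⁻¹]) :
    ∃ (B : Matrix ι ι ℂ[T;T⁻¹]) (j : ι) (c : ℂ[T;T⁻¹]), IsUnit B.det ∧ ∀ a, v a = c * B a j := by
  choose n p hp using fun a => (v a).exists_T_pow
  -- Entry `a` becomes polynomial after multiplication by `T (n a)`. The extra exponent, the sum
  -- over the other entries, gives all entries the same total power of `T`, which is then moved into
  -- the scalar `c`.
  obtain ⟨B, j, c, hB, h⟩ := exists_isUnit_det_eq_mul
    fun a => p a * Polynomial.X ^ (∑ b ∈ Finset.univ.erase a, n b)
  refine ⟨B.map Polynomial.toLaurent, j,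
    T (-((∑ b, n b : ℕ) : ℤ)) * Polynomial.toLaurent c, ?_, fun a => ?_⟩
  · have := RingHom.map_det (Polynomial.toLaurent : Polynomial ℂ →+* ℂ[T;T⁻¹]) B
    rw [RingHom.mapMatrix_apply] at this
    rw [← this]
    exact hB.map _
  · have h1 := congrArg Polynomial.toLaurent (h a)
    rw [map_mul, map_mul, Polynomial.toLaurent_X_pow, hp, mul_assoc, ← T_add] at h1
    have h2 : (n a : ℤ) + ((∑ b ∈ Finset.univ.erase a, n b : ℕ) : ℤ) = ((∑ b, n b : ℕ) : ℤ) := by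
      rw [← Nat.cast_add, Finset.add_sum_erase _ _ (Finset.mem_univ a)]
    rw [h2] at h1
    rw [Matrix.map_apply, mul_assoc, ← h1, mul_comm, mul_assoc, ← T_add]
    simp

end Laurent

/-! ### Congruence of skew-hermitian Laurent matrices to the standard skew form -/

section Hyperbolic

open LaurentPolynomial

variable {ι κ μ : Type} [Fintype ι] [DecidableEq ι] [Fintype κ] [DecidableEq κ] [Fintype μ]
  [DecidableEq μ]

theorem invert_invert (f : ℂ[T;T⁻¹]) : invert (invert f) = f := involutive_invert f

/-- The adjoint of a matrix of Laurent polynomials. -/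
def dagger {m n : Type*} (M : Matrix m n ℂ[T;T⁻¹]) : Matrix n m ℂ[T;T⁻¹] := (M.map invert)ᵀ

theorem dagger_apply {m n : Type*} (M : Matrix m n ℂ[T;T⁻¹]) (i : n) (j : m) :
    dagger M i j = invert (M j i) := rfl

theorem dagger_mul (M : Matrix ι κ ℂ[T;T⁻¹]) (N : Matrix κ μ ℂ[T;T⁻¹]) :
    dagger (M * N) = dagger N * dagger M := by
  refine Matrix.ext fun i j => ?_
  simp only [dagger_apply, Matrix.mul_apply, map_sum, map_mul, mul_comm]

theorem dagger_dagger (M : Matrix ι κ ℂ[T;T⁻¹]) : dagger (dagger M) = M := by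
  refine Matrix.ext fun i j => ?_
  simp only [dagger_apply, invert_invert]

theorem det_dagger (M : Matrix ι ι ℂ[T;T⁻¹]) : (dagger M).det = invert M.det := by
  rw [dagger, Matrix.det_transpose]
  exact (RingHom.map_det (invert : ℂ[T;T⁻¹] ≃ₐ[ℂ] ℂ[T;T⁻¹]).toRingEquiv.toRingHom M).symm

theorem dagger_congruence {A : Matrix ι ι ℂ[T;T⁻¹]} (hA : dagger A = -A)
    (B : Matrix ι ι ℂ[T;T⁻¹]) : dagger (dagger B * A * B) = -(dagger B * A * B) := by
  rw [dagger_mul, dagger_mul, dagger_dagger, hA]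
  simp [Matrix.mul_assoc]

theorem circleUnit_det_congruence {A B : Matrix ι ι ℂ[T;T⁻¹]} (hA : CircleUnit A.det)
    (hB : CircleUnit B.det) : CircleUnit (dagger B * A * B).det := by
  rw [Matrix.det_mul, Matrix.det_mul, det_dagger]
  exact circleUnit_mul.2 ⟨circleUnit_mul.2 ⟨hB.invert, hA⟩, hB⟩

/-- The standard skew-symmetric matrix, for a pairing of the indices. -/
def stdSkew (e : μ × Fin 2 ≃ ι) : Matrix ι ι ℂ :=
  ((1 : Matrix μ μ ℂ) ⊗ₖ !![0, 1; -1, 0]).submatrix e.symm e.symm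

/-- `A` is congruent to the standard skew-symmetric matrix, over the Laurent polynomials localized
at those without zeros on the unit circle. -/
def IsHyperbolic (A : Matrix ι ι ℂ[T;T⁻¹]) : Prop :=
  ∃ (μ : Type) (_ : Fintype μ) (_ : DecidableEq μ) (e : μ × Fin 2 ≃ ι) (G D : Matrix ι ι ℂ[T;T⁻¹]),
    CircleUnit G.det ∧ CircleUnit D.det ∧
      dagger G * A * G = dagger D * (stdSkew e).map C * D

theorem IsHyperbolic.of_congruence {A B : Matrix ι ι ℂ[T;T⁻¹]} (hB : CircleUnit B.det)
    (h : IsHyperbolic (dagger B * A * B)) : IsHyperbolic A := by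
  obtain ⟨μ, i₁, i₂, e, G, D, hG, hD, hGD⟩ := h
  refine ⟨μ, i₁, i₂, e, B * G, D, ?_, hD, ?_⟩
  · rw [Matrix.det_mul]
    exact circleUnit_mul.2 ⟨hB, hG⟩
  · rw [← hGD, dagger_mul]
    simp only [Matrix.mul_assoc]

theorem IsHyperbolic.of_submatrix {A : Matrix ι ι ℂ[T;T⁻¹]} (f : κ ≃ ι)
    (h : IsHyperbolic (A.submatrix f f)) : IsHyperbolic A := by
  obtain ⟨μ, i₁, i₂, e, G, D, hG, hD, hGD⟩ := h
  refine ⟨μ, i₁, i₂, e.trans f, G.submatrix f.symm f.symm, D.submatrix f.symm f.symm, ?_, ?_, ?_⟩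
  · rwa [Matrix.det_submatrix_equiv_self]
  · rwa [Matrix.det_submatrix_equiv_self]
  · have := congrArg (fun M => M.submatrix f.symm f.symm) hGD
    simp only [← Matrix.submatrix_mul_equiv _ _ _ f.symm, Matrix.submatrix_submatrix,
      Equiv.self_comp_symm, Matrix.submatrix_id_id] at this
    exact this

/-- The off-diagonal block with entry `s` is `D† J D` for `D = diag(1, s)`, so only the factor on
the right-hand side grows and nothing has to be divided by `s`. -/
theorem IsHyperbolic.fromBlocks {A : Matrix κ κ ℂ[T;T⁻¹]} (hA : IsHyperbolic A)
    {s : ℂ[T;T⁻¹]} (hs : CircleUnit s) :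
    IsHyperbolic (Matrix.fromBlocks !![0, s; -invert s, 0] 0 0 A :
      Matrix (Fin 2 ⊕ κ) (Fin 2 ⊕ κ) ℂ[T;T⁻¹]) := by
  obtain ⟨μ, _, _, e, G, D, hG, hD, hGD⟩ := hA
  let e' : (Unit ⊕ μ) × Fin 2 ≃ Fin 2 ⊕ κ :=
    (Equiv.sumProdDistrib Unit μ (Fin 2)).trans (Equiv.sumCongr (Equiv.uniqueProd (Fin 2) Unit) e)
  have he : stdSkew e' = Matrix.fromBlocks !![0, 1; -1, 0] 0 0 (stdSkew e) := by
    ext i j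
    rcases i with i | i <;> rcases j with j | j <;>
      simp [stdSkew, e', Matrix.one_apply]
  refine ⟨Unit ⊕ μ, inferInstance, inferInstance, e', Matrix.fromBlocks 1 0 0 G,
    Matrix.fromBlocks !![1, 0; 0, s] 0 0 D, ?_, ?_, ?_⟩
  · rwa [Matrix.det_fromBlocks_zero₂₁, Matrix.det_one, one_mul]
  · rw [Matrix.det_fromBlocks_zero₂₁, Matrix.det_fin_two_of]
    simpa using circleUnit_mul.2 ⟨hs, hD⟩
  · rw [he]
    simp only [dagger, Matrix.fromBlocks_map, Matrix.fromBlocks_transpose,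
      Matrix.fromBlocks_multiply]
    simp only [dagger] at hGD
    rw [Matrix.fromBlocks_inj]
    refine ⟨?_, ?_, ?_, ?_⟩
    · refine Matrix.ext fun i j => ?_
      fin_cases i <;> fin_cases j <;> simp [Matrix.mul_apply, Fin.sum_univ_two]
    · simp
    · simp
    · simpa using hGD

theorem exists_column_isUnit_det {ι : Type*} [Fintype ι] [DecidableEq ι] (v : ι → ℂ[T;T⁻¹])
    (j : ι) : ∃ (B : Matrix ι ι ℂ[T;T⁻¹]) (c : ℂ[T;T⁻¹]), IsUnit B.det ∧
      ∀ a, v a = c * B a j := by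
  have : Nonempty ι := ⟨j⟩
  obtain ⟨B, i, c, hB, h⟩ := exists_isUnit_det_eq_mul_laurent v
  refine ⟨B.submatrix id (Equiv.swap i j), c, ?_, fun a => by simp [h]⟩
  rw [Matrix.det_permute']
  exact (((Equiv.Perm.sign (Equiv.swap i j)).isUnit).map (Int.castRingHom _)).mul hB

theorem congruence_apply (A B : Matrix ι ι ℂ[T;T⁻¹]) (i j : ι) :
    (dagger B * A * B) i j = ∑ a, ∑ b, invert (B a i) * A a b * B b j := by
  simp only [Matrix.mul_apply, dagger_apply, Finset.sum_mul]
  rw [Finset.sum_comm]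

/-- It suffices to search in the span of two basis vectors. Completing the square there reduces
isotropy to writing the determinant of the 2 by 2 block, an invariant Laurent polynomial, as a norm
`β β*`. -/
theorem exists_isotropic_vector {A : Matrix ι ι ℂ[T;T⁻¹]} (hA : dagger A = -A) {j l : ι}
    (hjl : j ≠ l) : ∃ x : ι → ℂ[T;T⁻¹], x ≠ 0 ∧ ∑ a, ∑ b, invert (x a) * A a b * x b = 0 := by
  have skew : ∀ a b, invert (A a b) = -A b a := fun a b => congrFun (congrFun hA b) a
  have form : ∀ α γ : ℂ[T;T⁻¹], ∑ a, ∑ b, invert ((Pi.single j α + Pi.single l γ : ι → _) a) *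
      A a b * (Pi.single j α + Pi.single l γ : ι → _) b =
      invert α * A j j * α + invert α * A j l * γ + invert γ * A l j * α +
        invert γ * A l l * γ := by
    intro α γ
    have h1 : ∀ x y : ι → ℂ[T;T⁻¹], (fun a => invert (x a)) = y →
        ∑ a, ∑ b, invert (x a) * A a b * x b = y ⬝ᵥ A *ᵥ x := by
      rintro x y rfl
      simp only [dotProduct, Matrix.mulVec, Finset.mul_sum, mul_assoc]
    have h2 : (fun a => invert ((Pi.single j α + Pi.single l γ : ι → ℂ[T;T⁻¹]) a)) =
        Pi.single j (invert α) + Pi.single l (invert γ) := by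
      ext a : 1
      simp only [Pi.add_apply, map_add]
      congr 1
      · exact Pi.apply_single (fun _ => invert) (fun _ => map_zero invert) j α a
      · exact Pi.apply_single (fun _ => invert) (fun _ => map_zero invert) l γ a
    rw [h1 _ _ h2]
    simp only [Matrix.mulVec_add, add_dotProduct, single_dotProduct, Pi.add_apply,
      Matrix.mulVec_single, Pi.smul_apply, MulOpposite.smul_eq_mul_unop, MulOpposite.unop_op,
      Matrix.col_apply]
    ring
  by_cases ha : A j j = 0
  · refine ⟨Pi.single j 1 + Pi.single l 0, ?_, ?_⟩
    · simp
    · rw [form]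
      simp [ha]
  · obtain ⟨β, hβ⟩ := exists_mul_invert_eq (f := A j j * A l l + A j l * invert (A j l)) (by
      rw [map_add, map_mul, map_mul, invert_invert, skew, skew]
      ring)
    -- At coordinates `(α, A j j)` the form is `A j j` times `(α + A j l)(α + A j l)*` minus the 2
    -- by 2 determinant; hence `α + A j l = β`.
    refine ⟨Pi.single j (β - A j l) + Pi.single l (A j j), fun h => ha ?_, ?_⟩
    · have := congrFun h l
      simpa [hjl.symm] using this
    · rw [form]
      have h1 : A l j = -invert (A j l) := by rw [skew, neg_neg]
      rw [map_sub, skew j j, h1]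
      linear_combination A j j * hβ

/-- An isotropic vector is a multiple `c` of a column of an invertible matrix, placed at position
`j`. The value of the form there is multiplied by `c* c ≠ 0`, so the column is isotropic as well. -/
theorem exists_congruence_diag_eq_zero {A : Matrix ι ι ℂ[T;T⁻¹]} (hA : dagger A = -A) {j l : ι}
    (hjl : j ≠ l) : ∃ B : Matrix ι ι ℂ[T;T⁻¹], IsUnit B.det ∧ (dagger B * A * B) j j = 0 := by
  obtain ⟨x, hx, h⟩ := exists_isotropic_vector hA hjl
  obtain ⟨B, c, hB, hc⟩ := exists_column_isUnit_det x j
  refine ⟨B, hB, ?_⟩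
  have hc0 : c ≠ 0 := fun h => hx (funext fun a => by simp [hc, h])
  have hc' : invert c * c ≠ 0 :=
    mul_ne_zero ((map_ne_zero_iff _ (AlgEquiv.injective _)).2 hc0) hc0
  refine (mul_eq_zero.1 ?_).resolve_left hc'
  rw [congruence_apply, ← h, Finset.mul_sum]
  refine Finset.sum_congr rfl fun a _ => ?_
  rw [Finset.mul_sum]
  refine Finset.sum_congr rfl fun b _ => ?_
  rw [hc, hc, map_mul]
  ring

/-- Row `j` without its zero diagonal entry is `c` times a column of some invertible `B`. Changing
the other basis vectors by the inverse transpose of `B` sends it to `c` times a unit vector, and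
keeping basis vector `j` fixed ensures that only the right factor acts on row `j`. -/
theorem exists_congruence_row {A : Matrix ι ι ℂ[T;T⁻¹]} {j l : ι} (hjl : j ≠ l)
    (hA : A j j = 0) : ∃ (V : Matrix ι ι ℂ[T;T⁻¹]) (s : ℂ[T;T⁻¹]), IsUnit V.det ∧
      ∀ b, (dagger V * A * V) j b = if b = l then s else 0 := by
  obtain ⟨B, c, hB, hc⟩ := exists_column_isUnit_det (fun a : {a // ¬a = j} => A j a) ⟨l, hjl.symm⟩
  let σ := Equiv.sumCompl fun a => a = j
  have hB' : IsUnit (Bᵀ).det := by rwa [Matrix.det_transpose]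
  let V : Matrix ι ι ℂ[T;T⁻¹] :=
    (Matrix.fromBlocks (1 : Matrix {a // a = j} {a // a = j} ℂ[T;T⁻¹]) 0 0 (Bᵀ)⁻¹).submatrix
      σ.symm σ.symm
  have hj : σ.symm j = Sum.inl ⟨j, rfl⟩ := Equiv.sumCompl_symm_apply_of_pos (p := fun a => a = j) rfl
  have hVj : ∀ a, V a j = if a = j then 1 else 0 := by
    intro a
    simp only [V, Matrix.submatrix_apply, hj]
    by_cases ha : a = j
    · subst ha
      rw [hj]
      simp
    · have : σ.symm a = Sum.inr ⟨a, ha⟩ := Equiv.sumCompl_symm_apply_of_neg (p := fun a => a = j) ha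
      rw [this]
      simp [ha]
  refine ⟨V, c, ?_, fun b => ?_⟩
  · rw [Matrix.det_submatrix_equiv_self, Matrix.det_fromBlocks_zero₂₁, Matrix.det_one, one_mul]
    exact (Matrix.isUnit_nonsing_inv_det_iff).2 hB'
  · have h1 : (dagger V * A * V) j b = ∑ a, A j a * V a b := by
      rw [congruence_apply, Finset.sum_eq_single j]
      · simp [hVj]
      · intro a _ ha
        simp [hVj, ha]
      · simp
    rw [h1]
    by_cases hb : b = j
    · subst hb
      rw [if_neg hjl]
      refine Finset.sum_eq_zero fun a _ => ?_
      rw [hVj]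
      split_ifs with ha
      · rw [ha, hA, zero_mul]
      · rw [mul_zero]
    · have hb' : σ.symm b = Sum.inr ⟨b, hb⟩ := Equiv.sumCompl_symm_apply_of_neg (p := fun a => a = j) hb
      rw [← σ.sum_comp, Fintype.sum_sum_type]
      simp only [V, Matrix.submatrix_apply, Equiv.symm_apply_apply, hb', Matrix.fromBlocks_apply₁₂,
        Matrix.fromBlocks_apply₂₂, Matrix.zero_apply, mul_zero, Finset.sum_const_zero, zero_add]
      have h2 : ∀ a : {a // ¬a = j}, A j (σ (Sum.inr a)) = c * Bᵀ ⟨l, hjl.symm⟩ a := fun a => hc a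
      simp only [h2, mul_assoc]
      rw [← Finset.mul_sum, ← Matrix.mul_apply, Matrix.mul_nonsing_inv _ hB', Matrix.one_apply]
      by_cases hbl : b = l
      · subst hbl
        simp
      · have : (⟨l, hjl.symm⟩ : {a // ¬a = j}) ≠ ⟨b, hb⟩ := fun h => hbl (congrArg Subtype.val h).symm
        simp [hbl, this]

/-- The first two basis vectors span a hyperbolic plane, and Gaussian elimination splits it off.
Elimination is done without division, at the price of a congruence whose determinant is a power of
`s*`: not a unit, but free of zeros on the circle. -/
theorem isHyperbolic_of_row {A : Matrix (Fin 2 ⊕ κ) (Fin 2 ⊕ κ) ℂ[T;T⁻¹]} (hA : dagger A = -A)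
    (hdet : CircleUnit A.det) {s : ℂ[T;T⁻¹]}
    (hs : ∀ b, A (Sum.inl 0) b = if b = Sum.inl 1 then s else 0)
    (ih : ∀ M : Matrix κ κ ℂ[T;T⁻¹], dagger M = -M → CircleUnit M.det → IsHyperbolic M) :
    IsHyperbolic A := by
  have skew : ∀ a b, A b a = -invert (A a b) := fun a b => by
    have := congrFun (congrFun hA b) a
    rw [dagger_apply, Matrix.neg_apply] at this
    rw [this, neg_neg]
  -- A zero of `s` on the circle would annihilate a whole row of `A` there, and with it the
  -- determinant.
  have hsu : CircleUnit s := fun z hz h0 => hdet z hz <| by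
    rw [RingHom.map_det]
    refine Matrix.det_eq_zero_of_row_eq_zero (Sum.inl 0) fun b => ?_
    rw [RingHom.mapMatrix_apply, Matrix.map_apply, hs]
    split_ifs
    · exact h0
    · exact map_zero _
  set d := A (Sum.inl 1) (Sum.inl 1) with hd
  have hdd : invert d = -d := by
    have := skew (Sum.inl 1) (Sum.inl 1)
    rw [← hd] at this
    linear_combination this
  let u : κ → ℂ[T;T⁻¹] := fun b => A (Sum.inl 1) (Sum.inr b)
  let M : Matrix κ κ ℂ[T;T⁻¹] := A.toBlocks₂₂
  -- The first basis vector pairs only with the second. Every other vector is scaled by `s*` and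
  -- corrected by a multiple of the first one, `d / 2` for the second vector and `u b` for the rest.
  -- This cancels its pairing with the second vector.
  let E : Matrix (Fin 2 ⊕ κ) (Fin 2 ⊕ κ) ℂ[T;T⁻¹] :=
    Matrix.fromBlocks !![1, C 2⁻¹ * d; 0, invert s] (Matrix.of ![u, 0]) 0 (invert s • 1)
  have hE : CircleUnit E.det := by
    rw [Matrix.det_fromBlocks_zero₂₁, Matrix.det_fin_two_of, Matrix.det_smul, Matrix.det_one]
    simpa using circleUnit_mul.2 ⟨hsu.invert, hsu.invert.pow _⟩
  have hhalf : (C 2⁻¹ + C 2⁻¹ : ℂ[T;T⁻¹]) = 1 := by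
    rw [← map_add]
    norm_num
  have e00 : E (.inl 0) (.inl 0) = 1 := rfl
  have e01 : E (.inl 0) (.inl 1) = C 2⁻¹ * d := rfl
  have e10 : E (.inl 1) (.inl 0) = 0 := rfl
  have e11 : E (.inl 1) (.inl 1) = invert s := rfl
  have e0 : ∀ b, E (.inl 0) (.inr b) = u b := fun _ => rfl
  have e1 : ∀ b, E (.inl 1) (.inr b) = 0 := fun _ => rfl
  have ei : ∀ a (b : Fin 2), E (.inr a) (.inl b) = 0 := fun _ _ => rfl
  have ee : ∀ a b, E (.inr a) (.inr b) = if a = b then invert s else 0 := fun a b => by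
    change (invert s • (1 : Matrix κ κ ℂ[T;T⁻¹])) a b = _
    simp [Matrix.one_apply]
  have r0 : ∀ j, (A * E) (.inl 0) j = s * E (.inl 1) j := fun j => by
    simp [Matrix.mul_apply, hs]
  have r1 : ∀ j, (A * E) (.inl 1) j =
      -invert s * E (.inl 0) j + d * E (.inl 1) j + ∑ b, u b * E (.inr b) j := fun j => by
    simp only [Matrix.mul_apply, Fintype.sum_sum_type, Fin.sum_univ_two, skew (.inl 0) (.inl 1), hs,
      if_true]
    rfl
  have ri : ∀ i j, (A * E) (.inr i) j =
      -invert (u i) * E (.inl 1) j + ∑ b, M i b * E (.inr b) j := fun i j => by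
    simp only [Matrix.mul_apply, Fintype.sum_sum_type, Fin.sum_univ_two,
      skew (.inl 0) (.inr i), hs, skew (.inl 1) (.inr i)]
    simp [u, M, Matrix.toBlocks₂₂]
  have l : ∀ i j, (dagger E * A * E) i j = invert (E (.inl 0) i) * (A * E) (.inl 0) j +
      invert (E (.inl 1) i) * (A * E) (.inl 1) j +
        ∑ b, invert (E (.inr b) i) * (A * E) (.inr b) j := fun i j => by
    rw [Matrix.mul_assoc, Matrix.mul_apply, Fintype.sum_sum_type, Fin.sum_univ_two]
    rfl
  have hEA : dagger E * A * E = Matrix.fromBlocks !![0, s * invert s; -invert (s * invert s), 0]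
      0 0 ((s * invert s) • M) := by
    refine Matrix.ext fun i j => ?_
    rw [l]
    rcases i with i | i <;> rcases j with j | j
    · fin_cases i <;> fin_cases j <;>
        simp only [Fin.zero_eta, Fin.mk_one, Fin.isValue, r0, r1, ri, e00, e01, e10, e11, ei, map_zero,
          map_one, map_mul, mul_zero, zero_mul, Finset.sum_const_zero, invert_invert, hdd,
          Matrix.fromBlocks_apply₁₁, invert_C] <;>
        simp [-mul_eq_zero]
      · ring
      · linear_combination (-s * invert s * d) * hhalf
    · fin_cases i <;>
        simp [-mul_eq_zero, r0, r1, ri, e10, ei, e0, e1, ee]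
      ring
    · fin_cases j <;>
        simp [-mul_eq_zero, r0, r1, ri, e10, e11, ei, e0, e1, ee, apply_ite, invert_invert]
      ring
    · simp [-mul_eq_zero, r0, r1, ri, e0, e1, ee, apply_ite, invert_invert]
      ring
  have hdet' := circleUnit_det_congruence hdet hE
  have hdag := dagger_congruence hA E
  rw [hEA] at hdet' hdag
  refine .of_congruence hE ?_
  rw [hEA]
  refine .fromBlocks (ih _ ?_ ?_) (circleUnit_mul.2 ⟨hsu, hsu.invert⟩)
  · refine Matrix.ext fun i j => ?_
    exact congrFun (congrFun hdag (Sum.inr i)) (Sum.inr j)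
  · rw [Matrix.det_fromBlocks_zero₂₁] at hdet'
    exact (circleUnit_mul.1 hdet').2

/-- Induction on the size in steps of two: an isotropic vector is made a basis vector, its row is
concentrated in one entry, and the resulting plane is split off. -/
theorem isHyperbolic (A : Matrix ι ι ℂ[T;T⁻¹]) (hA : dagger A = -A) (hdet : CircleUnit A.det) :
    IsHyperbolic A := by
  induction hn : Fintype.card ι using Nat.strong_induction_on generalizing ι with
  | _ n ih =>
    match n with
    | 0 =>
      have := Fintype.card_eq_zero_iff.1 hn
      exact ⟨Empty, inferInstance, inferInstance, Equiv.equivOfIsEmpty _ _, 1, 1,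
        by simpa using CircleUnit.one, by simpa using CircleUnit.one, Matrix.ext fun i => isEmptyElim i⟩
    | 1 =>
      obtain ⟨i, hi⟩ := Fintype.card_eq_one_iff.1 hn
      have : Unique ι := ⟨⟨i⟩, hi⟩
      -- Size one cannot occur: at the fixed point `z = 1` of the involution the single entry equals
      -- its own negative, so it vanishes on the circle.
      refine absurd ?_ (hdet 1 (by simp))
      have h := congrFun (congrFun hA default) default
      rw [dagger_apply, Matrix.neg_apply] at h
      have h1 := congrArg (evalUnit 1) h
      rw [evalUnit_invert, inv_one, map_neg] at h1
      rw [Matrix.det_unique]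
      linear_combination h1 / 2
    | n + 2 =>
      obtain ⟨f⟩ : Nonempty (Fin 2 ⊕ Fin n ≃ ι) :=
        ⟨Fintype.equivOfCardEq (by simp [hn, add_comm])⟩
      refine .of_submatrix f ?_
      have hA' : dagger (A.submatrix f f) = -A.submatrix f f := by
        refine Matrix.ext fun i j => ?_
        exact congrFun (congrFun hA (f i)) (f j)
      have hdet' : CircleUnit (A.submatrix f f).det := by
        rwa [Matrix.det_submatrix_equiv_self]
      have h01 : (Sum.inl 0 : Fin 2 ⊕ Fin n) ≠ Sum.inl 1 := by simp
      obtain ⟨B, hB, h0⟩ := exists_congruence_diag_eq_zero hA' h01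
      have hB := CircleUnit.of_isUnit hB
      refine .of_congruence hB ?_
      obtain ⟨V, s, hV, hs⟩ := exists_congruence_row h01 h0
      have hV := CircleUnit.of_isUnit hV
      refine .of_congruence hV (isHyperbolic_of_row ?_ ?_ hs fun M hM hM' =>
        ih n (by omega) M hM hM' (by simp))
      · exact dagger_congruence (dagger_congruence hA' B) V
      · exact circleUnit_det_congruence (circleUnit_det_congruence hdet' hB) hV

end Hyperbolic

/-! ## Pfaffians -/

section Pfaffian

variable {μ : Type*} [Fintype μ] [DecidableEq μ]

/-- The Pfaffian of a matrix indexed by pairs, up to normalization. -/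
def pfSum (A : Matrix (μ × Fin 2) (μ × Fin 2) ℂ) : ℂ :=
  ∑ s : Equiv.Perm (μ × Fin 2), ((Equiv.Perm.sign s : ℤ) : ℂ) * ∏ i, A (s (i, 0)) (s (i, 1))

/-- Expanding the product gives a sum over all choices `f` of row indices, in which the sum over
permutations collects into the determinant of `K` with rows chosen by `f`. A repeated row gives
zero; the remaining `f` are permutations and contribute a sign times `det K`. -/
theorem pfSum_congruence (A K : Matrix (μ × Fin 2) (μ × Fin 2) ℂ) :
    pfSum (Kᵀ * A * K) = K.det * pfSum A := by
  have h1 : ∀ s : Equiv.Perm (μ × Fin 2), ∏ i, (Kᵀ * A * K) (s (i, 0)) (s (i, 1)) =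
      ∑ f : μ → Fin 2 → μ × Fin 2, (∏ i, A (f i 0) (f i 1)) * ∏ x : μ × Fin 2, K (f x.1 x.2) (s x) := by
    intro s
    have h2 : ∀ i, (Kᵀ * A * K) (s (i, 0)) (s (i, 1)) =
        ∑ p : Fin 2 → μ × Fin 2, A (p 0) (p 1) * ∏ ε, K (p ε) (s (i, ε)) := by
      intro i
      rw [← (finTwoArrowEquiv (μ × Fin 2)).symm.sum_comp, Fintype.sum_prod_type_right]
      simp only [Matrix.mul_apply, Finset.sum_mul, Matrix.transpose_apply, Fin.prod_univ_two]
      refine Finset.sum_congr rfl fun b _ => Finset.sum_congr rfl fun a _ => ?_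
      simp only [finTwoArrowEquiv_symm_apply, Matrix.cons_val_zero, Matrix.cons_val_one]
      ring
    simp only [h2]
    rw [Finset.prod_univ_sum, Fintype.piFinset_univ]
    refine Finset.sum_congr rfl fun f _ => ?_
    rw [Finset.prod_mul_distrib, Fintype.prod_prod_type]
  have h3 : ∀ f : μ → Fin 2 → μ × Fin 2, ∑ s : Equiv.Perm (μ × Fin 2),
      ((Equiv.Perm.sign s : ℤ) : ℂ) * ∏ x : μ × Fin 2, K (f x.1 x.2) (s x) =
      (K.submatrix (fun x : μ × Fin 2 => f x.1 x.2) id).det := by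
    intro f
    rw [← Matrix.det_transpose, Matrix.det_apply']
    rfl
  simp only [pfSum, h1, Finset.mul_sum]
  rw [Finset.sum_comm]
  have h4 : ∀ f : μ → Fin 2 → μ × Fin 2, ∑ s : Equiv.Perm (μ × Fin 2),
      ((Equiv.Perm.sign s : ℤ) : ℂ) * ((∏ i, A (f i 0) (f i 1)) *
        ∏ x : μ × Fin 2, K (f x.1 x.2) (s x)) =
      (∏ i, A (f i 0) (f i 1)) * (K.submatrix (fun x : μ × Fin 2 => f x.1 x.2) id).det := by
    intro f
    rw [← h3, Finset.mul_sum]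
    exact Finset.sum_congr rfl fun s _ => by ring
  simp only [h4]
  symm
  refine Fintype.sum_of_injective (fun (s : Equiv.Perm (μ × Fin 2)) i ε => s (i, ε)) ?_ _ _ ?_ ?_
  · intro s t h
    exact Equiv.ext fun x => congrFun (congrFun h x.1) x.2
  · intro f hf
    have hinj : ¬Function.Injective fun x : μ × Fin 2 => f x.1 x.2 := fun hinj =>
      hf ⟨Equiv.ofBijective _ (Finite.injective_iff_bijective.1 hinj), rfl⟩
    simp only [Function.Injective, not_forall] at hinj
    obtain ⟨x, y, hxy, hne⟩ := hinj
    rw [Matrix.det_zero_of_row_eq hne, mul_zero]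
    ext j
    exact congrArg (fun z => K z j) hxy
  · intro s
    have : (K.submatrix s id).det = ((Equiv.Perm.sign s : ℤ) : ℂ) * K.det := Matrix.det_permute s K
    change _ = _ * (K.submatrix s id).det
    rw [this]
    ring

theorem pfSum_submatrix (A : Matrix (μ × Fin 2) (μ × Fin 2) ℂ) (t : Equiv.Perm (μ × Fin 2)) :
    pfSum (A.submatrix t t) = ((Equiv.Perm.sign t : ℤ) : ℂ) * pfSum A := by
  symm
  rw [pfSum, pfSum, Finset.mul_sum]
  refine (Equiv.sum_comp (Equiv.mulLeft t) _).symm.trans ?_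
  refine Finset.sum_congr rfl fun s _ => ?_
  rw [← mul_assoc, Equiv.coe_mulLeft, Equiv.Perm.sign_mul]
  have : ((Equiv.Perm.sign t : ℤ) : ℂ) * ((Equiv.Perm.sign t : ℤ) : ℂ) = 1 := by
    rw [← Int.cast_mul, ← Units.val_mul, Int.units_mul_self]
    simp
  push_cast
  rw [← mul_assoc, this, one_mul]
  rfl

/-- No cancellation occurs. A permutation with nonzero term permutes the pairs by some `π` and acts
within pairs by `σ i`. Its sign is the product of the signs of the `σ i`, because `π` acts on two
copies, and this is also the product of the entries. All nonzero terms are therefore `1`, and the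
identity gives one. -/
theorem pfSum_kronecker_ne_zero :
    pfSum ((1 : Matrix μ μ ℂ) ⊗ₖ (!![0, 1; -1, 0] : Matrix (Fin 2) (Fin 2) ℂ)) ≠ 0 := by
  set ω : Matrix (Fin 2) (Fin 2) ℂ := !![0, 1; -1, 0] with hω
  have hsign : ∀ σ : Equiv.Perm (Fin 2), ω (σ 0) (σ 1) = ((Equiv.Perm.sign σ : ℤ) : ℂ) := by
    intro σ
    obtain rfl | rfl := (by decide : ∀ σ : Equiv.Perm (Fin 2), σ = 1 ∨ σ = Equiv.swap 0 1) σ <;>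
      simp [hω]
  set J := (1 : Matrix μ μ ℂ) ⊗ₖ ω with hJ
  have hterm : ∀ s : Equiv.Perm (μ × Fin 2),
      ((Equiv.Perm.sign s : ℤ) : ℂ) * ∏ i, J (s (i, 0)) (s (i, 1)) ≠ 0 →
      ((Equiv.Perm.sign s : ℤ) : ℂ) * ∏ i, J (s (i, 0)) (s (i, 1)) = 1 := by
    intro s hs
    have hs := right_ne_zero_of_mul hs
    have hi : ∀ i, (s (i, 0)).1 = (s (i, 1)).1 := fun i => by
      have := Finset.prod_ne_zero_iff.1 hs i (Finset.mem_univ _)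
      by_contra hne
      refine this ?_
      rw [hJ, Matrix.kroneckerMap_apply, Matrix.one_apply_ne hne, zero_mul]
    let p : μ → μ := fun i => (s (i, 0)).1
    have hp : ∀ i ε, (s (i, ε)).1 = p i := fun i ε => by
      fin_cases ε
      · rfl
      · exact (hi i).symm
    have hpi : Function.Injective p := by
      refine Finite.injective_iff_surjective.2 fun j => ?_
      obtain ⟨⟨i, ε⟩, h⟩ := s.surjective (j, 0)
      exact ⟨i, by rw [← hp i ε, h]⟩
    let π : Equiv.Perm μ := Equiv.ofBijective p (Finite.injective_iff_bijective.1 hpi)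
    have hσi : ∀ i, Function.Injective fun ε => (s (i, ε)).2 := fun i ε ε' h => by
      have : s (i, ε) = s (i, ε') := Prod.ext ((hp i ε).trans (hp i ε').symm) h
      exact congrArg Prod.snd (s.injective this)
    let σ : μ → Equiv.Perm (Fin 2) := fun i =>
      Equiv.ofBijective _ (Finite.injective_iff_bijective.1 (hσi i))
    have hsπ : s = (Equiv.prodCongrLeft fun _ => π : Equiv.Perm (μ × Fin 2)) * Equiv.prodCongrRight σ := by
      refine Equiv.ext fun x => Prod.ext ?_ ?_
      · exact hp x.1 x.2
      · rfl
    have hprod : ∏ i, J (s (i, 0)) (s (i, 1)) = ∏ i, ((Equiv.Perm.sign (σ i) : ℤ) : ℂ) := by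
      refine Finset.prod_congr rfl fun i _ => ?_
      rw [hJ, Matrix.kroneckerMap_apply, ← hsign, hi, Matrix.one_apply_eq, one_mul]
      rfl
    rw [hprod]
    conv_lhs => rw [hsπ]
    rw [Equiv.Perm.sign_mul, Equiv.Perm.sign_prodCongrLeft, Equiv.Perm.sign_prodCongrRight]
    simp only [Fin.prod_univ_two, Int.units_mul_self, one_mul]
    rw [← Int.cast_prod, ← Units.coe_prod, ← Int.cast_mul, ← Units.val_mul, Int.units_mul_self]
    simp
  have hone : ((Equiv.Perm.sign (1 : Equiv.Perm (μ × Fin 2)) : ℤ) : ℂ) *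
      ∏ i, J ((1 : Equiv.Perm (μ × Fin 2)) (i, 0)) ((1 : Equiv.Perm (μ × Fin 2)) (i, 1)) = 1 := by
    simp [hJ, hω]
  have : pfSum J = ∑ s : Equiv.Perm (μ × Fin 2),
      if ((Equiv.Perm.sign s : ℤ) : ℂ) * ∏ i, J (s (i, 0)) (s (i, 1)) = 1 then (1 : ℂ) else 0 := by
    refine Finset.sum_congr rfl fun s _ => ?_
    split_ifs with h
    · exact h
    · by_contra h0
      exact h (hterm s h0)
  rw [this, Finset.sum_boole, Nat.cast_ne_zero]
  exact Finset.card_ne_zero_of_mem (Finset.mem_filter.2 ⟨Finset.mem_univ 1, hone⟩)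

variable {P : ℕ}

/-- Positions `2i` and `2i + 1` are renamed `(i, 0)` and `(i, 1)`, so that the normalization and the
dictionary order survive only as a nonzero constant and a fixed reindexing. -/
theorem exists_pf_eq (P : ℕ) : ∃ (c : ℂ) (e : Fin P × Fin 2 ≃ Fin 2 × Fin P), c ≠ 0 ∧
    ∀ M, pf M = c * pfSum (M.submatrix e e) := by
  let f : Fin P × Fin 2 ≃ Fin (2 * P) := finProdFinEquiv.trans (finCongr (mul_comm P 2))
  refine ⟨((2 : ℂ) ^ P * (P.factorial : ℂ))⁻¹, f.trans finProdFinEquiv.symm, ?_, fun M => ?_⟩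
  · exact inv_ne_zero (mul_ne_zero (by simp) (by exact_mod_cast P.factorial_ne_zero))
  · rw [pf, pfaffian, pfSum, ← f.symm.permCongr.symm.sum_comp]
    congr 1
    refine Finset.sum_congr rfl fun s _ => ?_
    have h0 : ∀ i : Fin P, f (i, 0) = ⟨2 * i, by omega⟩ := fun i => by ext; simp [f]
    have h1 : ∀ i : Fin P, f (i, 1) = ⟨2 * i + 1, by omega⟩ := fun i => by
      ext
      simp [f, add_comm]
    congr 1
    · simp
    · refine Finset.prod_congr rfl fun i _ => ?_
      rw [← h0, ← h1]
      simp [Equiv.permCongr_symm]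

theorem pf_congruence (A K : Matrix (Fin 2 × Fin P) (Fin 2 × Fin P) ℂ) :
    pf (Kᵀ * A * K) = K.det * pf A := by
  obtain ⟨c, e, -, h⟩ := exists_pf_eq P
  rw [h, h, ← Matrix.submatrix_mul_equiv _ _ _ e, ← Matrix.submatrix_mul_equiv _ _ _ e,
    ← Matrix.transpose_submatrix, pfSum_congruence, Matrix.det_submatrix_equiv_self]
  ring

/-- Two pairings of the same index set differ by a permutation, which alters the sum only by a sign.
-/
theorem pf_stdSkew_ne_zero {μ : Type} [Fintype μ] [DecidableEq μ] (e : μ × Fin 2 ≃ Fin 2 × Fin P) :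
    pf (stdSkew e) ≠ 0 := by
  obtain ⟨c, f, hc, h⟩ := exists_pf_eq P
  have hcard : Fintype.card (Fin P) = Fintype.card μ := by
    have := Fintype.card_congr e
    simp only [Fintype.card_prod, Fintype.card_fin] at this ⊢
    omega
  let q : Fin P ≃ μ := Fintype.equivOfCardEq hcard
  let t : Equiv.Perm (Fin P × Fin 2) :=
    (f.trans e.symm).trans (Equiv.prodCongr q.symm (Equiv.refl _))
  have : (stdSkew e).submatrix f f =
      ((1 : Matrix (Fin P) (Fin P) ℂ) ⊗ₖ !![0, 1; -1, 0]).submatrix t t := by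
    ext x y
    simp [stdSkew, t, Matrix.one_apply]
  rw [h, this, pfSum_submatrix]
  refine mul_ne_zero hc (mul_ne_zero ?_ pfSum_kronecker_ne_zero)
  exact_mod_cast (Equiv.Perm.sign t).ne_zero

end Pfaffian

/-! ## Toeplitz operators with polynomial symbols -/

section Symbol

open Polynomial

variable {ι : Type*} [Fintype ι] [DecidableEq ι]

/-- The polynomial matrix `∑_{k < n} c_k X^k`. -/
def polySum (n : ℕ) (c : ℕ → Matrix ι ι ℂ) : Matrix ι ι ℂ[X] :=
  ∑ k ∈ Finset.range n, (X ^ k : ℂ[X]) • (c k).map C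

theorem polyOp_X_pow_smul {S : HalfLine ι →L[ℂ] HalfLine ι} (hS : IsTranslation S) (k : ℕ)
    (p : Matrix ι ι ℂ[X]) : polyOp hS ((X ^ k : ℂ[X]) • p) = S ^ k * polyOp hS p := by
  have : (Matrix.diagonal fun _ : ι => (X ^ k : ℂ[X])) = (Matrix.diagonal fun _ => X) ^ k :=
    (Matrix.diagonal_pow _ k).symm
  rw [Matrix.smul_eq_diagonal_mul, map_mul, this, map_pow, polyOp_X]

theorem polyOp_polySum {S : HalfLine ι →L[ℂ] HalfLine ι} (hS : IsTranslation S) (n : ℕ)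
    (c : ℕ → Matrix ι ι ℂ) :
    polyOp hS (polySum n c) = ∑ k ∈ Finset.range n, S ^ k * site (c k) := by
  simp only [polySum, map_sum, polyOp_X_pow_smul, polyOp_map_C]

theorem polySum_apply (n : ℕ) (c : ℕ → Matrix ι ι ℂ) (a b : ι) :
    polySum n c a b = ∑ k ∈ Finset.range n, X ^ k * C (c k a b) := by
  simp [polySum, Matrix.sum_apply]

theorem exists_eq_polySum (p : Matrix ι ι ℂ[X]) : ∃ n, ∀ m, n ≤ m →
    p = polySum m fun k => p.map fun q => q.coeff k := by
  refine ⟨∑ a, ∑ b, ((p a b).natDegree + 1), fun m hm => ?_⟩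
  refine Matrix.ext fun a b => ?_
  rw [polySum_apply]
  have h : (p a b).natDegree < m := by
    have h1 := Finset.single_le_sum (f := fun b => (p a b).natDegree + 1) (fun _ _ => Nat.zero_le _)
      (Finset.mem_univ b)
    have h2 := Finset.single_le_sum (f := fun a => ∑ b, ((p a b).natDegree + 1))
      (fun _ _ => Nat.zero_le _) (Finset.mem_univ a)
    beta_reduce at h1 h2
    omega
  conv_lhs => rw [(p a b).as_sum_range' m h]
  refine Finset.sum_congr rfl fun k _ => ?_
  rw [← C_mul_X_pow_eq_monomial, mul_comm]
  rfl

theorem eval_polySum (n : ℕ) (c : ℕ → Matrix ι ι ℂ) (z : ℂ) :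
    (polySum n c).map (eval z) = ∑ k ∈ Finset.range n, z ^ k • c k := by
  refine Matrix.ext fun a b => ?_
  rw [Matrix.map_apply, polySum_apply, eval_finsetSum]
  simp only [eval_mul, eval_pow, eval_X, eval_C, Matrix.sum_apply, Matrix.smul_apply, smul_eq_mul]

theorem eval_det (p : Matrix ι ι ℂ[X]) (z : ℂ) : p.det.eval z = (p.map (eval z)).det :=
  RingHom.map_det (evalRingHom z) p

theorem shift_pow_mul_shiftAdj_pow (n : ℕ) :
    (shift ^ n * shiftAdj ^ n : HalfLine ι →L[ℂ] HalfLine ι) = 1 := by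
  induction n with
  | zero => simp
  | succ n ih => rw [pow_succ, pow_succ', mul_assoc, ← mul_assoc shift, shift_mul_shiftAdj, one_mul, ih]

theorem shiftPow_sub (k n : ℕ) :
    (shiftPow ((k : ℤ) - n) : HalfLine ι →L[ℂ] HalfLine ι) = shift ^ k * shiftAdj ^ n := by
  rw [shiftPow]
  split_ifs with h
  · obtain ⟨m, rfl⟩ := Nat.exists_eq_add_of_le (show n ≤ k by omega)
    rw [add_comm, pow_add, mul_assoc, shift_pow_mul_shiftAdj_pow, mul_one]
    congr 1
    omega
  · obtain ⟨m, rfl⟩ := Nat.exists_eq_add_of_le (show k ≤ n by omega)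
    rw [pow_add, ← mul_assoc, shift_pow_mul_shiftAdj_pow, one_mul]
    congr 1
    omega

theorem exists_bound (h : ℤ →₀ Matrix ι ι ℂ) : ∃ N : ℕ, ∀ r, h r ≠ 0 → r.natAbs ≤ N :=
  ⟨h.support.sup Int.natAbs, fun _ hr => Finset.le_sup (Finsupp.mem_support_iff.2 hr)⟩

theorem sum_eq_sum_range {M : Type*} [AddCommMonoid M] {h : ℤ →₀ Matrix ι ι ℂ} {N : ℕ}
    (hN : ∀ r, h r ≠ 0 → r.natAbs ≤ N) (f : ℤ → Matrix ι ι ℂ → M) (hf : ∀ r, f r 0 = 0) :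
    h.sum f = ∑ k ∈ Finset.range (2 * N + 1), f ((k : ℤ) - N) (h ((k : ℤ) - N)) := by
  have hinj : Set.InjOn (fun k : ℕ => (k : ℤ) - N) (Finset.range (2 * N + 1)) := fun a _ b _ hab => by
    simp only at hab
    omega
  rw [Finsupp.sum_of_support_subset h (s := (Finset.range (2 * N + 1)).image fun k : ℕ => (k : ℤ) - N)
    _ f fun r _ => hf r, Finset.sum_image hinj]
  intro r hr
  have := hN r (Finsupp.mem_support_iff.1 hr)
  exact Finset.mem_image.2 ⟨(r + N).toNat, Finset.mem_range.2 (by omega), by omega⟩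

/-- The polynomial matrix `z^N ∑_r h_r z^r`. -/
def symbol (h : ℤ →₀ Matrix ι ι ℂ) (N : ℕ) : Matrix ι ι ℂ[X] :=
  polySum (2 * N + 1) fun k => h ((k : ℤ) - N)

variable {h : ℤ →₀ Matrix ι ι ℂ} {N : ℕ}

/-- Since `shift * shiftAdj = 1`, every hop can be written in normal order as `shift ^ (r + N) *
shiftAdj ^ N` with one fixed `N`. Right shifts commute with on-site matrices and are collected on
the right. -/
theorem toeplitz_eq (hN : ∀ r, h r ≠ 0 → r.natAbs ≤ N) :
    toeplitz h = polyOp isTranslation_shift (symbol h N) * shiftAdj ^ N := by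
  rw [toeplitz, sum_eq_sum_range hN _ fun _ => by rw [onSite_eq_site, site_zero]; simp, symbol,
    polyOp_polySum, Finset.sum_mul]
  refine Finset.sum_congr rfl fun k _ => ?_
  rw [shiftPow_sub, onSite_eq_site, mul_assoc, ((commute_site isTranslation_shiftAdj _).pow_right N).eq,
    ← mul_assoc]
  rfl

theorem bloch_eq (hN : ∀ r, h r ≠ 0 → r.natAbs ≤ N) (k : ℝ) :
    bloch h k = Complex.exp ((-k : ℝ) * Complex.I) ^ N •
      (symbol h N).map (eval (Complex.exp (k * Complex.I))) := by
  rw [bloch, sum_eq_sum_range hN _ fun r => smul_zero _, symbol, eval_polySum, Finset.smul_sum]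
  refine Finset.sum_congr rfl fun n _ => ?_
  rw [smul_smul, ← Complex.exp_nat_mul, ← Complex.exp_nat_mul, ← Complex.exp_add]
  congr 2
  push_cast
  ring

theorem det_bloch_eq (hN : ∀ r, h r ≠ 0 → r.natAbs ≤ N) (k : ℝ) :
    (bloch h k).det = onCircle (X ^ (N * Fintype.card ι)) (-k) * onCircle (symbol h N).det k := by
  rw [bloch_eq hN, Matrix.det_smul, onCircle, onCircle, eval_det, eval_pow, eval_X, pow_mul]

theorem exists_exp_eq {z : ℂ} (hz : ‖z‖ = 1) : ∃ k : ℝ, z = Complex.exp (k * Complex.I) :=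
  ⟨z.arg, by
    have := Complex.norm_mul_exp_arg_mul_I z
    rw [hz] at this
    simpa using this.symm⟩

theorem eval_det_symbol_ne_zero (hN : ∀ r, h r ≠ 0 → r.natAbs ≤ N)
    (hdet : ∀ k, (bloch h k).det ≠ 0) {z : ℂ} (hz : ‖z‖ = 1) : (symbol h N).det.eval z ≠ 0 := by
  obtain ⟨k, rfl⟩ := exists_exp_eq hz
  have := hdet k
  rw [det_bloch_eq hN] at this
  exact right_ne_zero_of_mul this

theorem eval_X_pow_ne_zero (n : ℕ) {z : ℂ} (hz : ‖z‖ = 1) : (X ^ n : ℂ[X]).eval z ≠ 0 := by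
  rw [eval_pow, eval_X]
  refine pow_ne_zero _ fun h => ?_
  simp [h] at hz

theorem discRoots_X_pow (n : ℕ) : discRoots (X ^ n : ℂ[X]) = n := by
  rw [discRoots, roots_X_pow, Multiset.filter_nsmul, Multiset.filter_singleton]
  simp

theorem isNonvanishing_det_bloch (hdet : ∀ k, (bloch h k).det ≠ 0) :
    IsNonvanishing fun k => (bloch h k).det := by
  obtain ⟨N, hN⟩ := exists_bound h
  simp only [det_bloch_eq hN]
  exact (isNonvanishing_onCircle fun z => eval_X_pow_ne_zero _).comp_neg.mul
    (isNonvanishing_onCircle fun z => eval_det_symbol_ne_zero hN hdet)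

/-- The Bloch determinant is that of the polynomial symbol times `z^(-N card ι)`; the latter
subtracts its degree from the count of zeros in the disc. -/
theorem winding_bloch (hN : ∀ r, h r ≠ 0 → r.natAbs ≤ N) (hdet : ∀ k, (bloch h k).det ≠ 0) :
    winding (bloch h) = discRoots (symbol h N).det - N * Fintype.card ι := by
  have h1 := isNonvanishing_onCircle (q := X ^ (N * Fintype.card ι)) fun z => eval_X_pow_ne_zero _
  have h2 := isNonvanishing_onCircle fun z => eval_det_symbol_ne_zero hN hdet (z := z)
  rw [winding]
  simp only [det_bloch_eq hN]
  rw [h1.comp_neg.integral_logDeriv_mul h2, integral_logDeriv_onCircle fun z => eval_det_symbol_ne_zero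
    hN hdet (z := z)]
  have h3 : ∫ k in (-Real.pi)..Real.pi, logDeriv (fun k => onCircle (X ^ (N * Fintype.card ι)) (-k)) k =
      -(2 * Real.pi * Complex.I * (N * Fintype.card ι)) := by
    simp only [logDeriv_comp_neg]
    rw [intervalIntegral.integral_neg,
      intervalIntegral.integral_comp_neg (fun k => logDeriv (onCircle (X ^ (N * Fintype.card ι))) k),
      neg_neg, integral_logDeriv_onCircle fun z => eval_X_pow_ne_zero _, discRoots_X_pow]
    push_cast
    rfl
  rw [h3]
  have := Complex.two_pi_I_ne_zero
  field_simp
  ring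

theorem isFredholm_shiftAdj_pow (N : ℕ) :
    (shiftAdj ^ N : HalfLine ι →L[ℂ] HalfLine ι).IsFredholm ∧
      index (shiftAdj ^ N : HalfLine ι →L[ℂ] HalfLine ι).toLinearMap = -(N * Fintype.card ι) := by
  have hX : (Matrix.diagonal fun _ : ι => (X : ℂ[X]) ^ N).det = X ^ (N * Fintype.card ι) := by
    rw [Matrix.det_diagonal, Finset.prod_const, Finset.card_univ, pow_mul]
  have h := isFredholm_polyOp isTranslation_shiftAdj hasIndexStep_shiftAdj
    (p := Matrix.diagonal fun _ : ι => (X : ℂ[X]) ^ N)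
    (fun z hz => by rw [hX]; exact eval_X_pow_ne_zero _ hz)
  have e : polyOp isTranslation_shiftAdj (Matrix.diagonal fun _ : ι => (X : ℂ[X]) ^ N) =
      shiftAdj ^ N := by
    have := polyOp_X_pow_smul (isTranslation_shiftAdj (ι := ι)) N 1
    rwa [Matrix.smul_one_eq_diagonal, map_one, mul_one] at this
  rw [e, hX, discRoots_X_pow] at h
  exact ⟨h.1, by rw [h.2]; push_cast; ring⟩

/-- The index theorem for block Toeplitz operators. -/
theorem index_toeplitz (hdet : ∀ k, (bloch h k).det ≠ 0) :
    (toeplitz h).IsFredholm ∧ (index (toeplitz h).toLinearMap : ℂ) = winding (bloch h) := by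
  obtain ⟨N, hN⟩ := exists_bound h
  have h1 := isFredholm_polyOp isTranslation_shift hasIndexStep_shift
    fun z => eval_det_symbol_ne_zero hN hdet (z := z)
  have h2 := isFredholm_shiftAdj_pow (ι := ι) N
  rw [toeplitz_eq hN]
  refine ⟨isFredholm_comp h1.1 h2.1, ?_⟩
  rw [index_mul h1.1 h2.1, h1.2, h2.2, winding_bloch hN hdet]
  push_cast
  ring

end Symbol

/-! ## Transposition of operators -/

section Transposition

open Polynomial
open scoped InnerProductSpace

variable {ι : Type*} [Fintype ι] [DecidableEq ι]

/-- `U` is the transpose of `V` with respect to complex conjugation. -/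
def IsTransposed (U V : HalfLine ι →L[ℂ] HalfLine ι) : Prop :=
  ∀ x y, ⟪conjVec x, U y⟫_ℂ = ⟪conjVec (V x), y⟫_ℂ

theorem isTransposed_site (a : Matrix ι ι ℂ) : IsTransposed (site aᵀ) (site a) := by
  intro x y
  rw [← ContinuousLinearMap.adjoint_inner_left, adjoint_site]
  congr 1
  refine halfLine_ext fun j b => ?_
  simp [site_apply]

theorem isTransposed_shift : IsTransposed (shift (ι := ι)) shiftAdj := by
  intro x y
  rw [← ContinuousLinearMap.adjoint_inner_left]
  congr 1
  refine halfLine_ext fun j b => ?_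
  cases j with
  | zero => rw [conjVec_apply, shiftAdj_apply_zero, shiftAdj_apply_zero, map_zero]
  | succ j => rw [conjVec_apply, shiftAdj_apply_succ, shiftAdj_apply_succ, conjVec_apply]

theorem IsTransposed.mul {U V U' V' : HalfLine ι →L[ℂ] HalfLine ι} (h : IsTransposed U V)
    (h' : IsTransposed U' V') : IsTransposed (U * U') (V' * V) := fun x y =>
  (h x (U' y)).trans (h' (V x) y)

theorem isTransposed_one : IsTransposed (1 : HalfLine ι →L[ℂ] HalfLine ι) 1 := fun _ _ => rfl

theorem IsTransposed.pow {U V : HalfLine ι →L[ℂ] HalfLine ι} (h : IsTransposed U V) (n : ℕ) :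
    IsTransposed (U ^ n) (V ^ n) := by
  induction n with
  | zero => simpa using isTransposed_one
  | succ n ih =>
    rw [pow_succ, pow_succ']
    exact ih.mul h

theorem IsTransposed.sum {α : Type*} {s : Finset α} {U V : α → HalfLine ι →L[ℂ] HalfLine ι}
    (h : ∀ i ∈ s, IsTransposed (U i) (V i)) :
    IsTransposed (∑ i ∈ s, U i) (∑ i ∈ s, V i) := by
  intro x y
  rw [_root_.sum_apply, _root_.sum_apply, inner_sum, map_sum, sum_inner]
  exact Finset.sum_congr rfl fun i hi => h i hi x y

theorem polySum_transpose (n : ℕ) (c : ℕ → Matrix ι ι ℂ) :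
    (polySum n c)ᵀ = polySum n fun k => (c k)ᵀ := by
  refine Matrix.ext fun a b => ?_
  rw [Matrix.transpose_apply, polySum_apply, polySum_apply]
  rfl

/-- Transposition exchanges the two shifts and transposes the coefficients, and coefficients commute
with shifts. -/
theorem isTransposed_polyOp (g : Matrix ι ι ℂ[X]) :
    IsTransposed (polyOp isTranslation_shift g) (polyOp isTranslation_shiftAdj gᵀ) := by
  obtain ⟨n, hn⟩ := exists_eq_polySum g
  rw [hn n le_rfl, polySum_transpose, polyOp_polySum, polyOp_polySum]
  refine .sum fun k _ => ?_
  rw [← ((commute_site isTranslation_shiftAdj _).pow_right k).eq]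
  exact (isTransposed_shift.pow k).mul (isTransposed_site _ᵀ)

end Transposition

/-! ### Clearing denominators in the congruence -/

section Laurent

open LaurentPolynomial
open Polynomial (toLaurent)

variable {ι : Type*} [Fintype ι] [DecidableEq ι]

theorem dagger_smul (f : ℂ[T;T⁻¹]) (M : Matrix ι ι ℂ[T;T⁻¹]) :
    dagger (f • M) = invert f • dagger M :=
  Matrix.ext fun a b => map_mul invert f (M b a)

theorem exists_toLaurent_eq (M : Matrix ι ι ℂ[T;T⁻¹]) :
    ∃ (n : ℕ) (g : Matrix ι ι (Polynomial ℂ)), g.map toLaurent = (T n : ℂ[T;T⁻¹]) • M := by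
  choose n f hf using fun a b => LaurentPolynomial.exists_T_pow (M a b)
  have hn : ∀ a b, n a b ≤ ∑ a, ∑ b, n a b := fun a b =>
    (Finset.single_le_sum (f := fun b => n a b) (fun _ _ => Nat.zero_le _) (Finset.mem_univ b)).trans
      (Finset.single_le_sum (f := fun a => ∑ b, n a b) (fun _ _ => Nat.zero_le _)
        (Finset.mem_univ a))
  refine ⟨∑ a, ∑ b, n a b, Matrix.of fun a b => f a b * Polynomial.X ^ (∑ a, ∑ b, n a b - n a b),
    Matrix.ext fun a b => ?_⟩
  rw [Matrix.map_apply, Matrix.of_apply, map_mul, hf, map_pow, Polynomial.toLaurent_X, T_pow,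
    mul_assoc, ← T_add, Matrix.smul_apply, smul_eq_mul, mul_comm]
  congr 2
  have := hn a b
  push_cast [this]
  ring

theorem toLaurent_polySum (n : ℕ) (c : ℕ → Matrix ι ι ℂ) (a b : ι) :
    toLaurent (polySum n c a b) = ∑ k ∈ Finset.range n, C (c k a b) * T k := by
  rw [polySum_apply, map_sum]
  refine Finset.sum_congr rfl fun k _ => ?_
  rw [map_mul, map_pow, Polynomial.toLaurent_X, T_pow, mul_one, Polynomial.toLaurent_C, mul_comm]

/-- A polynomial in the right shift corresponds to negative powers of `z`. Once `n` is large enough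
to dominate these powers, `z^n g†` is polynomial, obtained by reversing the coefficients, and the
missing `z^(-n)` is `shiftAdj ^ n` on the right. -/
theorem exists_reflect (g : Matrix ι ι (Polynomial ℂ)) : ∃ n₀ : ℕ, ∀ n : ℕ, n₀ ≤ n →
    ∃ g' : Matrix ι ι (Polynomial ℂ),
      polyOp isTranslation_shiftAdj gᵀ = polyOp isTranslation_shift g' * shiftAdj ^ n ∧
      g'.map toLaurent = (T n : ℂ[T;T⁻¹]) • dagger (g.map toLaurent) := by
  obtain ⟨n₀, hn₀⟩ := exists_eq_polySum g
  refine ⟨n₀, fun n hn => ?_⟩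
  have hg := hn₀ (n + 1) (by omega)
  set c : ℕ → Matrix ι ι ℂ := fun k => g.map fun q => q.coeff k
  refine ⟨polySum (n + 1) fun k => (c (n - k))ᵀ, ?_, Matrix.ext fun a b => ?_⟩
  · rw [hg, polySum_transpose, polyOp_polySum, polyOp_polySum, Finset.sum_mul,
      ← Finset.sum_range_reflect]
    refine Finset.sum_congr rfl fun k hk => ?_
    have hk : k ≤ n := by
      have := Finset.mem_range.1 hk
      omega
    rw [mul_assoc, ((commute_site isTranslation_shiftAdj _).pow_right n).eq, ← mul_assoc,
      show n + 1 - 1 - k = n - k by omega]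
    congr 1
    conv_rhs => rw [← Nat.add_sub_cancel' hk]
    rw [pow_add, ← mul_assoc, shift_pow_mul_shiftAdj_pow, one_mul]
  · rw [Matrix.map_apply, toLaurent_polySum, Matrix.smul_apply, dagger_apply, Matrix.map_apply, hg,
      toLaurent_polySum, map_sum, smul_eq_mul, Finset.mul_sum, ← Finset.sum_range_reflect]
    refine Finset.sum_congr rfl fun k hk => ?_
    have hk : k ≤ n := by
      have := Finset.mem_range.1 hk
      omega
    rw [show n + 1 - 1 - k = n - k by omega, map_mul, invert_T, invert_C, mul_left_comm, ← T_add,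
      show n - (n - k) = k by omega]
    congr 2
    omega

theorem evalUnit_map (g : Matrix ι ι (Polynomial ℂ)) (z : ℂˣ) :
    (g.map toLaurent).map (evalUnit z) = g.map (Polynomial.eval (z : ℂ)) :=
  Matrix.ext fun a b => evalUnit_toLaurent z (g a b)

theorem evalUnit_dagger_map (g : Matrix ι ι (Polynomial ℂ)) (z : ℂˣ) :
    (dagger (g.map toLaurent)).map (evalUnit z) = (g.map (Polynomial.eval (z⁻¹ : ℂ)))ᵀ :=
  Matrix.ext fun a b => by
    rw [Matrix.map_apply, dagger_apply, evalUnit_invert, Matrix.map_apply, evalUnit_toLaurent,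
      Units.val_inv_eq_inv_val]
    rfl

theorem circleUnit_toLaurent_iff {q : Polynomial ℂ} :
    CircleUnit (toLaurent q) ↔ ∀ z : ℂ, ‖z‖ = 1 → q.eval z ≠ 0 := by
  simp only [CircleUnit, evalUnit_toLaurent]
  refine ⟨fun h z hz => ?_, fun h z hz => h z hz⟩
  have h0 : z ≠ 0 := fun h => by simp [h] at hz
  exact h (Units.mk0 z h0) hz

/-- The powers of `z` that clear denominators cancel, because `z^n` on one side meets `z^(-n)` from
the adjoint on the other. The polynomial factors come from `G†` and `D†` so as to stand on the left,
where polynomials in the left shift multiply Toeplitz operators without correction. -/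
theorem exists_polynomial_congruence {ι : Type} [Fintype ι] [DecidableEq ι]
    {A : Matrix ι ι ℂ[T;T⁻¹]} (hA : dagger A = -A) (hdet : CircleUnit A.det) :
    ∃ (μ : Type) (_ : Fintype μ) (_ : DecidableEq μ) (e : μ × Fin 2 ≃ ι)
      (g d : Matrix ι ι (Polynomial ℂ)), (∀ z : ℂ, ‖z‖ = 1 → g.det.eval z ≠ 0) ∧
      (∀ z : ℂ, ‖z‖ = 1 → d.det.eval z ≠ 0) ∧
      g.map toLaurent * A * dagger (g.map toLaurent) =
        d.map toLaurent * (stdSkew e).map C * dagger (d.map toLaurent) := by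
  obtain ⟨μ, i₁, i₂, e, G, D, hG, hD, h⟩ := isHyperbolic A hA hdet
  obtain ⟨n, g, hg⟩ := exists_toLaurent_eq (dagger G)
  obtain ⟨m, d, hd⟩ := exists_toLaurent_eq (dagger D)
  have key : ∀ {n : ℕ} {g : Matrix ι ι (Polynomial ℂ)} {G : Matrix ι ι ℂ[T;T⁻¹]},
      g.map toLaurent = (T n : ℂ[T;T⁻¹]) • dagger G → CircleUnit G.det →
        (∀ z : ℂ, ‖z‖ = 1 → g.det.eval z ≠ 0) ∧ ∀ B : Matrix ι ι ℂ[T;T⁻¹],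
          g.map toLaurent * B * dagger (g.map toLaurent) = dagger G * B * G := by
    intro n g G hg hG
    refine ⟨circleUnit_toLaurent_iff.1 ?_, fun B => ?_⟩
    · have := congrArg Matrix.det hg
      rw [Matrix.det_smul, det_dagger] at this
      have e : toLaurent g.det = (g.map toLaurent).det := RingHom.map_det toLaurent g
      rw [e, this]
      exact circleUnit_mul.2 ⟨(CircleUnit.of_isUnit (isUnit_T _)).pow _, hG.invert⟩
    · rw [hg, dagger_smul, dagger_dagger, invert_T, Matrix.smul_mul, Matrix.smul_mul,
        Matrix.mul_smul, smul_smul, ← T_add, add_neg_cancel, T_zero, one_smul]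
  refine ⟨μ, i₁, i₂, e, g, d, (key hg hG).1, (key hd hD).1, ?_⟩
  rw [(key hg hG).2, (key hd hD).2, h]

end Laurent

/-! ## The parity of the kernel of skew-symmetric Toeplitz operators -/

section Parity

open Polynomial (X)
open LaurentPolynomial (C T invert)
open Polynomial (toLaurent)

variable {ι : Type*} [Fintype ι] [DecidableEq ι]

variable {h : ℤ →₀ Matrix ι ι ℂ} {N : ℕ}

/-- The Laurent polynomial matrix `∑_r h_r z^r`. -/
def laurentSymbol (h : ℤ →₀ Matrix ι ι ℂ) (N : ℕ) : Matrix ι ι (LaurentPolynomial ℂ) :=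
  (T (-N) : LaurentPolynomial ℂ) • (symbol h N).map toLaurent

theorem laurentSymbol_apply (a b : ι) : laurentSymbol h N a b =
    ∑ k ∈ Finset.range (2 * N + 1), C (h ((k : ℤ) - N) a b) * T ((k : ℤ) - N) := by
  rw [laurentSymbol, Matrix.smul_apply, Matrix.map_apply, symbol, toLaurent_polySum, smul_eq_mul,
    Finset.mul_sum]
  refine Finset.sum_congr rfl fun k _ => ?_
  rw [mul_left_comm, ← LaurentPolynomial.T_add, neg_add_eq_sub]

theorem dagger_laurentSymbol (hskew : ∀ r, (h (-r))ᵀ = -h r) :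
    dagger (laurentSymbol h N) = -laurentSymbol h N := by
  refine Matrix.ext fun a b => ?_
  rw [dagger_apply, Matrix.neg_apply, laurentSymbol_apply, laurentSymbol_apply, map_sum,
    ← Finset.sum_neg_distrib, ← Finset.sum_range_reflect]
  refine Finset.sum_congr rfl fun k hk => ?_
  have hk := Finset.mem_range.1 hk
  have e : ((2 * N + 1 - 1 - k : ℕ) : ℤ) - N = -((k : ℤ) - N) := by omega
  have := congrFun (congrFun (hskew ((k : ℤ) - N)) a) b
  rw [Matrix.transpose_apply, Matrix.neg_apply] at this
  rw [e, map_mul, LaurentPolynomial.invert_T, LaurentPolynomial.invert_C, this, neg_neg, map_neg,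
    neg_mul]

theorem evalUnit_laurentSymbol (hN : ∀ r, h r ≠ 0 → r.natAbs ≤ N) (z : ℂˣ) (k : ℝ)
    (hz : (z : ℂ) = Complex.exp (k * Complex.I)) :
    (laurentSymbol h N).map (evalUnit z) = bloch h k := by
  rw [bloch_eq hN, ← hz]
  refine Matrix.ext fun a b => ?_
  rw [Matrix.map_apply, laurentSymbol, Matrix.smul_apply, smul_eq_mul, map_mul, evalUnit_T,
    Matrix.map_apply, evalUnit_toLaurent, Matrix.smul_apply, Matrix.map_apply, smul_eq_mul,
    zpow_neg, zpow_natCast, hz, ← inv_pow, ← Complex.exp_neg]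
  push_cast
  rw [neg_mul]

/-- The unit `e^{ik}`. -/
def circleUnit (k : ℝ) : ℂˣ := Units.mk0 (Complex.exp (k * Complex.I)) (Complex.exp_ne_zero _)

theorem coe_circleUnit (k : ℝ) : (circleUnit k : ℂ) = Complex.exp (k * Complex.I) := rfl

theorem inv_circleUnit (k : ℝ) : (circleUnit k : ℂ)⁻¹ = Complex.exp ((-k : ℝ) * Complex.I) := by
  rw [coe_circleUnit, ← Complex.exp_neg]
  push_cast
  rw [neg_mul]

theorem circleUnit_det_laurentSymbol (hN : ∀ r, h r ≠ 0 → r.natAbs ≤ N)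
    (hdet : ∀ k, (bloch h k).det ≠ 0) : CircleUnit (laurentSymbol h N).det := by
  intro z hz
  obtain ⟨k, hk⟩ := exists_exp_eq hz
  rw [RingHom.map_det, RingHom.mapMatrix_apply, evalUnit_laurentSymbol hN z k hk]
  exact hdet k

theorem map_toLaurent_mul (p q : Matrix ι ι (Polynomial ℂ)) :
    (p * q).map toLaurent = p.map toLaurent * q.map toLaurent :=
  Matrix.map_mul

theorem polyOp_smul_X_pow_mul (p : Matrix ι ι (Polynomial ℂ)) (n : ℕ) :
    polyOp isTranslation_shift ((X ^ n : Polynomial ℂ) • p) * shiftAdj ^ n =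
      polyOp isTranslation_shift p := by
  have : (X ^ n : Polynomial ℂ) • p = p * (X ^ n : Polynomial ℂ) • (1 : Matrix ι ι (Polynomial ℂ)) := by
    rw [Matrix.mul_smul, mul_one]
  rw [this, map_mul, polyOp_X_pow_smul, map_one, mul_one, mul_assoc, shift_pow_mul_shiftAdj_pow,
    mul_one]

theorem shiftAdj_pow_comm_polyOp (g : Matrix ι ι (Polynomial ℂ)) (n : ℕ) :
    shiftAdj ^ n * polyOp isTranslation_shiftAdj g =
      polyOp isTranslation_shiftAdj g * shiftAdj ^ n := by
  have h : shiftAdj ^ n =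
      polyOp (isTranslation_shiftAdj (ι := ι)) ((X ^ n : Polynomial ℂ) • 1) := by
    rw [polyOp_X_pow_smul, map_one, mul_one]
  rw [h, ← map_mul, ← map_mul]
  simp

/-- Congruences of Laurent polynomial matrices give congruences of Toeplitz operators. -/
theorem toeplitz_congruence (hN : ∀ r, h r ≠ 0 → r.natAbs ≤ N) {g d : Matrix ι ι (Polynomial ℂ)}
    {J : Matrix ι ι ℂ} (hgd : g.map toLaurent * laurentSymbol h N * dagger (g.map toLaurent) =
      d.map toLaurent * J.map C * dagger (d.map toLaurent)) :
    polyOp isTranslation_shift g * toeplitz h * polyOp isTranslation_shiftAdj gᵀ =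
      polyOp isTranslation_shift d * site J * polyOp isTranslation_shiftAdj dᵀ := by
  obtain ⟨n₁, h₁⟩ := exists_reflect g
  obtain ⟨n₂, h₂⟩ := exists_reflect d
  -- A common exponent for `g'` and `d'` lets the identity, multiplied by one power of `z`, become
  -- an identity of polynomial matrices, to which the ring homomorphism `polyOp` applies.
  obtain ⟨g', hg, hg'⟩ := h₁ (max n₁ n₂) (le_max_left _ _)
  obtain ⟨d', hd, hd'⟩ := h₂ (max n₁ n₂) (le_max_right _ _)
  set n := max n₁ n₂
  have key : g * symbol h N * g' = (X ^ N : Polynomial ℂ) • (d * J.map Polynomial.C * d') := by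
    have hinj : Function.Injective fun M : Matrix ι ι (Polynomial ℂ) => M.map toLaurent :=
      Matrix.map_injective Polynomial.toLaurent_injective
    refine hinj ?_
    have e1 : (symbol h N).map toLaurent = (T N : LaurentPolynomial ℂ) • laurentSymbol h N := by
      rw [laurentSymbol, smul_smul, ← LaurentPolynomial.T_add, add_neg_cancel,
        LaurentPolynomial.T_zero, one_smul]
    have e2 : (J.map Polynomial.C).map toLaurent = J.map C :=
      Matrix.ext fun a b => Polynomial.toLaurent_C _
    have e3 : ((X ^ N : Polynomial ℂ) • (d * J.map Polynomial.C * d')).map toLaurent =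
        (T N : LaurentPolynomial ℂ) • (d * J.map Polynomial.C * d').map toLaurent :=
      Matrix.ext fun a b => by
        rw [Matrix.map_apply, Matrix.smul_apply, smul_eq_mul, map_mul, map_pow,
          Polynomial.toLaurent_X, LaurentPolynomial.T_pow, mul_one]
        rfl
    simp only [e3, map_toLaurent_mul, e1, e2, hg', hd', Matrix.mul_smul, Matrix.smul_mul]
    rw [hgd]
    exact smul_comm _ _ _
  calc polyOp isTranslation_shift g * toeplitz h * polyOp isTranslation_shiftAdj gᵀ
      = polyOp isTranslation_shift (g * symbol h N * g') * shiftAdj ^ N * shiftAdj ^ n := by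
        rw [toeplitz_eq hN, ← mul_assoc, mul_assoc _ (shiftAdj ^ N), shiftAdj_pow_comm_polyOp, hg,
          map_mul, map_mul]
        simp only [mul_assoc, ← pow_add]
        rw [add_comm]
    _ = polyOp isTranslation_shift d * site J * polyOp isTranslation_shiftAdj dᵀ := by
        rw [key, polyOp_smul_X_pow_mul, hd, map_mul, map_mul, polyOp_map_C]
        simp only [mul_assoc]

end Parity

/-! ## Operators and their blocks -/

section Blocks

open scoped InnerProductSpace

variable {ι κ : Type*} [Fintype ι] [DecidableEq ι] [Fintype κ] [DecidableEq κ]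

theorem block_apply (F : HalfLine ι →L[ℂ] HalfLine ι) (j j' : ℕ) (a b : ι) :
    block F j j' a b = F (ket j' b) j a := rfl

theorem adjoint_ket_apply (F : HalfLine ι →L[ℂ] HalfLine ι) (j j' : ℕ) (a b : ι) :
    ContinuousLinearMap.adjoint F (ket j a) j' b = starRingEnd ℂ (block F j j' a b) := by
  rw [← inner_ket, ContinuousLinearMap.adjoint_inner_right, ← inner_conj_symm, inner_ket,
    block_apply]

theorem apply_eq_inner (F : HalfLine ι →L[ℂ] HalfLine ι) (ψ : HalfLine ι) (j : ℕ) (a : ι) :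
    F ψ j a = ⟪ContinuousLinearMap.adjoint F (ket j a), ψ⟫_ℂ := by
  rw [ContinuousLinearMap.adjoint_inner_left, inner_ket]

theorem operator_ext {F G : HalfLine ι →L[ℂ] HalfLine ι} (h : ∀ j j', block F j j' = block G j j') :
    F = G := by
  ext1 ψ
  refine halfLine_ext fun j a => ?_
  rw [apply_eq_inner, apply_eq_inner]
  congr 1
  refine halfLine_ext fun j' b => ?_
  rw [adjoint_ket_apply, adjoint_ket_apply, h]

/-- On basis states the hypothesis says that the adjoint of `F` is minus the conjugate of `F`.
Expressing components through inner products with the adjoint extends this to `F = -C F† C` on all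
vectors, without a density argument. -/
theorem isSkewOperator_of_block {F : HalfLine ι →L[ℂ] HalfLine ι}
    (h : ∀ j j', (block F j' j)ᵀ = -block F j j') : IsSkewOperator conjVec F := by
  have hC := isConjugation_conjVec (ι := ι)
  have h1 : ∀ j a, ContinuousLinearMap.adjoint F (ket j a) = -conjVec (F (ket j a)) := fun j a =>
    halfLine_ext fun j' b => by
      have := congrFun (congrFun (h j j') a) b
      rw [Matrix.transpose_apply, Matrix.neg_apply] at this
      rw [adjoint_ket_apply]
      change _ = -conjVec (F (ket j a)) j' b
      rw [conjVec_apply, ← block_apply F j' j b a, this, map_neg, neg_neg]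
  have h2 : ∀ y, F y = -conjVec (ContinuousLinearMap.adjoint F (conjVec y)) := fun y =>
    halfLine_ext fun j a => by
      rw [apply_eq_inner, h1, inner_neg_left]
      change _ = -conjVec (ContinuousLinearMap.adjoint F (conjVec y)) j a
      rw [conjVec_apply, ← inner_ket, ContinuousLinearMap.adjoint_inner_right, inner_conj_symm,
        hC.inner_comm]
  intro x y
  rw [h2 y, inner_neg_right, hC.inner_conj, ContinuousLinearMap.adjoint_inner_left]

theorem shift_pow_apply (n : ℕ) (ψ : HalfLine ι) (j : ℕ) : (shift ^ n) ψ j = ψ (j + n) := by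
  induction n generalizing j with
  | zero => rfl
  | succ n ih =>
    rw [pow_succ']
    change (shift ^ n) ψ (j + 1) = _
    rw [ih, add_assoc, add_comm 1]

theorem shiftAdj_pow_apply (n : ℕ) (ψ : HalfLine ι) (j : ℕ) (a : ι) :
    (shiftAdj ^ n) ψ j a = if n ≤ j then ψ (j - n) a else 0 := by
  induction n generalizing j with
  | zero => simp
  | succ n ih =>
    rw [pow_succ']
    change shiftAdj ((shiftAdj ^ n) ψ) j a = _
    cases j with
    | zero => rw [shiftAdj_apply_zero, if_neg (by omega)]
    | succ j => simp only [shiftAdj_apply_succ, ih, add_le_add_iff_right, Nat.add_sub_add_right]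

theorem shiftPow_ket (r : ℤ) (j j' : ℕ) (a b : ι) :
    shiftPow r (ket j' b) j a = if r = j' - j ∧ a = b then 1 else 0 := by
  rw [shiftPow]
  split_ifs with h0 h1 h1
  · rw [shift_pow_apply, ket_apply, if_pos ⟨by omega, h1.2⟩]
  · rw [shift_pow_apply, ket_apply, if_neg fun h => h1 ⟨by omega, h.2⟩]
  · rw [shiftAdj_pow_apply, ket_apply, if_pos (by omega), if_pos ⟨by omega, h1.2⟩]
  · rw [shiftAdj_pow_apply]
    split_ifs
    · rw [ket_apply, if_neg fun h => h1 ⟨by omega, h.2⟩]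
    · rfl

theorem block_site_comp (V : Matrix κ ι ℂ) (F : HalfLine ι →L[ℂ] HalfLine ι) (U : Matrix ι κ ℂ)
    (j j' : ℕ) : block (site V ∘L F ∘L site U) j j' = V * block F j j' * U := by
  have h : ∀ b, site U (ket j' b) = ∑ c, U c b • ket j' c := fun b => halfLine_ext fun i a => by
    rw [site_apply]
    have : ∀ s : Finset ι, (∑ c ∈ s, U c b • ket j' c : HalfLine ι) i a =
        ∑ c ∈ s, U c b * ket j' c i a := fun s => by
      induction s using Finset.induction_on with
      | empty => rfl
      | insert c s hc ih =>
        rw [Finset.sum_insert hc, Finset.sum_insert hc, ← ih]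
        rfl
    rw [this]
    by_cases hi : i = j'
    · subst hi
      simp [ket_apply]
    · simp [ket_apply, hi]
  refine Matrix.ext fun a b => ?_
  have h' : F (site U (ket j' b)) = ∑ c, U c b • F (ket j' c) := by
    rw [h, map_sum]
    simp only [map_smul]
  change site V (F (site U (ket j' b))) j a = _
  rw [site_apply, Matrix.mul_assoc, Matrix.mul_apply]
  refine Finset.sum_congr rfl fun d _ => ?_
  rw [h', Matrix.mul_apply]
  congr 1
  have : ∀ s : Finset ι, (∑ c ∈ s, U c b • F (ket j' c) : HalfLine ι) j d =
      ∑ c ∈ s, block F j j' d c * U c b := fun s => by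
    induction s using Finset.induction_on with
    | empty => rfl
    | insert c s hc ih =>
      rw [Finset.sum_insert hc, Finset.sum_insert hc, ← ih, mul_comm]
      rfl
  exact this _

theorem block_add (F G : HalfLine ι →L[ℂ] HalfLine ι) (j j' : ℕ) :
    block (F + G) j j' = block F j j' + block G j j' := rfl

theorem block_toeplitz (h : ℤ →₀ Matrix ι ι ℂ) (j j' : ℕ) :
    block (toeplitz h) j j' = h ((j' : ℤ) - j) := by
  have h1 : ∀ r, block (shiftPow r ∘L onSite (h r)) j j' =
      if r = (j' : ℤ) - j then h r else 0 := fun r => by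
    have h2 : shiftPow r ∘L onSite (h r) = site 1 ∘L shiftPow r ∘L site (h r) := by
      rw [site_one]
      rfl
    have h3 : block (shiftPow r) j j' = if r = (j' : ℤ) - j then (1 : Matrix ι ι ℂ) else 0 :=
      Matrix.ext fun a b => by
        rw [block_apply, shiftPow_ket]
        by_cases hr : r = (j' : ℤ) - j <;> simp [hr, Matrix.one_apply]
    rw [h2, block_site_comp, h3]
    split_ifs <;> simp
  have h2 : ∀ s : Finset ℤ, block (∑ r ∈ s, shiftPow r ∘L onSite (h r)) j j' =
      ∑ r ∈ s, if r = (j' : ℤ) - j then h r else 0 := fun s => by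
    induction s using Finset.induction_on with
    | empty => rfl
    | insert r s hr ih => rw [Finset.sum_insert hr, Finset.sum_insert hr, block_add, h1, ih]
  rw [toeplitz, Finsupp.sum, h2, Finset.sum_ite_eq']
  split_ifs with hs
  · rfl
  · exact (Finsupp.notMem_support_iff.1 hs).symm

theorem isSkewOperator_toeplitz {h : ℤ →₀ Matrix ι ι ℂ} (hskew : ∀ r, (h (-r))ᵀ = -h r) :
    IsSkewOperator conjVec (toeplitz h) :=
  isSkewOperator_of_block fun j j' => by
    rw [block_toeplitz, block_toeplitz, ← hskew, neg_sub]

end Blocks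

/-! ### Kernel parity through congruence to the standard skew form -/

section Parity

open Polynomial (X toLaurent)
open LaurentPolynomial (C T invert)

variable {ι : Type} [Fintype ι] [DecidableEq ι] {μ : Type} [Fintype μ] [DecidableEq μ]

theorem stdSkew_transpose (e : μ × Fin 2 ≃ ι) : (stdSkew e)ᵀ = -stdSkew e := by
  have h : (!![0, 1; -1, 0] : Matrix (Fin 2) (Fin 2) ℂ)ᵀ = -!![0, 1; -1, 0] := by
    ext i j
    fin_cases i <;> fin_cases j <;> simp
  rw [stdSkew, Matrix.transpose_submatrix, ← Matrix.kroneckerMap_transpose, h, Matrix.transpose_one]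
  refine Matrix.ext fun a b => ?_
  simp only [Matrix.submatrix_apply, Matrix.kroneckerMap_apply, Matrix.neg_apply, mul_neg]

theorem stdSkew_mul_self (e : μ × Fin 2 ≃ ι) : stdSkew e * stdSkew e = -1 := by
  have h : (!![0, 1; -1, 0] * !![0, 1; -1, 0] : Matrix (Fin 2) (Fin 2) ℂ) = (-1 : ℂ) • 1 := by
    ext i j
    fin_cases i <;> fin_cases j <;> simp
  rw [stdSkew, Matrix.submatrix_mul_equiv, ← Matrix.mul_kronecker_mul, h, one_mul,
    Matrix.kronecker_smul, Matrix.one_kronecker_one]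
  refine Matrix.ext fun a b => ?_
  simp [Matrix.one_apply]

theorem isUnit_stdSkew (e : μ × Fin 2 ≃ ι) : IsUnit (stdSkew e) :=
  ⟨⟨stdSkew e, -stdSkew e, by rw [mul_neg, stdSkew_mul_self, neg_neg],
    by rw [neg_mul, stdSkew_mul_self, neg_neg]⟩, rfl⟩

theorem isSkewOperator_site {J : Matrix ι ι ℂ} (hJ : Jᵀ = -J) :
    IsSkewOperator conjVec (site J) := fun x y => by
  have h := isTransposed_site J x y
  have e : site (-J) = -site J := by rw [← neg_one_smul ℂ J, site_smul, neg_one_smul]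
  rw [hJ, e, isConjugation_conjVec.inner_comm (site J x)] at h
  rw [← h, _root_.neg_apply, inner_neg_right, neg_neg]

theorem IsTransposed.inner_congruence {U V : HalfLine ι →L[ℂ] HalfLine ι} (h : IsTransposed U V)
    {F K : HalfLine ι →L[ℂ] HalfLine ι} (x y : HalfLine ι) :
    inner ℂ (conjVec x) ((U * F * K) y) = inner ℂ (conjVec (V x)) (F (K y)) :=
  h x (F (K y))

theorem isFredholm_polyOp_transpose {g : Matrix ι ι (Polynomial ℂ)}
    (hg : ∀ z : ℂ, ‖z‖ = 1 → g.det.eval z ≠ 0) :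
    (polyOp isTranslation_shiftAdj gᵀ).IsFredholm ∧
      index (polyOp isTranslation_shiftAdj gᵀ).toLinearMap = -discRoots g.det := by
  have := isFredholm_polyOp isTranslation_shiftAdj hasIndexStep_shiftAdj (p := gᵀ)
    (by rwa [Matrix.det_transpose])
  rwa [Matrix.det_transpose, neg_one_mul] at this

variable {h : ℤ →₀ Matrix ι ι ℂ} {N : ℕ}

/-- The same operator is a congruence of `toeplitz h` by the operator of `g†` and of the constant
`J` by that of `d†`. These have indices minus the numbers of zeros in the disc, and `J` has no
kernel; comparing the two parities eliminates the middle operator. -/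
theorem even_ker_toeplitz (hN : ∀ r, h r ≠ 0 → r.natAbs ≤ N) (hskew : ∀ r, (h (-r))ᵀ = -h r)
    (hdet : ∀ k, (bloch h k).det ≠ 0) {g d : Matrix ι ι (Polynomial ℂ)}
    (hg : ∀ z : ℂ, ‖z‖ = 1 → g.det.eval z ≠ 0) (hd : ∀ z : ℂ, ‖z‖ = 1 → d.det.eval z ≠ 0)
    (e : μ × Fin 2 ≃ ι)
    (hgd : g.map toLaurent * laurentSymbol h N * dagger (g.map toLaurent) =
      d.map toLaurent * (stdSkew e).map C * dagger (d.map toLaurent)) :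
    Even (Module.finrank ℂ (toeplitz h).ker + discRoots g.det + discRoots d.det) := by
  have hJ : IsUnit (site (stdSkew e)) := (isUnit_stdSkew e).map onSiteHom
  have h1 := (isSkewOperator_toeplitz hskew).even_ker_congruence isConjugation_conjVec
    (G := polyOp isTranslation_shift g * toeplitz h * polyOp isTranslation_shiftAdj gᵀ)
    (index_toeplitz hdet).1 (isFredholm_polyOp_transpose hg).1
    (isTransposed_polyOp g).inner_congruence
  have h2 := (isSkewOperator_site (stdSkew_transpose e)).even_ker_congruence isConjugation_conjVec
    (G := polyOp isTranslation_shift d * site (stdSkew e) * polyOp isTranslation_shiftAdj dᵀ)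
    (isFredholm_of_isUnit hJ).1 (isFredholm_polyOp_transpose hd).1
    (isTransposed_polyOp d).inner_congruence
  rw [(isFredholm_polyOp_transpose hg).2, toeplitz_congruence hN hgd] at h1
  have h3 : (site (stdSkew e)).ker = ⊥ := by
    obtain ⟨u, hu⟩ := hJ
    refine (Submodule.eq_bot_iff _).2 fun x hx => ?_
    have hx : site (stdSkew e) x = 0 := hx
    have := congrArg (fun F => F x) u.inv_mul
    rw [hu] at this
    change u⁻¹.val (site (stdSkew e) x) = x at this
    rw [← this, hx, map_zero]
  rw [(isFredholm_polyOp_transpose hd).2, h3, finrank_bot] at h2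
  obtain ⟨a, ha⟩ := h1
  obtain ⟨b, hb⟩ := h2
  rw [Nat.even_iff]
  omega

theorem neg_one_pow_eq_of_even {a b : ℕ} (h : Even (a + b)) : (-1 : ℂ) ^ a = (-1) ^ b := by
  have h1 := h.neg_one_pow (α := ℂ)
  rw [pow_add] at h1
  have h2 : (-1 : ℂ) ^ b * (-1) ^ b = 1 := by rw [← pow_add]; exact (Even.add_self b).neg_one_pow
  linear_combination (-1 : ℂ) ^ b * h1 - (-1 : ℂ) ^ a * h2

theorem evalUnit_congruence (hN : ∀ r, h r ≠ 0 → r.natAbs ≤ N) {g d : Matrix ι ι (Polynomial ℂ)}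
    {J : Matrix ι ι ℂ} (hgd : g.map toLaurent * laurentSymbol h N * dagger (g.map toLaurent) =
      d.map toLaurent * J.map C * dagger (d.map toLaurent)) {z w : ℂ} {k : ℝ}
    (hz : Complex.exp (k * Complex.I) = z) (hw : Complex.exp ((-k : ℝ) * Complex.I) = w) :
    g.map (Polynomial.eval z) * bloch h k * (g.map (Polynomial.eval w))ᵀ =
      d.map (Polynomial.eval z) * J * (d.map (Polynomial.eval w))ᵀ := by
  have h1 := congrArg (fun M => M.map (evalUnit (circleUnit k))) hgd
  have h2 : (J.map C).map (evalUnit (circleUnit k)) = J := Matrix.ext fun a b => evalUnit_C _ _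
  simp only [Matrix.map_mul, evalUnit_map, evalUnit_dagger_map, h2, inv_circleUnit,
    evalUnit_laurentSymbol hN _ k (coe_circleUnit k)] at h1
  rwa [coe_circleUnit, hz, hw] at h1

end Parity

/-! ### The Pfaffian formula for the parity -/

section ParityFormula

variable {P : ℕ} {h : ℤ →₀ Matrix (Fin 2 × Fin P) (Fin 2 × Fin P) ℂ}

/-- The parity of the kernel of a skew-symmetric Toeplitz operator, in terms of its symbol. -/
theorem neg_one_pow_ker_toeplitz (hskew : ∀ r, (h (-r))ᵀ = -h r)
    (hdet : ∀ k, (bloch h k).det ≠ 0) :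
    (-1 : ℂ) ^ Module.finrank ℂ (toeplitz h).ker =
      pf (bloch h 0) / pf (bloch h Real.pi) * Complex.exp (1 / 2 *
        ∫ k in (0 : ℝ)..Real.pi, logDeriv (fun k' : ℝ => (bloch h k').det) k) := by
  obtain ⟨N, hN⟩ := exists_bound h
  obtain ⟨μ, i₁, i₂, e, g, d, hg, hd, hgd⟩ := exists_polynomial_congruence
    (dagger_laurentSymbol (N := N) hskew) (circleUnit_det_laurentSymbol hN hdet)
  have heven := even_ker_toeplitz hN hskew hdet hg hd e hgd
  rw [add_assoc] at heven
  rw [neg_one_pow_eq_of_even heven]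
  -- Determinants of the congruence at `e^{ik}`; the adjoint factors are evaluated at `e^{-ik}`.
  have hsplit : ∀ k, (bloch h k).det * (onCircle g.det k * onCircle g.det (-k)) =
      (stdSkew e).det * (onCircle d.det k * onCircle d.det (-k)) := fun k => by
    have := congrArg Matrix.det (evalUnit_congruence hN hgd (k := k) rfl rfl)
    simp only [Matrix.det_mul, Matrix.det_transpose, ← eval_det] at this
    simp only [onCircle]
    linear_combination this
  have hJ : (stdSkew e).det ≠ 0 :=
    ((Matrix.isUnit_iff_isUnit_det _).1 (isUnit_stdSkew e)).ne_zero
  -- Only where `e^{ik} = e^{-ik}`, that is at `k = 0` and `k = π`, is the identity a congruence by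
  -- a matrix and its own transpose, so that Pfaffians can be compared.
  have hpf : ∀ z : ℂ, ∀ k : ℝ, Complex.exp (k * Complex.I) = z →
      Complex.exp ((-k : ℝ) * Complex.I) = z →
      g.det.eval z * pf (bloch h k) = d.det.eval z * pf (stdSkew e) := fun z k hz hw => by
    have := congrArg pf (evalUnit_congruence hN hgd hz hw)
    have h1 : ∀ (M A : Matrix (Fin 2 × Fin P) (Fin 2 × Fin P) ℂ), pf (M * A * Mᵀ) = M.det * pf A :=
      fun M A => by simpa using pf_congruence A Mᵀ
    rwa [h1, h1, ← eval_det, ← eval_det] at this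
  have hpf1 := hpf 1 0 (by simp) (by simp)
  have hpf2 := hpf (-1) Real.pi Complex.exp_pi_mul_I (by
    push_cast
    rw [neg_mul, Complex.exp_neg, Complex.exp_pi_mul_I]
    norm_num)
  have hgc := isNonvanishing_onCircle hg
  have hdc := isNonvanishing_onCircle hd
  have hint : (∫ k in (0 : ℝ)..Real.pi, logDeriv (fun k => (bloch h k).det) k) +
      ∫ k in (0 : ℝ)..Real.pi, logDeriv (fun k => onCircle g.det k * onCircle g.det (-k)) k =
      ∫ k in (0 : ℝ)..Real.pi, logDeriv (fun k => onCircle d.det k * onCircle d.det (-k)) k := by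
    rw [← (isNonvanishing_det_bloch hdet).integral_logDeriv_mul (hgc.mul hgc.comp_neg)]
    simp only [hsplit]
    rw [(isNonvanishing_const hJ).integral_logDeriv_mul (hdc.mul hdc.comp_neg),
      integral_logDeriv_const, zero_add]
  -- The exponentials for `g` and `d` are quotients of determinants at `-1` and `1`, which cancel
  -- those in the Pfaffian quotient, times the signs counting zeros in the disc, which remain.
  have hexp := congrArg (fun x => Complex.exp (1 / 2 * x)) hint
  simp only [mul_add, Complex.exp_add] at hexp
  rw [exp_half_integral_onCircle hg, exp_half_integral_onCircle hd] at hexp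
  set E := Complex.exp (1 / 2 * ∫ k in (0 : ℝ)..Real.pi, logDeriv (fun k => (bloch h k).det) k)
  have n1 : ‖(1 : ℂ)‖ = 1 := by simp
  have n2 : ‖(-1 : ℂ)‖ = 1 := by simp
  have hg1 := hg 1 n1
  have hg2 := hg (-1) n2
  have hd1 := hd 1 n1
  have hd2 := hd (-1) n2
  have hj := pf_stdSkew_ne_zero e
  have hA2 : pf (bloch h Real.pi) ≠ 0 := fun h0 => by
    rw [h0, mul_zero] at hpf2
    exact mul_ne_zero hd2 hj hpf2.symm
  have hs : (-1 : ℂ) ^ discRoots g.det * (-1) ^ discRoots g.det = 1 := by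
    rw [← pow_add]
    exact (Even.add_self _).neg_one_pow
  have hA1' : pf (bloch h 0) = d.det.eval 1 * pf (stdSkew e) / g.det.eval 1 := by
    rw [eq_div_iff hg1, ← hpf1, mul_comm]
  have hA2' : pf (bloch h Real.pi) = d.det.eval (-1) * pf (stdSkew e) / g.det.eval (-1) := by
    rw [eq_div_iff hg2, ← hpf2, mul_comm]
  have hE : E = d.det.eval (-1) / d.det.eval 1 * (-1) ^ discRoots d.det *
      (g.det.eval 1 / g.det.eval (-1)) * (-1) ^ discRoots g.det := by
    rw [← hexp]
    have : Polynomial.eval (-1) g.det / Polynomial.eval 1 g.det *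
      (Polynomial.eval 1 g.det / Polynomial.eval (-1) g.det) = 1 := by field_simp
    linear_combination (-E * (Polynomial.eval (-1) g.det / Polynomial.eval 1 g.det *
      (Polynomial.eval 1 g.det / Polynomial.eval (-1) g.det))) * hs - E * this
  rw [hE, hA1', hA2', pow_add]
  field_simp

/-- The parity of the kernel of a finite-rank skew-symmetric perturbation of a skew-symmetric
Toeplitz operator. -/
theorem neg_one_pow_ker (hskew : ∀ r, (h (-r))ᵀ = -h r) (hdet : ∀ k, (bloch h k).det ≠ 0)
    {W : HalfLine (Fin 2 × Fin P) →L[ℂ] HalfLine (Fin 2 × Fin P)}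
    (hW : ∀ j j', (block W j' j)ᵀ = -block W j j') (hW' : FiniteDimensional ℂ W.range) :
    (-1 : ℂ) ^ Module.finrank ℂ (toeplitz h + W).ker =
      pf (bloch h 0) / pf (bloch h Real.pi) * Complex.exp (1 / 2 *
        ∫ k in (0 : ℝ)..Real.pi, logDeriv (fun k' : ℝ => (bloch h k').det) k) := by
  rw [← neg_one_pow_ker_toeplitz hskew hdet]
  refine neg_one_pow_eq_of_even ((isSkewOperator_toeplitz hskew).even_ker_add isConjugation_conjVec
    ?_ (index_toeplitz hdet).1 hW')
  refine isSkewOperator_of_block fun j j' => ?_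
  rw [block_add, block_add, Matrix.transpose_add, hW, block_toeplitz, block_toeplitz, ← neg_sub,
    hskew, neg_add]

end ParityFormula

/-! ## Hamiltonians and their blocks -/

section Hamiltonians

variable {ι κ : Type*} [Fintype ι] [DecidableEq ι] [Fintype κ] [DecidableEq κ]

/-- The linear map `M ↦ A M B` on matrices. -/
def sandwich (A : Matrix κ ι ℂ) (B : Matrix ι κ ℂ) : Matrix ι ι ℂ →ₗ[ℂ] Matrix κ κ ℂ where
  toFun M := A * M * B
  map_add' M N := by rw [Matrix.mul_add, Matrix.add_mul]
  map_smul' c M := by simp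

@[simp]
theorem sandwich_apply (A : Matrix κ ι ℂ) (B : Matrix ι κ ℂ) (M : Matrix ι ι ℂ) :
    sandwich A B M = A * M * B := rfl

/-- The hopping matrices obtained by applying a linear map. -/
def mapHop (L : Matrix ι ι ℂ →ₗ[ℂ] Matrix κ κ ℂ) (h : ℤ →₀ Matrix ι ι ℂ) : ℤ →₀ Matrix κ κ ℂ :=
  h.mapRange L (map_zero L)

theorem mapHop_apply (L : Matrix ι ι ℂ →ₗ[ℂ] Matrix κ κ ℂ) (h : ℤ →₀ Matrix ι ι ℂ) (r : ℤ) :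
    mapHop L h r = L (h r) := rfl

theorem bloch_mapHop (L : Matrix ι ι ℂ →ₗ[ℂ] Matrix κ κ ℂ) (h : ℤ →₀ Matrix ι ι ℂ) (k : ℝ) :
    bloch (mapHop L h) k = L (bloch h k) := by
  rw [bloch, bloch, mapHop, Finsupp.sum_mapRange_index (by simp), Finsupp.sum, Finsupp.sum, map_sum]
  simp only [map_smul]

theorem map_bloch_eq_zero (L : Matrix ι ι ℂ →ₗ[ℂ] Matrix κ κ ℂ) {h : ℤ →₀ Matrix ι ι ℂ}
    (hL : ∀ r, L (h r) = 0) (k : ℝ) : L (bloch h k) = 0 := by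
  have : mapHop L h = 0 := Finsupp.ext hL
  rw [← bloch_mapHop, this]
  exact Finsupp.sum_zero_index

theorem conjTranspose_bloch {h : ℤ →₀ Matrix ι ι ℂ} (hh : ∀ r, h (-r) = (h r)ᴴ) (k : ℝ) :
    (bloch h k)ᴴ = bloch h k := by
  obtain ⟨N, hN⟩ := exists_bound h
  rw [bloch, sum_eq_sum_range hN _ fun _ => smul_zero _, Matrix.conjTranspose_sum]
  rw [← Finset.sum_range_reflect]
  refine Finset.sum_congr rfl fun n hn => ?_
  have hn := Finset.mem_range.1 hn
  have e : ((2 * N + 1 - 1 - n : ℕ) : ℤ) - N = -((n : ℤ) - N) := by omega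
  rw [e, Matrix.conjTranspose_smul, hh, Matrix.conjTranspose_conjTranspose, RCLike.star_def,
    ← Complex.exp_conj]
  congr 2
  simp
  ring

theorem site_comp_toeplitz_add_comp_site (A : Matrix κ ι ℂ) (B : Matrix ι κ ℂ)
    (h : ℤ →₀ Matrix ι ι ℂ) (W : HalfLine ι →L[ℂ] HalfLine ι) :
    site A ∘L (toeplitz h + W) ∘L site B =
      toeplitz (mapHop (sandwich A B) h) + site A ∘L W ∘L site B :=
  operator_ext fun j j' => by
    rw [block_site_comp, block_add, block_add, block_site_comp, block_toeplitz, block_toeplitz,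
      mapHop_apply, sandwich_apply, Matrix.mul_add, Matrix.add_mul]

theorem finiteDimensional_range_site_comp (A : Matrix κ ι ℂ) (B : Matrix ι κ ℂ)
    {W : HalfLine ι →L[ℂ] HalfLine ι} (hW : FiniteDimensional ℂ W.range) :
    FiniteDimensional ℂ (site A ∘L W ∘L site B).range := by
  have : (site A ∘L W ∘L site B).range ≤ W.range.map (site A).toLinearMap := by
    rintro _ ⟨x, rfl⟩
    exact ⟨W (site B x), ⟨site B x, rfl⟩, rfl⟩
  exact Submodule.finiteDimensional_of_le this

theorem block_adjoint (F : HalfLine ι →L[ℂ] HalfLine ι) (j j' : ℕ) :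
    block (ContinuousLinearMap.adjoint F) j j' = (block F j' j)ᴴ :=
  Matrix.ext fun a b => adjoint_ket_apply F j' j b a

theorem adjoint_toeplitz {h : ℤ →₀ Matrix ι ι ℂ} (hh : ∀ r, h (-r) = (h r)ᴴ) :
    ContinuousLinearMap.adjoint (toeplitz h) = toeplitz h :=
  operator_ext fun j j' => by
    rw [block_adjoint, block_toeplitz, block_toeplitz, ← hh, neg_sub]

theorem finiteDimensional_zeroModes {S : Set (Matrix ι ι ℂ)} {h : ℤ →₀ Matrix ι ι ℂ}
    {W : HalfLine ι →L[ℂ] HalfLine ι} (hh : IsGappedBloch S h) (hW : IsBoundaryTerm S W) :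
    FiniteDimensional ℂ (zeroModes (toeplitz h + W)) :=
  (isFredholm_add (index_toeplitz hh.gapped).1 hW.finiteRank).finite_ker

theorem index_toeplitz_add {h : ℤ →₀ Matrix ι ι ℂ} {W : HalfLine ι →L[ℂ] HalfLine ι}
    (hdet : ∀ k, (bloch h k).det ≠ 0) (hW : FiniteDimensional ℂ W.range) :
    ((Module.finrank ℂ (toeplitz h + W).ker : ℤ) -
      Module.finrank ℂ (ContinuousLinearMap.adjoint (toeplitz h + W)).ker : ℤ) =
        winding (bloch h) := by
  obtain ⟨h1, h2⟩ := index_toeplitz hdet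
  rw [← h2, ← index_eq_ker_adjoint (isFredholm_add h1 hW), index_add h1 hW]

end Hamiltonians

/-! ## Chiral Hamiltonians -/

section Chiral

variable {ι κ : Type*} [Fintype ι] [DecidableEq ι] [Fintype κ] [DecidableEq κ]

/-- The columns of `V₀` and `V₁` together form an orthonormal basis. -/
structure IsSplitting (V₀ V₁ : Matrix ι κ ℂ) : Prop where
  mul₀₀ : V₀ᴴ * V₀ = 1
  mul₁₁ : V₁ᴴ * V₁ = 1
  mul₀₁ : V₀ᴴ * V₁ = 0
  mul₁₀ : V₁ᴴ * V₀ = 0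
  add : V₀ * V₀ᴴ + V₁ * V₁ᴴ = 1

variable {V₀ V₁ : Matrix ι κ ℂ}

theorem IsSplitting.symm (h : IsSplitting V₀ V₁) : IsSplitting V₁ V₀ :=
  ⟨h.mul₁₁, h.mul₀₀, h.mul₁₀, h.mul₀₁, by rw [add_comm, h.add]⟩

/-- `M` is block off-diagonal with respect to a splitting. -/
def IsOdd (V₀ V₁ : Matrix ι κ ℂ) (M : Matrix ι ι ℂ) : Prop := V₀ᴴ * M * V₀ = 0 ∧ V₁ᴴ * M * V₁ = 0

/-- On a chirality sector `Γ` acts by a sign whose square is `1`, so conjugating `M` by `Γ` does not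
change its diagonal block, while the constraint negates it. -/
theorem isOdd_of_anticomm {Γ M : Matrix ι ι ℂ} {ε : ℂ} (hε : ε * ε = 1) (h₀ : Γ * V₀ = ε • V₀)
    (h₁ : Γ * V₁ = -ε • V₁) (hΓ : Γᴴ = Γ) (hε' : star ε = ε) (hM : Γ * M * Γ = -M) :
    IsOdd V₀ V₁ M := by
  have key : ∀ (V : Matrix ι κ ℂ) (c : ℂ), c * c = 1 → star c = c → Γ * V = c • V →
      Vᴴ * M * V = 0 := by
    intro V c hc hc' hV
    have hV' : Vᴴ * Γ = c • Vᴴ := by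
      rw [← hΓ, ← Matrix.conjTranspose_mul, hV, Matrix.conjTranspose_smul, hc']
    have h1 : Vᴴ * (Γ * M * Γ) * V = Vᴴ * M * V := by
      have : Vᴴ * (Γ * M * Γ) * V = (Vᴴ * Γ) * M * (Γ * V) := by simp only [Matrix.mul_assoc]
      rw [this, hV, hV', Matrix.mul_smul, Matrix.smul_mul, Matrix.smul_mul, smul_smul, hc, one_smul]
    rw [hM, Matrix.mul_neg, Matrix.neg_mul] at h1
    have h2 : (2 : ℂ) • (Vᴴ * M * V) = 0 := by
      rw [two_smul]
      nth_rewrite 1 [← h1]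
      rw [neg_add_cancel]
    exact (smul_eq_zero.1 h2).resolve_left two_ne_zero
  refine ⟨key V₀ ε hε hε' h₀, key V₁ (-ε) ?_ ?_ h₁⟩
  · rw [neg_mul_neg, hε]
  · rw [star_neg, hε']

theorem IsSplitting.eq_of_isOdd (hV : IsSplitting V₀ V₁) {M : Matrix ι ι ℂ} (hM : IsOdd V₀ V₁ M) :
    M = V₁ * (V₁ᴴ * M * V₀) * V₀ᴴ + V₀ * (V₀ᴴ * M * V₁) * V₁ᴴ := by
  have h1 : M = (V₀ * V₀ᴴ + V₁ * V₁ᴴ) * M * (V₀ * V₀ᴴ + V₁ * V₁ᴴ) := by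
    rw [hV.add, one_mul, mul_one]
  have h2 : (V₀ * V₀ᴴ + V₁ * V₁ᴴ) * M * (V₀ * V₀ᴴ + V₁ * V₁ᴴ) =
      V₀ * (V₀ᴴ * M * V₀) * V₀ᴴ + V₁ * (V₁ᴴ * M * V₁) * V₁ᴴ +
        (V₁ * (V₁ᴴ * M * V₀) * V₀ᴴ + V₀ * (V₀ᴴ * M * V₁) * V₁ᴴ) := by
    simp only [Matrix.add_mul, Matrix.mul_add, Matrix.mul_assoc]
    abel
  rw [hM.1, hM.2] at h2
  rw [h2] at h1
  simpa using h1

/-- For odd `M` one has `M V₀ = V₁ (V₁ᴴ M V₀)`, so a null vector of the block would give, through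
the injective `V₀`, a null vector of `M`. -/
theorem IsSplitting.det_ne_zero (hV : IsSplitting V₀ V₁) {M : Matrix ι ι ℂ}
    (hM : IsOdd V₀ V₁ M) (hdet : M.det ≠ 0) : (V₁ᴴ * M * V₀).det ≠ 0 := by
  intro h0
  obtain ⟨v, hv, hMv⟩ := Matrix.exists_mulVec_eq_zero_iff.2 h0
  refine hdet (Matrix.exists_mulVec_eq_zero_iff.1 ⟨V₀ *ᵥ v, fun h => hv ?_, ?_⟩)
  · have := congrArg (fun w => V₀ᴴ *ᵥ w) h
    simpa [Matrix.mulVec_mulVec, hV.mul₀₀] using this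
  · have h1 : M * V₀ = V₁ * (V₁ᴴ * M * V₀) := by
      conv_lhs => rw [hV.eq_of_isOdd hM]
      rw [Matrix.add_mul, Matrix.mul_assoc _ V₀ᴴ, Matrix.mul_assoc _ V₁ᴴ, hV.mul₀₀, hV.mul₁₀]
      simp
    rw [Matrix.mulVec_mulVec, h1, ← Matrix.mulVec_mulVec, hMv, Matrix.mulVec_zero]

theorem isOdd_bloch {h : ℤ →₀ Matrix ι ι ℂ} (hh : ∀ r, IsOdd V₀ V₁ (h r)) (k : ℝ) :
    IsOdd V₀ V₁ (bloch h k) :=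
  ⟨map_bloch_eq_zero (sandwich V₀ᴴ V₀) (fun r => (hh r).1) k,
    map_bloch_eq_zero (sandwich V₁ᴴ V₁) (fun r => (hh r).2) k⟩

theorem IsSplitting.operator_eq (hV : IsSplitting V₀ V₁) {H : HalfLine ι →L[ℂ] HalfLine ι}
    (hH : ∀ j j', IsOdd V₀ V₁ (block H j j')) :
    H = site V₁ ∘L (site V₁ᴴ ∘L H ∘L site V₀) ∘L site V₀ᴴ +
      site V₀ ∘L (site V₀ᴴ ∘L H ∘L site V₁) ∘L site V₁ᴴ :=
  operator_ext fun j j' => by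
    rw [block_add, block_site_comp, block_site_comp, block_site_comp, block_site_comp]
    exact hV.eq_of_isOdd (hH j j')

theorem site_comp_apply {μ : Type*} [Fintype μ] [DecidableEq μ] (A : Matrix κ ι ℂ)
    (B : Matrix ι μ ℂ) (x : HalfLine μ) : site A (site B x) = site (A * B) x := by
  rw [site_mul]
  rfl

theorem IsSplitting.apply_add (hV : IsSplitting V₀ V₁) (x : HalfLine ι) :
    site V₀ (site V₀ᴴ x) + site V₁ (site V₁ᴴ x) = x := by
  rw [site_comp_apply, site_comp_apply]
  have := site_add (V₀ * V₀ᴴ) (V₁ * V₁ᴴ)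
  rw [hV.add, site_one] at this
  exact (congrArg (fun F => F x) this).symm

theorem IsSplitting.site_injective (hV : IsSplitting V₀ V₁) : Function.Injective (site V₀) :=
  Function.LeftInverse.injective (g := site V₀ᴴ) fun x => by
    rw [site_comp_apply, hV.mul₀₀, site_one]
    rfl

theorem IsSplitting.map_ker (hV : IsSplitting V₀ V₁) {H : HalfLine ι →L[ℂ] HalfLine ι}
    (hH : ∀ j j', IsOdd V₀ V₁ (block H j j')) :
    Submodule.map (site V₀).toLinearMap (site V₁ᴴ ∘L H ∘L site V₀).ker =
      H.ker ⊓ (site V₁ᴴ).ker := by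
  apply le_antisymm
  · rintro _ ⟨x, hx, rfl⟩
    have hx : site V₁ᴴ (H (site V₀ x)) = 0 := hx
    have h1 : site V₁ᴴ (site V₀ x) = 0 := by
      rw [site_comp_apply, hV.mul₁₀, site_zero]
      rfl
    refine ⟨?_, h1⟩
    change H (site V₀ x) = 0
    have h2 : H (site V₀ x) = site V₁ (site V₁ᴴ (H (site V₀ (site V₀ᴴ (site V₀ x))))) +
      site V₀ (site V₀ᴴ (H (site V₁ (site V₁ᴴ (site V₀ x))))) :=
      congrArg (fun F => F (site V₀ x)) (hV.operator_eq hH)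
    have h3 : site V₀ᴴ (site V₀ x) = x := by
      rw [site_comp_apply, hV.mul₀₀, site_one]
      rfl
    rw [h2, h3, hx, h1]
    simp
  · rintro x ⟨hx, hx'⟩
    have hx : H x = 0 := hx
    have hx' : site V₁ᴴ x = 0 := hx'
    have h1 := hV.apply_add x
    rw [hx', map_zero, add_zero] at h1
    refine ⟨site V₀ᴴ x, ?_, h1⟩
    change site V₁ᴴ (H (site V₀ (site V₀ᴴ x))) = 0
    rw [h1, hx, map_zero]

theorem IsSplitting.finrank_ker (hV : IsSplitting V₀ V₁) {H : HalfLine ι →L[ℂ] HalfLine ι}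
    (hH : ∀ j j', IsOdd V₀ V₁ (block H j j')) :
    Module.finrank ℂ (site V₁ᴴ ∘L H ∘L site V₀).ker =
      Module.finrank ℂ ↥(H.ker ⊓ (site V₁ᴴ).ker) := by
  rw [← hV.map_ker hH]
  exact (Submodule.equivMapOfInjective _ hV.site_injective _).finrank_eq

theorem IsSplitting.eigenspace_eq (hV : IsSplitting V₀ V₁) {Γ : Matrix ι ι ℂ} {ε : ℂ} (hε : ε ≠ 0)
    (h₀ : Γ * V₀ = ε • V₀) (h₁ : V₁ᴴ * Γ = -ε • V₁ᴴ) :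
    Module.End.eigenspace (onSite Γ).toLinearMap ε = (site V₁ᴴ).ker := by
  ext x
  rw [Module.End.mem_eigenspace_iff]
  change site Γ x = ε • x ↔ site V₁ᴴ x = 0
  constructor
  · intro hx
    have h2 := congrArg (site V₁ᴴ) hx
    rw [site_comp_apply, h₁, site_smul, map_smul] at h2
    change -ε • site V₁ᴴ x = ε • site V₁ᴴ x at h2
    have h3 : (2 * ε) • site V₁ᴴ x = 0 := by
      rw [two_mul, add_smul]
      nth_rewrite 1 [← h2]
      rw [neg_smul, neg_add_cancel]
    exact (smul_eq_zero.1 h3).resolve_left (mul_ne_zero two_ne_zero hε)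
  · intro hx
    have h2 := hV.apply_add x
    rw [hx, map_zero, add_zero] at h2
    rw [← h2, site_comp_apply, h₀, site_smul]
    rfl

theorem isOdd_block {S : Set (Matrix ι ι ℂ)} {h : ℤ →₀ Matrix ι ι ℂ}
    {W : HalfLine ι →L[ℂ] HalfLine ι} (hh : IsGappedBloch S h) (hW : IsBoundaryTerm S W)
    (hS : ∀ M ∈ S, IsOdd V₀ V₁ M) (j j' : ℕ) : IsOdd V₀ V₁ (block (toeplitz h + W) j j') := by
  have h1 := hS _ (hh.symmetric ((j' : ℤ) - j))
  have h2 := hS _ (hW.symmetric j j')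
  rw [block_add, block_toeplitz]
  constructor
  · rw [Matrix.mul_add, Matrix.add_mul, h1.1, h2.1, add_zero]
  · rw [Matrix.mul_add, Matrix.add_mul, h1.2, h2.2, add_zero]

/-- Zero modes of chirality `+1` are the kernel of the block from `V₀` to `V₁`, and those of
chirality `-1` the kernel of its adjoint. The difference is the index of this block, again a
Toeplitz operator plus a finite-rank term. -/
theorem IsSplitting.chiralBoundary_eq (hV : IsSplitting V₀ V₁) {Γ : Matrix ι ι ℂ}
    (hΓ : Γᴴ = Γ) (h₀ : Γ * V₀ = V₀) (h₁ : Γ * V₁ = -V₁) {S : Set (Matrix ι ι ℂ)}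
    (hS : ∀ M ∈ S, Γ * M * Γ = -M) {h : ℤ →₀ Matrix ι ι ℂ} {W : HalfLine ι →L[ℂ] HalfLine ι}
    (hh : IsGappedBloch S h) (hW : IsBoundaryTerm S W) :
    (chiralBoundary Γ (toeplitz h + W) : ℂ) = winding fun k => V₁ᴴ * bloch h k * V₀ := by
  have hS' : ∀ M ∈ S, IsOdd V₀ V₁ M := fun M hM =>
    isOdd_of_anticomm (ε := 1) (one_mul 1) (by rw [h₀, one_smul]) (by rw [h₁, neg_one_smul]) hΓ
      (star_one ℂ) (hS M hM)
  have hodd := isOdd_block hh hW hS'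
  have hadj : ∀ V : Matrix ι κ ℂ, Vᴴ * Γ = (Γ * V)ᴴ := fun V => by
    rw [Matrix.conjTranspose_mul, hΓ]
  have hsa : ContinuousLinearMap.adjoint (toeplitz h + W) = toeplitz h + W := by
    rw [map_add, adjoint_toeplitz hh.hermitian, hW.hermitian.adjoint_eq]
  have e1 := hV.eigenspace_eq (Γ := Γ) (ε := 1) one_ne_zero (by rw [h₀, one_smul])
    (by rw [hadj, h₁, Matrix.conjTranspose_neg, neg_one_smul])
  have e2 := hV.symm.eigenspace_eq (Γ := Γ) (ε := -1) (neg_ne_zero.2 one_ne_zero)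
    (by rw [h₁, neg_one_smul]) (by rw [hadj, h₀, neg_neg, one_smul])
  have f1 := hV.finrank_ker hodd
  have f2 := hV.symm.finrank_ker fun j j' => (hodd j j').symm
  have hdet : ∀ k, (bloch (mapHop (sandwich V₁ᴴ V₀) h) k).det ≠ 0 := fun k => by
    rw [bloch_mapHop]
    exact hV.det_ne_zero (isOdd_bloch (fun r => hS' _ (hh.symmetric r)) k) (hh.gapped k)
  have key := index_toeplitz_add hdet (finiteDimensional_range_site_comp V₁ᴴ V₀ hW.finiteRank)
  rw [← site_comp_toeplitz_add_comp_site, ContinuousLinearMap.adjoint_comp,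
    ContinuousLinearMap.adjoint_comp, hsa, adjoint_site, adjoint_site,
    Matrix.conjTranspose_conjTranspose, ContinuousLinearMap.comp_assoc, f1, f2] at key
  rw [chiralBoundary, e1, e2]
  refine key.trans ?_
  congr 1
  funext k
  exact bloch_mapHop _ _ k

end Chiral

/-! ## Classes AIII, CII and BDI -/

section ChiralClasses

variable {κ : Type*} [Fintype κ] [DecidableEq κ]

/-- The inclusion of the internal states selected by `f`. -/
def inclusion {ι κ : Type*} [DecidableEq ι] (f : κ → ι) : Matrix ι κ ℂ :=
  (1 : Matrix ι ι ℂ).submatrix id f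

variable {ι : Type*} [Fintype ι] [DecidableEq ι]

theorem inclusion_apply (f : κ → ι) (x : ι) (q : κ) :
    inclusion f x q = if x = f q then 1 else 0 := Matrix.one_apply

theorem inclusion_mul_inclusion (f g : κ → ι) (M : Matrix ι ι ℂ) :
    (inclusion f)ᴴ * M * inclusion g = M.submatrix f g :=
  Matrix.ext fun a b => by
    simp [Matrix.mul_apply, inclusion_apply, Matrix.conjTranspose_apply, apply_ite]

theorem isSplitting_inclusion (e : Fin 2 × κ ≃ ι) :
    IsSplitting (inclusion fun q => e (0, q)) (inclusion fun q => e (1, q)) := by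
  have h : ∀ f g : κ → ι, (inclusion f)ᴴ * inclusion g = (1 : Matrix ι ι ℂ).submatrix f g :=
    fun f g => by rw [← inclusion_mul_inclusion, Matrix.mul_one]
  refine ⟨?_, ?_, ?_, ?_, ?_⟩
  · rw [h]
    exact Matrix.ext fun a b => by simp [Matrix.one_apply]
  · rw [h]
    exact Matrix.ext fun a b => by simp [Matrix.one_apply]
  · rw [h]
    exact Matrix.ext fun a b => by simp
  · rw [h]
    exact Matrix.ext fun a b => by simp
  · refine Matrix.ext fun x y => ?_
    have h1 : (inclusion e * (inclusion e)ᴴ) x y =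
        ((inclusion fun q => e (0, q)) * (inclusion fun q => e (0, q))ᴴ +
          (inclusion fun q => e (1, q)) * (inclusion fun q => e (1, q))ᴴ) x y := by
      rw [Matrix.add_apply, Matrix.mul_apply, Matrix.mul_apply, Matrix.mul_apply,
        Fintype.sum_prod_type, Fin.sum_univ_two]
      rfl
    rw [← h1, Matrix.mul_apply, ← e.symm.sum_comp]
    simp [inclusion_apply, Matrix.conjTranspose_apply, apply_ite, Matrix.one_apply]

theorem pauliZ_kronecker_conjTranspose :
    (pauliZ ⊗ₖ (1 : Matrix κ κ ℂ))ᴴ = pauliZ ⊗ₖ (1 : Matrix κ κ ℂ) := by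
  have : pauliZᴴ = pauliZ := by
    ext i j
    fin_cases i <;> fin_cases j <;> simp [pauliZ]
  rw [Matrix.conjTranspose_kronecker, this, Matrix.conjTranspose_one]

theorem mul_inclusion (M : Matrix ι ι ℂ) (f : κ → ι) : M * inclusion f = M.submatrix id f :=
  Matrix.ext fun a b => by simp [Matrix.mul_apply, inclusion_apply]

theorem pauliZ_mul_inclusion_zero :
    (pauliZ ⊗ₖ (1 : Matrix κ κ ℂ)) * (inclusion fun q => ((0 : Fin 2), q) : Matrix (Fin 2 × κ) κ ℂ) =
      inclusion (fun q => ((0 : Fin 2), q)) := by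
  rw [mul_inclusion]
  refine Matrix.ext fun ⟨i, a⟩ b => ?_
  fin_cases i <;> simp [inclusion_apply, pauliZ, Matrix.one_apply]

theorem pauliZ_mul_inclusion_one :
    (pauliZ ⊗ₖ (1 : Matrix κ κ ℂ)) * (inclusion fun q => ((1 : Fin 2), q) : Matrix (Fin 2 × κ) κ ℂ) =
      -inclusion (fun q => ((1 : Fin 2), q)) := by
  rw [mul_inclusion]
  refine Matrix.ext fun ⟨i, a⟩ b => ?_
  fin_cases i <;> simp [inclusion_apply, pauliZ, Matrix.one_apply, neg_ite]

/-- The bulk-boundary correspondence for Hamiltonians with a sublattice symmetry. -/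
theorem chiralBoundary_pauliZ {S : Set (Matrix (Fin 2 × κ) (Fin 2 × κ) ℂ)}
    (hS : ∀ M ∈ S, (pauliZ ⊗ₖ 1) * M * (pauliZ ⊗ₖ 1) = -M)
    {h : ℤ →₀ Matrix (Fin 2 × κ) (Fin 2 × κ) ℂ} {W : HalfLine (Fin 2 × κ) →L[ℂ] HalfLine (Fin 2 × κ)}
    (hh : IsGappedBloch S h) (hW : IsBoundaryTerm S W) :
    (chiralBoundary (pauliZ ⊗ₖ 1) (toeplitz h + W) : ℂ) =
      winding fun k => lowerLeft (bloch h k) := by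
  rw [(isSplitting_inclusion (Equiv.refl (Fin 2 × κ))).chiralBoundary_eq
    pauliZ_kronecker_conjTranspose pauliZ_mul_inclusion_zero pauliZ_mul_inclusion_one hS hh hW]
  congr 1
  funext k
  exact inclusion_mul_inclusion _ _ _

/-- Exchange of the spin index and the sublattice index. -/
def swapSpin (P : ℕ) : Fin 2 × (Fin 2 × Fin P) ≃ Fin 2 × Fin 2 × Fin P :=
  ((Equiv.prodAssoc _ _ _).symm.trans (Equiv.prodCongr (Equiv.prodComm _ _) (Equiv.refl _))).trans
    (Equiv.prodAssoc _ _ _)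

theorem swapSpin_apply {P : ℕ} (a b : Fin 2) (p : Fin P) : swapSpin P (a, (b, p)) = (b, a, p) := rfl

variable {P : ℕ}

theorem spin_mul_inclusion_zero :
    ((1 : Matrix (Fin 2) (Fin 2) ℂ) ⊗ₖ (pauliZ ⊗ₖ (1 : Matrix (Fin P) (Fin P) ℂ))) *
      inclusion (fun q => swapSpin P (0, q)) = inclusion (fun q => swapSpin P (0, q)) := by
  rw [mul_inclusion]
  refine Matrix.ext fun ⟨j, i, a⟩ ⟨k, b⟩ => ?_
  fin_cases i <;> simp [inclusion_apply, pauliZ, Matrix.one_apply, swapSpin_apply]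
  grind

theorem spin_mul_inclusion_one :
    ((1 : Matrix (Fin 2) (Fin 2) ℂ) ⊗ₖ (pauliZ ⊗ₖ (1 : Matrix (Fin P) (Fin P) ℂ))) *
      inclusion (fun q => swapSpin P (1, q)) = -inclusion (fun q => swapSpin P (1, q)) := by
  rw [mul_inclusion]
  refine Matrix.ext fun ⟨j, i, a⟩ ⟨k, b⟩ => ?_
  fin_cases i <;> simp [inclusion_apply, pauliZ, Matrix.one_apply, swapSpin_apply]
  grind

theorem eq_zero_of_commute_pauliZ {M : Matrix (Fin 2 × κ) (Fin 2 × κ) ℂ}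
    (h : Commute (pauliZ ⊗ₖ 1) M) (x y : κ) : M (0, x) (1, y) = 0 ∧ M (1, x) (0, y) = 0 := by
  have h1 := congrFun (congrFun h.eq (0, x)) (1, y)
  have h2 := congrFun (congrFun h.eq (1, x)) (0, y)
  rw [Matrix.mul_apply, Matrix.mul_apply, Fintype.sum_prod_type, Fintype.sum_prod_type,
    Fin.sum_univ_two, Fin.sum_univ_two] at h1 h2
  simp [pauliZ, Matrix.one_apply] at h1 h2
  exact ⟨by linear_combination h1 / 2, by linear_combination -h2 / 2⟩

theorem eq_of_commute_pauliX {M : Matrix (Fin 2 × κ) (Fin 2 × κ) ℂ}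
    (h : Commute (pauliX ⊗ₖ 1) M) (x y : κ) : M (1, x) (1, y) = M (0, x) (0, y) := by
  have h1 := congrFun (congrFun h.eq (0, x)) (1, y)
  rw [Matrix.mul_apply, Matrix.mul_apply, Fintype.sum_prod_type, Fintype.sum_prod_type,
    Fin.sum_univ_two, Fin.sum_univ_two] at h1
  simpa [pauliX, Matrix.one_apply] using h1

/-- The commutator with a matrix. -/
def commutator (A : Matrix ι ι ℂ) : Matrix ι ι ℂ →ₗ[ℂ] Matrix ι ι ℂ := sandwich A 1 - sandwich 1 A

theorem commute_bloch {A : Matrix ι ι ℂ} {h : ℤ →₀ Matrix ι ι ℂ} (hA : ∀ r, Commute A (h r))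
    (k : ℝ) : Commute A (bloch h k) := by
  have := map_bloch_eq_zero (commutator A) (h := h) (fun r => by
    simp [commutator, (hA r).eq]) k
  change A * bloch h k = bloch h k * A
  simpa [commutator, sub_eq_zero] using this

/-- Commutation with `σ_z` removes the spin-flip blocks and commutation with `σ_x` makes the two
spin blocks equal. The determinant is then a square, whose logarithmic derivative carries the factor
`2`. -/
theorem bulkBDI_eq {h : ℤ →₀ Matrix (Fin 2 × Fin 2 × Fin P) (Fin 2 × Fin 2 × Fin P) ℂ}
    (hh : IsGappedBloch (classBDI P) h)
    (hdet : ∀ k, ((inclusion fun q => swapSpin P (1, q))ᴴ * bloch h k *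
      (inclusion fun q => swapSpin P (0, q))).det ≠ 0) :
    (winding fun k => (inclusion fun q => swapSpin P (1, q))ᴴ * bloch h k *
      (inclusion fun q => swapSpin P (0, q))) = bulkBDI h := by
  have hblock : ∀ k, (inclusion fun q => swapSpin P (1, q))ᴴ * bloch h k *
      (inclusion fun q => swapSpin P (0, q)) = 1 ⊗ₖ blockBDI (bloch h k) := fun k => by
    have hX := eq_of_commute_pauliX (commute_bloch (fun r => (hh.symmetric r).1) k)
    have hZ := eq_zero_of_commute_pauliZ (commute_bloch (fun r => (hh.symmetric r).2.2.1) k)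
    rw [inclusion_mul_inclusion]
    refine Matrix.ext fun ⟨i, a⟩ ⟨j, b⟩ => ?_
    fin_cases i <;> fin_cases j <;>
      simp [swapSpin_apply, hX, hZ, blockBDI]
  have hdet' : ∀ k, ((inclusion fun q => swapSpin P (1, q))ᴴ * bloch h k *
      (inclusion fun q => swapSpin P (0, q))).det =
        (blockBDI (bloch h k)).det * (blockBDI (bloch h k)).det := fun k => by
    rw [hblock, Matrix.det_kronecker]
    simp [sq]
  have hb : ∀ k, blockBDI (bloch h k) = bloch (mapHop (sandwich
      (inclusion fun q : Fin P => ((0 : Fin 2), (1 : Fin 2), q))ᴴ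
      (inclusion fun q : Fin P => ((0 : Fin 2), (0 : Fin 2), q))) h) k := fun k => by
    rw [bloch_mapHop, sandwich_apply, inclusion_mul_inclusion]
    rfl
  have hne : ∀ k, (blockBDI (bloch h k)).det ≠ 0 := fun k h0 => hdet k (by rw [hdet', h0, zero_mul])
  have hnv : IsNonvanishing fun k => (blockBDI (bloch h k)).det := by
    simp only [hb] at hne ⊢
    exact isNonvanishing_det_bloch hne
  rw [bulkBDI, winding, winding]
  simp only [hdet']
  rw [hnv.integral_logDeriv_mul hnv]
  ring

theorem chiralBoundary_classBDI
    {h : ℤ →₀ Matrix (Fin 2 × Fin 2 × Fin P) (Fin 2 × Fin 2 × Fin P) ℂ}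
    {W : HalfLine (Fin 2 × Fin 2 × Fin P) →L[ℂ] HalfLine (Fin 2 × Fin 2 × Fin P)}
    (hh : IsGappedBloch (classBDI P) h) (hW : IsBoundaryTerm (classBDI P) W) :
    (chiralBoundary (1 ⊗ₖ (pauliZ ⊗ₖ 1)) (toeplitz h + W) : ℂ) = bulkBDI h := by
  have hΓ : ((1 : Matrix (Fin 2) (Fin 2) ℂ) ⊗ₖ (pauliZ ⊗ₖ (1 : Matrix (Fin P) (Fin P) ℂ)))ᴴ =
      1 ⊗ₖ (pauliZ ⊗ₖ 1) := by
    rw [Matrix.conjTranspose_kronecker, pauliZ_kronecker_conjTranspose, Matrix.conjTranspose_one]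
  have hs := isSplitting_inclusion (swapSpin P)
  have hS : ∀ M ∈ classBDI P, (1 ⊗ₖ (pauliZ ⊗ₖ 1)) * M * (1 ⊗ₖ (pauliZ ⊗ₖ 1)) = -M :=
    fun M hM => hM.2.2.2.2
  rw [hs.chiralBoundary_eq hΓ spin_mul_inclusion_zero spin_mul_inclusion_one hS hh hW]
  refine bulkBDI_eq hh fun k => hs.det_ne_zero (isOdd_bloch (fun r => ?_) k) (hh.gapped k)
  exact isOdd_of_anticomm (ε := 1) (one_mul 1) (by rw [spin_mul_inclusion_zero, one_smul])
    (by rw [spin_mul_inclusion_one, neg_one_smul]) hΓ (star_one ℂ) (hS _ (hh.symmetric r))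

end ChiralClasses

/-! ## Skew-symmetric blocks -/

section SkewBlocks

variable {ι κ : Type*} [Fintype ι] [DecidableEq ι] [Fintype κ] [DecidableEq κ]

theorem conj_conjTranspose (M : Matrix ι κ ℂ) : (conj M)ᴴ = Mᵀ :=
  Matrix.ext fun a b => by simp [conj]

theorem conj_eq_conjTranspose_transpose (M : Matrix ι κ ℂ) : conj M = Mᴴᵀ := rfl

/-- The Fermi constraint turns the transpose of `M` into minus its adjoint, conjugated by `X`, and
`X` is absorbed by the frames. Class DIII uses two different frames, exchanged by conjugation; class
D uses `V₀ = V₁`. -/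
theorem transpose_block {X M : Matrix ι ι ℂ} {V₀ V₁ : Matrix ι κ ℂ} (hX : Xᴴ = X)
    (h₀ : conj V₀ = X * V₁) (h₁ : conj V₁ = X * V₀) (hM : X * conj M * X = -M) :
    (V₁ᴴ * M * V₀)ᵀ = -(V₁ᴴ * Mᴴ * V₀) := by
  have hM' : X * Mᵀ * X = -Mᴴ := by
    have := congrArg Matrix.conjTranspose hM
    rwa [Matrix.conjTranspose_mul, Matrix.conjTranspose_mul, hX, conj_conjTranspose,
      Matrix.conjTranspose_neg, ← Matrix.mul_assoc] at this
  have h₀' : V₀ᵀ = V₁ᴴ * X := by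
    rw [← conj_conjTranspose, h₀, Matrix.conjTranspose_mul, hX]
  calc (V₁ᴴ * M * V₀)ᵀ = V₀ᵀ * Mᵀ * conj V₁ := by
        rw [Matrix.transpose_mul, Matrix.transpose_mul, conj_eq_conjTranspose_transpose,
          Matrix.mul_assoc]
    _ = V₁ᴴ * (X * Mᵀ * X) * V₀ := by
        rw [h₀', h₁]
        simp only [Matrix.mul_assoc]
    _ = _ := by rw [hM', Matrix.mul_neg, Matrix.neg_mul]

theorem IsBoundaryTerm.conjTranspose_block {S : Set (Matrix ι ι ℂ)}
    {W : HalfLine ι →L[ℂ] HalfLine ι} (hW : IsBoundaryTerm S W) (j j' : ℕ) :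
    (block W j j')ᴴ = block W j' j := by
  rw [← block_adjoint, hW.hermitian.adjoint_eq]

/-- The parity of the zero modes of a block whose transpose is minus its adjoint block. -/
theorem neg_one_pow_ker_block {P : ℕ} {S : Set (Matrix ι ι ℂ)} {h : ℤ →₀ Matrix ι ι ℂ}
    {W : HalfLine ι →L[ℂ] HalfLine ι} (hh : IsGappedBloch S h) (hW : IsBoundaryTerm S W)
    {A : Matrix (Fin 2 × Fin P) ι ℂ} {B : Matrix ι (Fin 2 × Fin P) ℂ}
    (hS : ∀ M ∈ S, (A * M * B)ᵀ = -(A * Mᴴ * B)) (hdet : ∀ k, (A * bloch h k * B).det ≠ 0) :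
    (-1 : ℂ) ^ Module.finrank ℂ (site A ∘L (toeplitz h + W) ∘L site B).ker =
      pf (A * bloch h 0 * B) / pf (A * bloch h Real.pi * B) * Complex.exp (1 / 2 *
        ∫ k in (0 : ℝ)..Real.pi, logDeriv (fun k' : ℝ => (A * bloch h k' * B).det) k) := by
  have hb : ∀ k, A * bloch h k * B = bloch (mapHop (sandwich A B) h) k := fun k => by
    rw [bloch_mapHop, sandwich_apply]
  simp only [hb] at hdet ⊢
  rw [site_comp_toeplitz_add_comp_site]
  refine neg_one_pow_ker (fun r => ?_) hdet (fun j j' => ?_)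
    (finiteDimensional_range_site_comp A B hW.finiteRank)
  · rw [mapHop_apply, mapHop_apply, sandwich_apply, sandwich_apply, hS _ (hh.symmetric _),
      ← hh.hermitian, neg_neg]
  · rw [block_site_comp, block_site_comp, hS _ (hW.symmetric _ _), hW.conjTranspose_block]

theorem isSkewOperator_block {S : Set (Matrix ι ι ℂ)} {h : ℤ →₀ Matrix ι ι ℂ}
    {W : HalfLine ι →L[ℂ] HalfLine ι} (hh : IsGappedBloch S h) (hW : IsBoundaryTerm S W)
    {A : Matrix κ ι ℂ} {B : Matrix ι κ ℂ} (hS : ∀ M ∈ S, (A * M * B)ᵀ = -(A * Mᴴ * B)) :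
    IsSkewOperator conjVec (site A ∘L (toeplitz h + W) ∘L site B) :=
  isSkewOperator_of_block fun j j' => by
    rw [block_site_comp, block_site_comp, block_add, block_add, Matrix.mul_add, Matrix.add_mul,
      Matrix.mul_add, Matrix.add_mul, Matrix.transpose_add, hS _ (hW.symmetric _ _),
      hW.conjTranspose_block, block_toeplitz, block_toeplitz, hS _ (hh.symmetric _),
      ← hh.hermitian, neg_sub, neg_add]

end SkewBlocks

/-! ## Class D -/

section ClassD

theorem star_inv_sqrt_two : star (((1 / Real.sqrt 2 : ℝ) : ℂ)) = ((1 / Real.sqrt 2 : ℝ) : ℂ) :=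
  Complex.conj_ofReal _

theorem inv_sqrt_two_mul_self :
    ((1 / Real.sqrt 2 : ℝ) : ℂ) * ((1 / Real.sqrt 2 : ℝ) : ℂ) = 1 / 2 := by
  rw [← Complex.ofReal_mul, div_mul_div_comm, Real.mul_self_sqrt (by norm_num)]
  norm_num

theorem UDadj_unitary : UDadjᴴ * UDadj = 1 := by
  rw [UDadj, Matrix.conjTranspose_smul, star_inv_sqrt_two, Matrix.smul_mul, Matrix.mul_smul,
    smul_smul, inv_sqrt_two_mul_self]
  ext i j
  fin_cases i <;> fin_cases j <;> simp [Matrix.mul_apply, Fin.sum_univ_two] <;> norm_num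

theorem conj_UDadj : conj UDadj = pauliX * UDadj := by
  have : conj UDadj = star ((1 / Real.sqrt 2 : ℝ) : ℂ) • conj !![1, Complex.I; 1, -Complex.I] :=
    Matrix.ext fun a b => map_mul (starRingEnd ℂ) _ _
  rw [this, star_inv_sqrt_two, UDadj, Matrix.mul_smul]
  congr 1
  ext i j
  fin_cases i <;> fin_cases j <;> simp [Matrix.mul_apply, Fin.sum_univ_two, conj, pauliX]

theorem conj_kronecker_one {m n p : Type*} [DecidableEq p] (M : Matrix m n ℂ) :
    conj (M ⊗ₖ (1 : Matrix p p ℂ)) = conj M ⊗ₖ 1 :=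
  Matrix.ext fun a b => by
    simp only [conj, Matrix.map_apply, Matrix.kroneckerMap_apply, map_mul, Matrix.one_apply]
    split_ifs <;> simp

variable {P : ℕ}

/-- The unitary of class D on all internal states. -/
abbrev unitaryD (P : ℕ) : Matrix (Fin 2 × Fin P) (Fin 2 × Fin P) ℂ := UDadj ⊗ₖ 1

theorem unitaryD_unitary : (unitaryD P)ᴴ * unitaryD P = 1 := by
  rw [Matrix.conjTranspose_kronecker, ← Matrix.mul_kronecker_mul, UDadj_unitary,
    Matrix.conjTranspose_one, mul_one, Matrix.one_kronecker_one]

theorem blockD_eq (M : Matrix (Fin 2 × Fin P) (Fin 2 × Fin P) ℂ) :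
    blockD M = (-Complex.I) • ((unitaryD P)ᴴ * M * unitaryD P) := by
  rw [blockD, Matrix.conjTranspose_kronecker, Matrix.conjTranspose_one]

theorem blockD_eq' (M : Matrix (Fin 2 × Fin P) (Fin 2 × Fin P) ℂ) :
    blockD M = ((-Complex.I) • (unitaryD P)ᴴ) * M * unitaryD P := by
  rw [blockD_eq, Matrix.smul_mul, Matrix.smul_mul]

theorem pauliX_kronecker_conjTranspose {κ : Type*} [Fintype κ] [DecidableEq κ] :
    (pauliX ⊗ₖ (1 : Matrix κ κ ℂ))ᴴ = pauliX ⊗ₖ (1 : Matrix κ κ ℂ) := by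
  have : pauliXᴴ = pauliX := by
    ext i j
    fin_cases i <;> fin_cases j <;> simp [pauliX]
  rw [Matrix.conjTranspose_kronecker, this, Matrix.conjTranspose_one]

theorem blockD_transpose {M : Matrix (Fin 2 × Fin P) (Fin 2 × Fin P) ℂ} (hM : M ∈ classD P) :
    (blockD M)ᵀ = -blockD Mᴴ := by
  have hV : conj (unitaryD P) = (pauliX ⊗ₖ 1) * unitaryD P := by
    rw [conj_kronecker_one, conj_UDadj, ← Matrix.mul_kronecker_mul, one_mul]
  rw [blockD_eq, blockD_eq, Matrix.transpose_smul,
    transpose_block pauliX_kronecker_conjTranspose hV hV hM, smul_neg]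

theorem det_blockD_ne_zero {M : Matrix (Fin 2 × Fin P) (Fin 2 × Fin P) ℂ} (hM : M.det ≠ 0) :
    (blockD M).det ≠ 0 := by
  have h := congrArg Matrix.det (unitaryD_unitary (P := P))
  rw [Matrix.det_mul, Matrix.det_one] at h
  rw [blockD_eq, Matrix.det_smul, Matrix.det_mul, Matrix.det_mul]
  exact mul_ne_zero (pow_ne_zero _ (neg_ne_zero.2 Complex.I_ne_zero))
    (mul_ne_zero (mul_ne_zero (left_ne_zero_of_mul_eq_one h) hM) (right_ne_zero_of_mul_eq_one h))

/-- The block is anti-hermitian of even order `2P`, so the sign picked up by the determinant is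
trivial. -/
theorem star_det_blockD {M : Matrix (Fin 2 × Fin P) (Fin 2 × Fin P) ℂ} (hM : Mᴴ = M) :
    star (blockD M).det = (blockD M).det := by
  have h : (blockD M)ᴴ = -blockD M := by
    rw [blockD_eq, Matrix.conjTranspose_smul, Matrix.conjTranspose_mul, Matrix.conjTranspose_mul,
      Matrix.conjTranspose_conjTranspose, hM, Matrix.mul_assoc, ← neg_smul]
    simp
  rw [← Matrix.det_conjTranspose, h, Matrix.det_neg]
  simp

/-- A real function has a real logarithmic derivative, so the exponent is real. -/
theorem exp_half_integral_real {f : ℝ → ℂ} (hf : ∀ k, star (f k) = f k) (hd : Differentiable ℝ f)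
    (a b : ℝ) : ∃ x : ℝ, 0 < x ∧ Complex.exp (1 / 2 * ∫ k in a..b, logDeriv f k) = x := by
  obtain ⟨g, rfl⟩ : ∃ g : ℝ → ℝ, f = fun k => (g k : ℂ) :=
    ⟨fun k => (f k).re, funext fun k => (Complex.conj_eq_iff_re.1 (hf k)).symm⟩
  have hg : Differentiable ℝ g := Complex.reCLM.differentiable.comp hd
  have h : ∀ k, logDeriv (fun k => (g k : ℂ)) k = (logDeriv g k : ℝ) := fun k => by
    rw [logDeriv_apply, logDeriv_apply, (hg k).hasDerivAt.ofReal_comp.deriv]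
    push_cast
    rfl
  refine ⟨Real.exp (1 / 2 * ∫ k in a..b, logDeriv g k), Real.exp_pos _, ?_⟩
  simp only [h]
  rw [intervalIntegral.integral_ofReal]
  push_cast
  rfl

theorem finrank_ker_unitary {ι : Type*} [Fintype ι] [DecidableEq ι] {A B : Matrix ι ι ℂ}
    (hA : IsUnit A) (hB : IsUnit B) (H : HalfLine ι →L[ℂ] HalfLine ι) :
    Module.finrank ℂ (site A ∘L H ∘L site B).ker = Module.finrank ℂ H.ker := by
  obtain ⟨u, rfl⟩ := hA
  obtain ⟨v, rfl⟩ := hB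
  have hu : ∀ x, site u⁻¹.val (site u.val x) = x := fun x => by
    rw [site_comp_apply, u.inv_mul, site_one]
    rfl
  have hv : ∀ x, site v.val (site v⁻¹.val x) = x := fun x => by
    rw [site_comp_apply, v.mul_inv, site_one]
    rfl
  have hv' : Function.LeftInverse (site v⁻¹.val) (site v.val) := fun x => by
    rw [site_comp_apply, v.inv_mul, site_one]
    rfl
  have h : Submodule.map (site v.val).toLinearMap (site u.val ∘L H ∘L site v.val).ker = H.ker := by
    apply le_antisymm
    · rintro _ ⟨x, hx, rfl⟩
      have hx : site u.val (H (site v.val x)) = 0 := hx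
      change H (site v.val x) = 0
      rw [← hu (H (site v.val x)), hx, map_zero]
    · intro x hx
      have hx : H x = 0 := hx
      refine ⟨site v⁻¹.val x, ?_, hv x⟩
      change site u.val (H (site v.val (site v⁻¹.val x))) = 0
      rw [hv, hx, map_zero]
  rw [← h]
  exact (Submodule.equivMapOfInjective _ hv'.injective _).finrank_eq

theorem neg_one_pow_numZeroModes_classD
    {h : ℤ →₀ Matrix (Fin 2 × Fin P) (Fin 2 × Fin P) ℂ}
    {W : HalfLine (Fin 2 × Fin P) →L[ℂ] HalfLine (Fin 2 × Fin P)}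
    (hh : IsGappedBloch (classD P) h) (hW : IsBoundaryTerm (classD P) W) :
    (-1 : ℂ) ^ numZeroModes (toeplitz h + W) = bulkD h := by
  have hdet : ∀ k, (blockD (bloch h k)).det ≠ 0 := fun k => det_blockD_ne_zero (hh.gapped k)
  have hV : IsUnit (unitaryD P) := by
    rw [Matrix.isUnit_iff_isUnit_det]
    have := congrArg Matrix.det (unitaryD_unitary (P := P))
    rw [Matrix.det_mul, Matrix.det_one] at this
    exact (right_ne_zero_of_mul_eq_one this).isUnit
  have hV' : IsUnit ((-Complex.I) • (unitaryD P)ᴴ) := by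
    rw [Matrix.isUnit_iff_isUnit_det, Matrix.det_smul, Matrix.det_conjTranspose]
    have := (Matrix.isUnit_iff_isUnit_det _).1 hV
    exact (IsUnit.pow _ (neg_ne_zero.2 Complex.I_ne_zero).isUnit).mul this.star
  have key := neg_one_pow_ker_block (A := (-Complex.I) • (unitaryD P)ᴴ) (B := unitaryD P) hh hW
    (fun M hM => by rw [← blockD_eq', ← blockD_eq', blockD_transpose hM])
    (fun k => by rw [← blockD_eq']; exact hdet k)
  rw [finrank_ker_unitary hV' hV] at key
  simp only [← blockD_eq'] at key
  have hf : Differentiable ℝ fun k => (blockD (bloch h k)).det := by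
    have hb : ∀ k, blockD (bloch h k) = bloch (mapHop (sandwich ((-Complex.I) • (unitaryD P)ᴴ)
        (unitaryD P)) h) k := fun k => by
      rw [bloch_mapHop, sandwich_apply, blockD_eq']
    simp only [hb] at hdet ⊢
    exact (isNonvanishing_det_bloch hdet).differentiable
  obtain ⟨x, hx, hx'⟩ := exp_half_integral_real
    (fun k => star_det_blockD (conjTranspose_bloch hh.hermitian k)) hf 0 Real.pi
  rw [hx'] at key
  rw [bulkD, sgn, numZeroModes, zeroModes, key]
  -- The Pfaffian quotient times the positive number `x` is `±1`. Its norm is therefore `1 / x`, and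
  -- dividing the quotient by its norm is the same as multiplying by `x`.
  have hn := congrArg norm key
  rw [norm_pow, norm_neg, norm_one, one_pow, norm_mul, Complex.norm_real,
    Real.norm_of_nonneg hx.le] at hn
  rw [eq_div_iff (fun h0 => by
    rw [Complex.ofReal_eq_zero] at h0
    rw [h0, zero_mul] at hn
    exact one_ne_zero hn)]
  rw [mul_assoc, ← Complex.ofReal_mul, mul_comm x, ← hn, Complex.ofReal_one, mul_one]

end ClassD

/-! ## Class DIII -/

section ClassDIII

/-- From `F = -C F† C`, conjugation is an antilinear bijection between the two kernels. -/
theorem finrank_ker_adjoint {ι : Type*} [Fintype ι] [DecidableEq ι]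
    {F : HalfLine ι →L[ℂ] HalfLine ι} (hF : IsSkewOperator conjVec F) :
    Module.finrank ℂ (ContinuousLinearMap.adjoint F).ker = Module.finrank ℂ F.ker := by
  have hC := isConjugation_conjVec (ι := ι)
  have h : ∀ x, F x = -conjVec (ContinuousLinearMap.adjoint F (conjVec x)) := fun x => by
    refine ext_inner_left ℂ fun y => ?_
    rw [← hC.conj_conj y, hF, inner_neg_right, hC.inner_conj, ContinuousLinearMap.adjoint_inner_left]
  have h1 : ∀ x, F x = 0 → ContinuousLinearMap.adjoint F (conjVec x) = 0 := fun x hx => by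
    rw [h, neg_eq_zero] at hx
    rw [← hC.conj_conj (ContinuousLinearMap.adjoint F (conjVec x)), hx, map_zero]
  have h2 : ∀ x, ContinuousLinearMap.adjoint F x = 0 → F (conjVec x) = 0 := fun x hx => by
    rw [h, hC.conj_conj, hx, map_zero, neg_zero]
  let e : (ContinuousLinearMap.adjoint F).ker ≃+ F.ker :=
    { toFun := fun x => ⟨conjVec x, h2 x x.2⟩
      invFun := fun x => ⟨conjVec x, h1 x x.2⟩
      left_inv := fun x => Subtype.ext (hC.conj_conj x)
      right_inv := fun x => Subtype.ext (hC.conj_conj x)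
      map_add' := fun x y => Subtype.ext (map_add conjVec (x : HalfLine ι) y) }
  rw [Module.finrank, Module.finrank]
  congr 1
  -- The bijection is only semilinear; ranks agree along an additive equivalence that twists scalars
  -- by a bijection.
  exact rank_eq_of_equiv_equiv (starRingEnd ℂ) e (starRingAut (R := ℂ)).bijective fun c x =>
    Subtype.ext (map_smulₛₗ conjVec c (x : HalfLine ι))

/-- An odd operator maps the two sectors into each other, so both components of a zero mode are zero
modes and the kernel is the direct sum of its chiral parts. -/
theorem IsSplitting.finrank_ker_eq_add {ι κ : Type*} [Fintype ι] [DecidableEq ι] [Fintype κ]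
    [DecidableEq κ] {V₀ V₁ : Matrix ι κ ℂ} (hV : IsSplitting V₀ V₁)
    {H : HalfLine ι →L[ℂ] HalfLine ι} (hH : ∀ j j', IsOdd V₀ V₁ (block H j j'))
    (hfin : FiniteDimensional ℂ H.ker) :
    Module.finrank ℂ H.ker = Module.finrank ℂ (site V₁ᴴ ∘L H ∘L site V₀).ker +
      Module.finrank ℂ (site V₀ᴴ ∘L H ∘L site V₁).ker := by
  rw [hV.finrank_ker hH, hV.symm.finrank_ker fun j j' => (hH j j').symm]
  have : FiniteDimensional ℂ ↥(H.ker ⊓ (site V₁ᴴ).ker) := Submodule.finiteDimensional_inf_left _ _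
  have : FiniteDimensional ℂ ↥(H.ker ⊓ (site V₀ᴴ).ker) := Submodule.finiteDimensional_inf_left _ _
  have hinf : (H.ker ⊓ (site V₁ᴴ).ker) ⊓ (H.ker ⊓ (site V₀ᴴ).ker) = ⊥ := by
    refine (Submodule.eq_bot_iff _).2 fun x hx => ?_
    have h1 : site V₁ᴴ x = 0 := hx.1.2
    have h0 : site V₀ᴴ x = 0 := hx.2.2
    rw [← hV.apply_add x, h0, h1, map_zero, map_zero, add_zero]
  have hsup : (H.ker ⊓ (site V₁ᴴ).ker) ⊔ (H.ker ⊓ (site V₀ᴴ).ker) = H.ker := by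
    refine le_antisymm (sup_le inf_le_left inf_le_left) fun x hx => ?_
    have hx : H x = 0 := hx
    have key : ∀ {V V' : Matrix ι κ ℂ}, IsSplitting V V' →
        (∀ j j', IsOdd V V' (block H j j')) → H (site V (site Vᴴ x)) = 0 ∧
          site V'ᴴ (site V (site Vᴴ x)) = 0 := by
      intro V V' hV hH
      have e0 : ∀ y, site V'ᴴ (site V y) = 0 := fun y => by
        rw [site_comp_apply, hV.mul₁₀, site_zero]
        rfl
      have e1 : ∀ y, site Vᴴ (site V y) = y := fun y => by
        rw [site_comp_apply, hV.mul₀₀, site_one]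
        rfl
      have e2 : ∀ y, site V'ᴴ (site V' y) = y := fun y => by
        rw [site_comp_apply, hV.mul₁₁, site_one]
        rfl
      have hH' : ∀ y, H y = site V' (site V'ᴴ (H (site V (site Vᴴ y)))) +
          site V (site Vᴴ (H (site V' (site V'ᴴ y)))) := fun y =>
        congrArg (fun F => F y) (hV.operator_eq hH)
      have h1 := congrArg (site V'ᴴ) (hH' x)
      rw [map_add, e0, e2, hx, map_zero, add_zero] at h1
      refine ⟨?_, e0 _⟩
      rw [hH' (site V (site Vᴴ x)), e1, e0, ← h1]
      simp
    rw [← hV.apply_add x]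
    exact Submodule.add_mem_sup (key hV hH) (key hV.symm fun j j' => (hH j j').symm)
  have := Submodule.finrank_sup_add_finrank_inf_eq (H.ker ⊓ (site V₁ᴴ).ker)
    (H.ker ⊓ (site V₀ᴴ).ker)
  rw [hinf, hsup, finrank_bot, add_zero] at this
  exact this

/-- The columns of `UDIIIadj` of chirality `-1` (for `i = 0`) and `+1` (for `i = 1`). -/
def columnsDIII (i : Fin 2) : Matrix (Fin 2 × Fin 2) (Fin 2) ℂ := UDIIIadj.submatrix id (Prod.mk i)

/-- The numerators of the entries of `UDIIIadj`. -/
def entriesDIII (i : Fin 2) : Matrix (Fin 2 × Fin 2) (Fin 2) ℂ :=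
  Matrix.of fun x s => (![![![![0, -Complex.I], ![-Complex.I, 0]], ![![1, 0], ![0, -1]]],
    ![![![Complex.I, 0], ![0, Complex.I]], ![![0, -1], ![1, 0]]]] :
      Fin 2 → Fin 2 → Fin 2 → Fin 2 → ℂ) x.1 x.2 i s

theorem columnsDIII_eq (i : Fin 2) :
    columnsDIII i = ((1 / Real.sqrt 2 : ℝ) : ℂ) • entriesDIII i := by
  refine Matrix.ext fun ⟨a, b⟩ s => ?_
  fin_cases i <;> fin_cases a <;> fin_cases b <;> fin_cases s <;> rfl

theorem conjTranspose_columnsDIII_mul (i j : Fin 2) :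
    (columnsDIII i)ᴴ * columnsDIII j = if i = j then 1 else 0 := by
  rw [columnsDIII_eq, columnsDIII_eq, Matrix.conjTranspose_smul, star_inv_sqrt_two, Matrix.smul_mul,
    Matrix.mul_smul, smul_smul, inv_sqrt_two_mul_self]
  ext a b
  fin_cases i <;> fin_cases j <;> fin_cases a <;> fin_cases b <;>
    simp [Matrix.mul_apply, Fintype.sum_prod_type, Fin.sum_univ_two, entriesDIII] <;> norm_num

theorem columnsDIII_mul_add :
    columnsDIII 0 * (columnsDIII 0)ᴴ + columnsDIII 1 * (columnsDIII 1)ᴴ = 1 := by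
  simp only [columnsDIII_eq, Matrix.conjTranspose_smul, star_inv_sqrt_two, Matrix.smul_mul,
    Matrix.mul_smul, smul_smul, inv_sqrt_two_mul_self, ← smul_add]
  refine Matrix.ext fun ⟨a, b⟩ ⟨c, d⟩ => ?_
  fin_cases a <;> fin_cases b <;> fin_cases c <;> fin_cases d <;>
    simp [Matrix.mul_apply, Fin.sum_univ_two, entriesDIII] <;> norm_num

/-- Conjugation followed by `τ_x` exchanges the two chirality sectors; in `Fin 2`, `1 - i` is the
other index. This is what makes the off-diagonal block, rather than a diagonal one, skew-symmetric.
-/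
theorem conj_columnsDIII (i : Fin 2) :
    conj (columnsDIII i) =
      (pauliX ⊗ₖ (1 : Matrix (Fin 2) (Fin 2) ℂ)) * columnsDIII (1 - i) := by
  have : conj (((1 / Real.sqrt 2 : ℝ) : ℂ) • entriesDIII i) =
      star ((1 / Real.sqrt 2 : ℝ) : ℂ) • conj (entriesDIII i) :=
    Matrix.ext fun a b => map_mul (starRingEnd ℂ) _ _
  rw [columnsDIII_eq, columnsDIII_eq, this, star_inv_sqrt_two, Matrix.mul_smul]
  congr 1
  refine Matrix.ext fun ⟨a, b⟩ s => ?_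
  fin_cases i <;> fin_cases a <;> fin_cases b <;> fin_cases s <;>
    simp [Matrix.mul_apply, Fintype.sum_prod_type, Fin.sum_univ_two, entriesDIII, conj, pauliX]

theorem chiral_mul_columnsDIII (i : Fin 2) :
    (pauliX ⊗ₖ pauliY) * columnsDIII i = ((-1) ^ (i.val + 1) : ℂ) • columnsDIII i := by
  rw [columnsDIII_eq, Matrix.mul_smul, smul_comm]
  congr 1
  refine Matrix.ext fun ⟨a, b⟩ s => ?_
  fin_cases i <;> fin_cases a <;> fin_cases b <;> fin_cases s <;>
    simp [Matrix.mul_apply, Fintype.sum_prod_type, Fin.sum_univ_two, entriesDIII, pauliX, pauliY]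

variable {P : ℕ}

/-- The columns of the unitary of class DIII on all internal states. -/
def unitaryDIII (P : ℕ) (i : Fin 2) : Matrix ((Fin 2 × Fin 2) × Fin P) (Fin 2 × Fin P) ℂ :=
  columnsDIII i ⊗ₖ 1

theorem isSplitting_unitaryDIII (P : ℕ) : IsSplitting (unitaryDIII P 0) (unitaryDIII P 1) := by
  have h : ∀ i j, (unitaryDIII P i)ᴴ * unitaryDIII P j =
      ((columnsDIII i)ᴴ * columnsDIII j) ⊗ₖ 1 := fun i j => by
    rw [unitaryDIII, unitaryDIII, Matrix.conjTranspose_kronecker, ← Matrix.mul_kronecker_mul,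
      Matrix.conjTranspose_one, mul_one]
  have h' : ∀ i, unitaryDIII P i * (unitaryDIII P i)ᴴ =
      (columnsDIII i * (columnsDIII i)ᴴ) ⊗ₖ 1 := fun i => by
    rw [unitaryDIII, Matrix.conjTranspose_kronecker, ← Matrix.mul_kronecker_mul,
      Matrix.conjTranspose_one, mul_one]
  refine ⟨?_, ?_, ?_, ?_, ?_⟩
  · rw [h, conjTranspose_columnsDIII_mul, if_pos rfl, Matrix.one_kronecker_one]
  · rw [h, conjTranspose_columnsDIII_mul, if_pos rfl, Matrix.one_kronecker_one]
  · rw [h, conjTranspose_columnsDIII_mul, if_neg zero_ne_one, Matrix.zero_kronecker]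
  · rw [h, conjTranspose_columnsDIII_mul, if_neg one_ne_zero, Matrix.zero_kronecker]
  · rw [h', h', ← Matrix.add_kronecker, columnsDIII_mul_add, Matrix.one_kronecker_one]

theorem blockDIII_eq (M : Matrix ((Fin 2 × Fin 2) × Fin P) ((Fin 2 × Fin 2) × Fin P) ℂ) :
    blockDIII M = (unitaryDIII P 1)ᴴ * M * unitaryDIII P 0 :=
  Matrix.ext fun a b => by
    have h : (unitaryDIII P 1)ᴴ a = (UDIIIadjᴴ ⊗ₖ (1 : Matrix (Fin P) (Fin P) ℂ)) ((1, a.1), a.2) :=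
      funext fun x => by
        simp [unitaryDIII, columnsDIII, Matrix.one_apply, eq_comm]
        split_ifs <;> simp
    rw [Matrix.mul_apply]
    simp only [Matrix.mul_apply, h]
    rfl

theorem conj_unitaryDIII (i : Fin 2) :
    conj (unitaryDIII P i) = ((pauliX ⊗ₖ (1 : Matrix (Fin 2) (Fin 2) ℂ)) ⊗ₖ
      (1 : Matrix (Fin P) (Fin P) ℂ)) * unitaryDIII P (1 - i) := by
  rw [unitaryDIII, unitaryDIII, conj_kronecker_one, conj_columnsDIII, ← Matrix.mul_kronecker_mul,
    one_mul]

theorem blockDIII_transpose {M : Matrix ((Fin 2 × Fin 2) × Fin P) ((Fin 2 × Fin 2) × Fin P) ℂ}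
    (hM : M ∈ classDIII P) : ((unitaryDIII P 1)ᴴ * M * unitaryDIII P 0)ᵀ =
      -((unitaryDIII P 1)ᴴ * Mᴴ * unitaryDIII P 0) := by
  refine transpose_block ?_ (conj_unitaryDIII 0) (conj_unitaryDIII 1) hM.1
  rw [Matrix.conjTranspose_kronecker, pauliX_kronecker_conjTranspose, Matrix.conjTranspose_one]

/-- Both constraints involve complex conjugation, and their product does not: it gives the chiral
symmetry `Γ = τ_x σ_y`, which anticommutes with `M`. The first frame has chirality `-1`, hence `ε =
-1`. -/
theorem isOdd_classDIII {M : Matrix ((Fin 2 × Fin 2) × Fin P) ((Fin 2 × Fin 2) × Fin P) ℂ}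
    (hM : M ∈ classDIII P) : IsOdd (unitaryDIII P 0) (unitaryDIII P 1) M := by
  obtain ⟨h1, h2⟩ := hM
  set X : Matrix ((Fin 2 × Fin 2) × Fin P) ((Fin 2 × Fin 2) × Fin P) ℂ :=
    (pauliX ⊗ₖ (1 : Matrix (Fin 2) (Fin 2) ℂ)) ⊗ₖ (1 : Matrix (Fin P) (Fin P) ℂ) with hX
  set Y : Matrix ((Fin 2 × Fin 2) × Fin P) ((Fin 2 × Fin 2) × Fin P) ℂ :=
    ((1 : Matrix (Fin 2) (Fin 2) ℂ) ⊗ₖ pauliY) ⊗ₖ (1 : Matrix (Fin P) (Fin P) ℂ) with hY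
  have hYY : Y * Y = 1 := by
    have : pauliY * pauliY = 1 := by
      ext i j
      fin_cases i <;> fin_cases j <;> simp [pauliY, Matrix.mul_apply, Fin.sum_univ_two]
    rw [hY, ← Matrix.mul_kronecker_mul, ← Matrix.mul_kronecker_mul, this]
    simp
  have hXY : X * Y = (pauliX ⊗ₖ pauliY) ⊗ₖ 1 := by
    rw [hX, hY, ← Matrix.mul_kronecker_mul, ← Matrix.mul_kronecker_mul]
    simp
  have hYX : Y * X = (pauliX ⊗ₖ pauliY) ⊗ₖ 1 := by
    rw [hX, hY, ← Matrix.mul_kronecker_mul, ← Matrix.mul_kronecker_mul]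
    simp
  set Γ : Matrix ((Fin 2 × Fin 2) × Fin P) ((Fin 2 × Fin 2) × Fin P) ℂ :=
    (pauliX ⊗ₖ pauliY) ⊗ₖ (1 : Matrix (Fin P) (Fin P) ℂ) with hΓ
  have hconj : conj M = Y * M * Y := by
    conv_rhs => rw [← h2]
    calc conj M = 1 * conj M * 1 := by simp
      _ = Y * (Y * conj M * Y) * Y := by
        rw [← hYY]
        simp only [Matrix.mul_assoc]
  have hΓM : Γ * M * Γ = -M := by
    rw [← h1, hconj]
    calc Γ * M * Γ = X * Y * M * (Y * X) := by rw [hXY, hYX]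
      _ = X * (Y * M * Y) * X := by simp only [Matrix.mul_assoc]
  have hΓV : ∀ i, Γ * unitaryDIII P i = ((-1) ^ (i.val + 1) : ℂ) • unitaryDIII P i := fun i => by
    rw [unitaryDIII, hΓ, ← Matrix.mul_kronecker_mul, chiral_mul_columnsDIII, one_mul,
      Matrix.smul_kronecker]
  refine isOdd_of_anticomm (Γ := Γ) (ε := -1) (by norm_num) ?_ ?_ ?_ (by simp) hΓM
  · rw [hΓV]
    simp
  · rw [hΓV]
    simp
  · have hx : pauliXᴴ = pauliX := by
      ext i j
      fin_cases i <;> fin_cases j <;> simp [pauliX]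
    have hy : pauliYᴴ = pauliY := by
      ext i j
      fin_cases i <;> fin_cases j <;> simp [pauliY]
    rw [hΓ, Matrix.conjTranspose_kronecker, Matrix.conjTranspose_kronecker, hx, hy,
      Matrix.conjTranspose_one]

/-- The kernel splits into those of the block and of its adjoint. The block is skew-symmetric, so
the two dimensions agree, and half the number of zero modes is the kernel dimension whose parity the
Pfaffian formula gives. -/
theorem numZeroModes_classDIII
    {h : ℤ →₀ Matrix ((Fin 2 × Fin 2) × Fin P) ((Fin 2 × Fin 2) × Fin P) ℂ}
    {W : HalfLine ((Fin 2 × Fin 2) × Fin P) →L[ℂ] HalfLine ((Fin 2 × Fin 2) × Fin P)}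
    (hh : IsGappedBloch (classDIII P) h) (hW : IsBoundaryTerm (classDIII P) W) :
    Even (numZeroModes (toeplitz h + W)) ∧
      (-1 : ℂ) ^ (numZeroModes (toeplitz h + W) / 2) = bulkDIII h := by
  have hs := isSplitting_unitaryDIII P
  have hS : ∀ M ∈ classDIII P, IsOdd (unitaryDIII P 0) (unitaryDIII P 1) M :=
    fun M hM => isOdd_classDIII hM
  have hT : ∀ M ∈ classDIII P, ((unitaryDIII P 1)ᴴ * M * unitaryDIII P 0)ᵀ =
      -((unitaryDIII P 1)ᴴ * Mᴴ * unitaryDIII P 0) := fun M hM => blockDIII_transpose hM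
  have hdet : ∀ k, ((unitaryDIII P 1)ᴴ * bloch h k * unitaryDIII P 0).det ≠ 0 := fun k =>
    hs.det_ne_zero (isOdd_bloch (fun r => hS _ (hh.symmetric r)) k) (hh.gapped k)
  have key := neg_one_pow_ker_block hh hW hT hdet
  have hker := hs.finrank_ker_eq_add (isOdd_block hh hW hS) (finiteDimensional_zeroModes hh hW)
  have hadj := finrank_ker_adjoint (isSkewOperator_block hh hW hT)
  have hsa : ContinuousLinearMap.adjoint (toeplitz h + W) = toeplitz h + W := by
    rw [map_add, adjoint_toeplitz hh.hermitian, hW.hermitian.adjoint_eq]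
  rw [ContinuousLinearMap.adjoint_comp, ContinuousLinearMap.adjoint_comp, hsa, adjoint_site,
    adjoint_site, Matrix.conjTranspose_conjTranspose, ContinuousLinearMap.comp_assoc] at hadj
  rw [hadj] at hker
  have hnum : numZeroModes (toeplitz h + W) = _ := hker
  rw [hnum]
  refine ⟨Even.add_self _, ?_⟩
  rw [← two_mul, Nat.mul_div_cancel_left _ two_pos, key, bulkDIII]
  simp only [blockDIII_eq]

end ClassDIII

end BBC

end

theorem mainTheorem1 (P : ℕ) :
    (∀ (h : ℤ →₀ Matrix (Fin 2 × Fin P) (Fin 2 × Fin P) ℂ)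
      (W : BBC.HalfLine (Fin 2 × Fin P) →L[ℂ] BBC.HalfLine (Fin 2 × Fin P)),
      BBC.IsGappedBloch (BBC.classAIII P) h → BBC.IsBoundaryTerm (BBC.classAIII P) W →
        FiniteDimensional ℂ (BBC.zeroModes (BBC.toeplitz h + W)) ∧
        (BBC.chiralBoundary (BBC.pauliZ ⊗ₖ 1) (BBC.toeplitz h + W) : ℂ) = BBC.bulkAIII h) ∧
    (∀ (h : ℤ →₀ Matrix (Fin 2 × Fin 2 × Fin P) (Fin 2 × Fin 2 × Fin P) ℂ)
      (W : BBC.HalfLine (Fin 2 × Fin 2 × Fin P) →L[ℂ] BBC.HalfLine (Fin 2 × Fin 2 × Fin P)),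
      BBC.IsGappedBloch (BBC.classBDI P) h → BBC.IsBoundaryTerm (BBC.classBDI P) W →
        FiniteDimensional ℂ (BBC.zeroModes (BBC.toeplitz h + W)) ∧
        (BBC.chiralBoundary (1 ⊗ₖ (BBC.pauliZ ⊗ₖ 1)) (BBC.toeplitz h + W) : ℂ) =
          BBC.bulkBDI h) ∧
    (∀ (h : ℤ →₀ Matrix (Fin 2 × Fin 2 × Fin P) (Fin 2 × Fin 2 × Fin P) ℂ)
      (W : BBC.HalfLine (Fin 2 × Fin 2 × Fin P) →L[ℂ] BBC.HalfLine (Fin 2 × Fin 2 × Fin P)),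
      BBC.IsGappedBloch (BBC.classCII P) h → BBC.IsBoundaryTerm (BBC.classCII P) W →
        FiniteDimensional ℂ (BBC.zeroModes (BBC.toeplitz h + W)) ∧
        (BBC.chiralBoundary (BBC.pauliZ ⊗ₖ 1) (BBC.toeplitz h + W) : ℂ) = BBC.bulkCII h) ∧
    (∀ (h : ℤ →₀ Matrix (Fin 2 × Fin P) (Fin 2 × Fin P) ℂ)
      (W : BBC.HalfLine (Fin 2 × Fin P) →L[ℂ] BBC.HalfLine (Fin 2 × Fin P)),
      BBC.IsGappedBloch (BBC.classD P) h → BBC.IsBoundaryTerm (BBC.classD P) W →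
        FiniteDimensional ℂ (BBC.zeroModes (BBC.toeplitz h + W)) ∧
        (-1 : ℂ) ^ BBC.numZeroModes (BBC.toeplitz h + W) = BBC.bulkD h) ∧
    (∀ (h : ℤ →₀ Matrix ((Fin 2 × Fin 2) × Fin P) ((Fin 2 × Fin 2) × Fin P) ℂ)
      (W : BBC.HalfLine ((Fin 2 × Fin 2) × Fin P) →L[ℂ] BBC.HalfLine ((Fin 2 × Fin 2) × Fin P)),
      BBC.IsGappedBloch (BBC.classDIII P) h → BBC.IsBoundaryTerm (BBC.classDIII P) W →
        FiniteDimensional ℂ (BBC.zeroModes (BBC.toeplitz h + W)) ∧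
        Even (BBC.numZeroModes (BBC.toeplitz h + W)) ∧
        (-1 : ℂ) ^ (BBC.numZeroModes (BBC.toeplitz h + W) / 2) = BBC.bulkDIII h) := by
  refine ⟨fun h W hh hW => ⟨BBC.finiteDimensional_zeroModes hh hW, ?_⟩,
    fun h W hh hW => ⟨BBC.finiteDimensional_zeroModes hh hW, ?_⟩,
    fun h W hh hW => ⟨BBC.finiteDimensional_zeroModes hh hW, ?_⟩,
    fun h W hh hW => ⟨BBC.finiteDimensional_zeroModes hh hW, ?_⟩,
    fun h W hh hW => ⟨BBC.finiteDimensional_zeroModes hh hW, ?_⟩⟩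
  · exact BBC.chiralBoundary_pauliZ (fun M hM => hM) hh hW
  · exact BBC.chiralBoundary_classBDI hh hW
  · exact BBC.chiralBoundary_pauliZ (fun M hM => hM.2) hh hW
  · exact BBC.neg_one_pow_numZeroModes_classD hh hW
  · exact BBC.numZeroModes_classDIII hh hW
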